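/- **Notation.** Let $\Sigma=\{0,1\}$, and let $\mathrm{poly}$ be the set of functions $\mathbb N\to\mathbb N$ given by polynomials with integer coefficients. Write $u\sqsubseteq v$ if $u$ is a prefix of $v$, and $s[0:n-1]$ for the first $n$ letters of $s$. Machines are deterministic Turing machines (in the multi-stack model, where two stacks form a tape) with one input stack per input; $\mathbf P$ is the class of languages $L\subseteq\Sigma^*$ decided in polynomial time. **Reasonable advice bounds.** A set $\mathcal F$ of non-decreasing functions $\mathbb N\to\mathbb N$ is a class of reasonable advice bounds if for every $f\in\mathcal F$: (1) $f(n)\le n$ for all large $n$; (2) there is $g\in\mathcal F$, computable in time polynomial in $n$, with $f(n)\le g(n)$ for all large $n$; (3) for every $p\in\mathrm{poly}$ there is $g\in\mathcal F$ with $f(p(n))\le g(n)$ for all large $n$. We also assume that $\mathcal F$ is unbounded up to constants: for every $c\in\mathbb N$ some $f\in\mathcal F$ satisfies $f(n)\ge c$ for all large $n$. **Advice classes.** $L\in\mathbf P/f^*$ if there are $L'\in\mathbf P$ and $\alpha:\mathbb N\to\Sigma^*$ with $|\alpha(n)|=f(n)$ and $\alpha(m)\sqsubseteq\alpha(n)$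 for $m\le n$, such that for all $n$ and all $w\in\Sigma^n$: $w\in L\Leftrightarrow\langle w,\alpha(n)\rangle\in L'$, and $\langle w,\alpha(n)\rangle\in L'\Leftrightarrow\langle w,a\rangle\in L'$ whenever $\alpha(n)\sqsubseteq a\sqsubseteq\alpha(k)$ for some $k\ge n$. Let $\mathbf P/\mathcal F^*=\bigcup_{f\in\mathcal F}\mathbf P/f^*$. **Kolmogorov words and reals.** Let $U$ be a universal machine with two inputs and polynomial overhead: for every machine $M$ with two inputs there are $p\in\Sigma^*$ and $q\in\mathrm{poly}$ such that, whenever $M$ outputs $y$ on $(x,z)$ within time $t$, $U$ outputs $y$ on $(px,z)$ within time $q(t)$. An infinite word $s\in\Sigma^\omega$ lies in $\bar K^f_g$ if there is $\beta\in\Sigma^\omega$ such that for all but finitely many $n$ and all $m\ge f(n)$, $U$ on inputs $\beta[0:m-1]$ and $n$ (in unary) outputs $s[0:n-1]$ within time $g(n)$. Let $\bar K^{\mathcal F}_{\mathrm{poly}}=\bigcup_{f\in\mathcal F,\,g\in\mathrm{poly}}\bar K^f_g$ and $K^{\mathcal F}_{\mathrm{poly}}=\delta_4(\bar K^{\mathcal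 F}_{\mathrm{poly}})$, where $\delta_4(s)=\sum_{i\ge0}(2s_i+1)/4^{i+1}$ is injective on $\Sigma^\omega$. **Networks.** A network has hidden cells $h_0,\dots,h_{K-1}$ ($K\ge1$) with initial values $\mathbf h^0\in([0,1]\cap\mathbb Q)^K$ and weight matrices $W_{in}^t\in\mathbb R^{K\times3}$, $W_{res}^t\in\mathbb R^{K\times K}$, $W_{out}^t\in\mathbb R^{2\times K}$. Its dynamics is $$\mathbf h^{t+1}=\sigma\bigl(W_{in}^t(x_0^t,x_1^t,1)^{\mathsf T}+W_{res}^t\mathbf h^t\bigr),\qquad \mathbf y^{t+1}=\theta\bigl(W_{out}^t\mathbf h^{t+1}\bigr),$$ applied componentwise, where $\sigma(x)=\min(1,\max(0,x))$, and $\theta(x)=0$ for $x<0$, $\theta(x)=1$ for $x\ge1$, and $\theta$ is undefined on $[0,1)$. On input $w\in\Sigma^n$, $(x_0^t,x_1^t)=(w_t,1)$ for $t<n$ and $(0,0)$ for $t\ge n$. The word $w$ is accepted (rejected) in time $\tau\ge1$ if all outputs $\mathbf y^t$, $t\ge1$, are defined, $\mathbf y^\tau=(1,1)$ (resp. $(0,1)$)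 and $\mathbf y^t=(0,0)$ for all $t\ne\tau$. The network decides $L$ in time $f$ if every $w\in L$ is accepted and every $w\notin L$ is rejected in some time $\tau\le f(|w|)$. $\mathbf{ANN}[R,\mathrm{poly}]$, for $R\subseteq\mathbb R$, is the class of languages decided in a time $f\in\mathrm{poly}$ by networks all of whose weights are static and rational, except that the bias of $h_0$ (the weight from the constant input $1$ to $h_0$) is a static element of $R$. $\mathbf{ENN}[E,\mathrm{poly}]$, for $E\subseteq\Sigma^\omega$, is defined in the same way, except that the bias of $h_0$ at time $t$ is $e_t$, for some $e\in E$. **Theorem.** Let $U$ and $\mathcal F$ be as above. Then $$\mathbf P/\mathcal F^*=\mathbf{ANN}\bigl[K^{\mathcal F}_{\mathrm{poly}},\mathrm{poly}\bigr]=\mathbf{ENN}\bigl[\bar K^{\mathcal F}_{\mathrm{poly}},\mathrm{poly}\bigr].$$ Moreover, if every $f\in\mathcal F$ is computable in time polynomial in $n$, then $\mathbf P/\mathcal F^*$ does not change when, in its definition, only the words $a=\alpha(k)$ with $k\ge n$ are considered. -/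

import Mathlib

open Filter

/-! Turing machines. -/

/-- A deterministic Turing machine with read access to input words indexed by `ι`, in Mathlib's
multi-stack model `Turing.TM2` (the model of Mathlib's polynomial-time computability; two stacks
are a tape). There are finitely many stacks: one for each input word, and the work stacks `W`, one
of which is the output stack. The stack symbols are the bits together with a finite set `A` of
auxiliary symbols. -/
structure Machine (ι : Type) [DecidableEq ι] where
  /-- work stacks -/
  W : Type
  /-- auxiliary stack symbols -/
  A : Type
  /-- program labels -/
  Λ : Type
  /-- states of the finite internal memory -/
  σ : Type
  [decW : DecidableEq W]
  [finW : Fintype W]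
  [finA : Fintype A]
  [finΛ : Fintype Λ]
  [finσ : Fintype σ]
  /-- output stack -/
  out : W
  /-- initial label -/
  main : Λ
  /-- initial memory state -/
  start : σ
  /-- the program -/
  prog : Λ → Turing.TM2.Stmt (fun _ : ι ⊕ W => Bool ⊕ A) Λ σ

attribute [instance] Machine.decW Machine.finW Machine.finA Machine.finΛ Machine.finσ

namespace Machine

variable {ι : Type} [DecidableEq ι]

abbrev Cfg (M : Machine ι) : Type :=
  Turing.TM2.Cfg (fun _ : ι ⊕ M.W => Bool ⊕ M.A) M.Λ M.σ

/-- Initial configuration: the `i`-th input word stands on the `i`-th input stack, its first letter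
on top, and the work stacks are empty. -/
def init (M : Machine ι) (x : ι → List Bool) : M.Cfg where
  l := some M.main
  var := M.start
  stk := Sum.elim (fun i => (x i).map Sum.inl) (fun _ => [])

/-- On input `x` the machine halts after at most `t` steps, with exactly the word `y` on its output
stack (the first letter on top). -/
def OutputsIn (M : Machine ι) (x : ι → List Bool) (y : List Bool) (t : ℕ) : Prop :=
  ∃ c : M.Cfg, c.l = none ∧ c.stk (Sum.inr M.out) = y.map Sum.inl ∧
    Nonempty (StateTransition.EvalsToInTime (Turing.TM2.step M.prog) (M.init x) (some c) t)

/-- `M` decides the language `L` in time `t`. -/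
def DecidesIn (M : Machine Unit) (L : Language Bool) (t : ℕ → ℕ) : Prop :=
  ∀ w : List Bool,
    (w ∈ L → M.OutputsIn (fun _ => w) [true] (t w.length)) ∧
    (w ∉ L → M.OutputsIn (fun _ => w) [false] (t w.length))

end Machine

/-- The functions `ℕ → ℕ` that are given by a polynomial with integer coefficients. -/
def poly : Set (ℕ → ℕ) := {f | ∃ p : Polynomial ℤ, ∀ n : ℕ, (f n : ℤ) = p.eval (n : ℤ)}

/-- The class **P**. -/
def classP : Set (Language Bool) := {L | ∃ M : Machine Unit, ∃ t ∈ poly, M.DecidesIn L t}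

/-- The number `n` in unary. -/
def unary (n : ℕ) : List Bool := List.replicate n true

/-- `g n` is computable in time polynomial in `n`. -/
def PolyTimeComputable (g : ℕ → ℕ) : Prop :=
  ∃ M : Machine Unit, ∃ t ∈ poly, ∀ n, M.OutputsIn (fun _ => unary n) (unary (g n)) (t n)

/-! Classes with advice. -/

/-- The pairing `⟨w, a⟩` of words: the letters of `w` doubled, the separator `01`, then `a`. -/
def pairWord (w a : List Bool) : List Bool := w.flatMap (fun b => [b, b]) ++ false :: true :: a

/-- `α` is a prefix advice of size `f`. -/
def IsPrefixAdvice (α : ℕ → List Bool) (f : ℕ → ℕ) : Prop :=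
  (∀ m n, m ≤ n → α m <+: α n) ∧ ∀ n, (α n).length = f n

/-- `C / f*`: prefix advice of size `f`, where an advice word `α n` may be replaced, for inputs of
length `n`, by every longer prefix of the advice sequence, i.e. by every word `a` between `α n`
and some later `α k`. -/
def adviceStar (C : Set (Language Bool)) (f : ℕ → ℕ) : Set (Language Bool) :=
  {L | ∃ L' ∈ C, ∃ α : ℕ → List Bool, IsPrefixAdvice α f ∧
    ∀ (n : ℕ) (w : List Bool), w.length = n →
      (w ∈ L ↔ pairWord w (α n) ∈ L') ∧
      ∀ k ≥ n, ∀ a : List Bool, α n <+: a → a <+: α k →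
        (pairWord w (α n) ∈ L' ↔ pairWord w a ∈ L')}

/-- `C / 𝓕*`. -/
def adviceStarClass (C : Set (Language Bool)) (𝓕 : Set (ℕ → ℕ)) : Set (Language Bool) :=
  {L | ∃ f ∈ 𝓕, L ∈ adviceStar C f}

/-- The variant of `C / f*` in which `α n` may be replaced by the later advice words `α k` only,
and nothing is required at prefixes of intermediate length. -/
def weakAdviceStar (C : Set (Language Bool)) (f : ℕ → ℕ) : Set (Language Bool) :=
  {L | ∃ L' ∈ C, ∃ α : ℕ → List Bool, IsPrefixAdvice α f ∧
    ∀ (n : ℕ) (w : List Bool), w.length = n →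
      (w ∈ L ↔ pairWord w (α n) ∈ L') ∧
      ∀ k ≥ n, (pairWord w (α n) ∈ L' ↔ pairWord w (α k) ∈ L')}

def weakAdviceStarClass (C : Set (Language Bool)) (𝓕 : Set (ℕ → ℕ)) : Set (Language Bool) :=
  {L | ∃ f ∈ 𝓕, L ∈ weakAdviceStar C f}

/-! Kolmogorov complexity of infinite words and of reals. -/

/-- The word of the first `n` letters of `s`. -/
def prefixWord (s : ℕ → Bool) (n : ℕ) : List Bool := (List.range n).map s

/-- `U` is universal with polynomial overhead: every machine `M` has a program word `p` such that
`U` with `p` written in front of the first input does what `M` does, in time polynomial in the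
running time of `M`. -/
def Machine.IsUniversal (U : Machine (Fin 2)) : Prop :=
  ∀ M : Machine (Fin 2), ∃ p : List Bool, ∃ q ∈ poly,
    ∀ (x z y : List Bool) (t : ℕ), M.OutputsIn ![x, z] y t → U.OutputsIn ![p ++ x, z] y (q t)

/-- The set `K̄^f_g` of infinite words `s` whose first `n` bits are computed by `U`, in time `g n`,
from `n` and any prefix of length at least `f n` of some fixed infinite word `β`, for all but
finitely many `n`. -/
def KolmogorovWord (U : Machine (Fin 2)) (f g : ℕ → ℕ) : Set (ℕ → Bool) :=
  {s | ∃ β : ℕ → Bool, ∀ᶠ n in atTop, ∀ m ≥ f n,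
    U.OutputsIn ![prefixWord β m, unary n] (prefixWord s n) (g n)}

/-- `K̄^𝓕_𝓖`. -/
def KolmogorovWords (U : Machine (Fin 2)) (𝓕 𝓖 : Set (ℕ → ℕ)) : Set (ℕ → Bool) :=
  {s | ∃ f ∈ 𝓕, ∃ g ∈ 𝓖, s ∈ KolmogorovWord U f g}

/-- The base-4 encoding `δ₄` of infinite words. It is injective, with range `Δ`. -/
noncomputable def delta4 (s : ℕ → Bool) : ℝ :=
  ∑' i : ℕ, (2 * (if s i then 1 else 0) + 1 : ℝ) / 4 ^ (i + 1)

/-- `K^𝓕_𝓖`: the reals of `Δ` whose base-4 expansion lies in `K̄^𝓕_𝓖`. -/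
noncomputable def KolmogorovReals (U : Machine (Fin 2)) (𝓕 𝓖 : Set (ℕ → ℕ)) : Set ℝ :=
  delta4 '' KolmogorovWords U 𝓕 𝓖

/-! Recurrent neural networks. -/

/-- The linear sigmoid. -/
noncomputable def linSigmoid (x : ℝ) : ℝ := if x < 0 then 0 else if x ≤ 1 then x else 1

/-- The hard threshold: `0` below `0`, `1` from `1` on, and without a value on `[0, 1)`. -/
noncomputable def hardThreshold (x : ℝ) : Option Bool :=
  if x < 0 then some false else if 1 ≤ x then some true else none

/-- A recurrent neural network with two input cells, `K + 1` hidden cells, two output cells and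
weights that may depend on the time. The last column of `Win` holds the biases. -/
structure RNN where
  K : ℕ
  Win : ℕ → Matrix (Fin (K + 1)) (Fin 3) ℝ
  Wres : ℕ → Matrix (Fin (K + 1)) (Fin (K + 1)) ℝ
  Wout : ℕ → Matrix (Fin 2) (Fin (K + 1)) ℝ
  h₀ : Fin (K + 1) → ℝ
  h₀_mem : ∀ i, h₀ i ∈ Set.Icc (0 : ℝ) 1

namespace RNN

/-- The input at time `t` when the word `w` is presented: data bit and validation bit. -/
def input (w : List Bool) (t : ℕ) : Fin 2 → ℝ :=
  if h : t < w.length then ![if w[t] then 1 else 0, 1] else ![0, 0]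

/-- The hidden state at time `t` on input `w`. -/
noncomputable def state (N : RNN) (w : List Bool) : ℕ → Fin (N.K + 1) → ℝ
  | 0 => N.h₀
  | t + 1 => fun i => linSigmoid
      ((N.Win t).mulVec ![input w t 0, input w t 1, 1] i + (N.Wres t).mulVec (N.state w t) i)

/-- The output at time `t + 1` on input `w`: data bit and validation bit. -/
noncomputable def output (N : RNN) (w : List Bool) (t : ℕ) : Fin 2 → Option Bool :=
  fun j => hardThreshold ((N.Wout t).mulVec (N.state w (t + 1)) j)

/-- `w` is accepted (`b = true`) or rejected (`b = false`) in time `τ`: the output is `(b, 1)` at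
time `τ` and `(0, 0)` at all other times `1, 2, 3, …`. -/
def Answers (N : RNN) (w : List Bool) (b : Bool) (τ : ℕ) : Prop :=
  1 ≤ τ ∧ ∀ t, N.output w t =
    if t + 1 = τ then ![some b, some true] else ![some false, some false]

/-- `N` decides the language `L` in time `f`. -/
def DecidesIn (N : RNN) (L : Language Bool) (f : ℕ → ℕ) : Prop :=
  ∀ w : List Bool,
    (w ∈ L → ∃ τ ≤ f w.length, N.Answers w true τ) ∧
    (w ∉ L → ∃ τ ≤ f w.length, N.Answers w false τ)

/-- All weights except possibly the bias of the hidden cell `0` are static and rational, and so are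
the initial activation values. -/
def RationalExceptBias (N : RNN) : Prop :=
  (∀ i j, ¬(i = 0 ∧ j = 2) → ∃ q : ℚ, ∀ t, N.Win t i j = q) ∧
  (∀ i j, ∃ q : ℚ, ∀ t, N.Wres t i j = q) ∧
  (∀ i j, ∃ q : ℚ, ∀ t, N.Wout t i j = q) ∧
  ∀ i, ∃ q : ℚ, N.h₀ i = q

/-- `ANN[r]`: the bias of the hidden cell `0` is static and equal to `r`. -/
def IsANN (N : RNN) (r : ℝ) : Prop :=
  N.RationalExceptBias ∧ ∀ t, N.Win t 0 2 = r

/-- `ENN[e]`: the bias of the hidden cell `0` at time `t` is the bit `e t`. (The weights are then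
bounded, uniformly in `t`.) -/
def IsENN (N : RNN) (e : ℕ → Bool) : Prop :=
  N.RationalExceptBias ∧ ∀ t, N.Win t 0 2 = if e t then 1 else 0

end RNN

/-- The class **ANN**`[R, 𝓕]` of languages. -/
def classANN (R : Set ℝ) (𝓕 : Set (ℕ → ℕ)) : Set (Language Bool) :=
  {L | ∃ r ∈ R, ∃ f ∈ 𝓕, ∃ N : RNN, N.IsANN r ∧ N.DecidesIn L f}

/-- The class **ENN**`[E, 𝓕]` of languages. -/
def classENN (E : Set (ℕ → Bool)) (𝓕 : Set (ℕ → ℕ)) : Set (Language Bool) :=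
  {L | ∃ e ∈ E, ∃ f ∈ 𝓕, ∃ N : RNN, N.IsENN e ∧ N.DecidesIn L f}

/-- Classes of reasonable advice bounds (non-decreasing functions; inequalities are required for
all sufficiently large arguments). -/
structure IsReasonable (𝓕 : Set (ℕ → ℕ)) : Prop where
  monotone : ∀ f ∈ 𝓕, Monotone f
  sublinear : ∀ f ∈ 𝓕, ∀ᶠ n in atTop, f n ≤ n
  dominated : ∀ f ∈ 𝓕, ∃ g ∈ 𝓕, (∀ᶠ n in atTop, f n ≤ g n) ∧ PolyTimeComputable g
  comp_poly : ∀ f ∈ 𝓕, ∀ p ∈ poly, ∃ g ∈ 𝓕, ∀ᶠ n in atTop, f (p n) ≤ g n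

/-! Structured programs on Boolean stacks and their compilation to machines. -/

/-! The three classes are linked by a cycle of inclusions: advice into evolving networks, these into
networks with one real weight, these back into advice.

Advice to evolving networks (`adviceStarClass_subset_classENN`). Prefix advice of unbounded length
consists of prefixes of one infinite word `A`. A word `s` is made from `A` by thinning: its `i`-th
block of two letters is a marker, followed by the next letter of `A` if fewer than `g i` letters are
known so far. Here `g` is a polynomial-time computable bound of the class, eventually above `f (4 n
+ 8)`. The first `n` letters of `s` need only about `g n` letters of `A`, so `s` has small
complexity; yet they contain at least `f n` letters of `A`, hence usable advice. The recovered
prefix may be longer than the advice word, and its length need not be one of the advice lengths;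
this is why the definition of the advice class admits all intermediate words. No closure under added
constants is assumed, so the program for the universal machine overwrites the beginning of `A`
instead of preceding it; the lost letters are built into the decision procedure
(`codeWord_mem_KolmogorovWords`). Bounded advice is eventually constant and needs no information
from the weights.

It remains to let a network carry out a polynomial-time decision from the input and an equally long
prefix of the bias word (`PT.mem_classENN`). A machine is first replaced by one that has only stacks
of bits, its control included. The network stores a stack as a number with base-4 digits 1 and 3;
the gaps between such numbers let saturated linear maps read tops, test emptiness, push and pop. One
machine step takes three time steps.

Evolving to real weights (`classENN_subset_classANN`). The real bias is admitted once and then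
suppressed, and a few cells strip off one base-4 digit per time step. The simulated network receives
these bits as its bias, with a delay of two.

Real weights to advice (`classANN_subset_adviceStarClass`). A perturbation of the bias grows at most
by a constant factor per step (`abs_state_sub_le`), so polynomially many digits determine all
outputs up to the answer, the threshold having a gap. The truncated network is run in exact rational
arithmetic. The digits are computed by the universal machine from a prefix of its input word; every
longer prefix serves as well, which is exactly the stability required of the advice.

If the bounds are computable, overlong advice can be cut back to its proper length, which gives the
last claim. Polynomial-time algorithms are composed throughout by the closure properties of `PT`;
`PT.exists_machine` and `PT.exists_sim` pass between `PT` and machines. -/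

/-- Structured programs on Boolean stacks. -/
inductive Prog (K : Type) : Type
  | skip : Prog K
  | push (k : K) (b : Bool) : Prog K
  | pop (k : K) : Prog K
  | seq (p q : Prog K) : Prog K
  | case (k : K) (p q r : Prog K) : Prog K
  | loop (k : K) (p : Prog K) : Prog K

/-- `Exec p s s' t`: the program `p` started in the state `s` stops in the state `s'` after `t`
steps. `case k p q r` runs `p`, `q` or `r` if the stack `k` is empty, has top `false` or has top
`true`; `loop k p` runs `p` as long as the stack `k` is not empty. -/
inductive Exec {K : Type} [DecidableEq K] :
    Prog K → (K → List Bool) → (K → List Bool) → ℕ → Prop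
  | skip (s) : Exec .skip s s 1
  | push (s k b) : Exec (.push k b) s (Function.update s k (b :: s k)) 1
  | pop (s k) : Exec (.pop k) s (Function.update s k (s k).tail) 1
  | seq {p q s s' s'' t t'} : Exec p s s' t → Exec q s' s'' t' → Exec (.seq p q) s s'' (t + t')
  | case_nil {k p q r s s' t} : s k = [] → Exec p s s' t → Exec (.case k p q r) s s' (t + 1)
  | case_false {k p q r s s' t l} : s k = false :: l → Exec q s s' t →
      Exec (.case k p q r) s s' (t + 1)
  | case_true {k p q r s s' t l} : s k = true :: l → Exec r s s' t →
      Exec (.case k p q r) s s' (t + 1)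
  | loop_nil {k p s} : s k = [] → Exec (.loop k p) s s 1
  | loop_cons {k p s s' s'' t t'} : s k ≠ [] → Exec p s s' t → Exec (.loop k p) s' s'' t' →
      Exec (.loop k p) s s'' (t + t' + 1)

namespace Prog

variable {K K' : Type}

/-- Renaming of stacks. -/
def map (φ : K → K') : Prog K → Prog K'
  | skip => skip
  | push k b => push (φ k) b
  | pop k => pop (φ k)
  | seq p q => seq (p.map φ) (q.map φ)
  | case k p q r => case (φ k) (p.map φ) (q.map φ) (r.map φ)
  | loop k p => loop (φ k) (p.map φ)

/-- The stacks that a program uses. -/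
def regs : Prog K → Set K
  | skip => ∅
  | push k _ => {k}
  | pop k => {k}
  | seq p q => p.regs ∪ q.regs
  | case k p q r => {k} ∪ (p.regs ∪ (q.regs ∪ r.regs))
  | loop k p => {k} ∪ p.regs

theorem finite_regs (p : Prog K) : p.regs.Finite := by
  induction p with
  | skip => exact Set.finite_empty
  | push | pop => exact Set.finite_singleton _
  | seq p q hp hq => exact hp.union hq
  | case k p q r hp hq hr => exact (Set.finite_singleton _).union (hp.union (hq.union hr))
  | loop k p hp => exact (Set.finite_singleton _).union hp

/-- Labels of the machine program of a structured program. -/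
def Lab : Prog K → Type
  | skip => Unit
  | push _ _ => Unit
  | pop _ => Unit
  | seq p q => p.Lab ⊕ q.Lab
  | case _ p q r => Unit ⊕ p.Lab ⊕ q.Lab ⊕ r.Lab
  | loop _ p => Unit ⊕ p.Lab

instance finite_Lab : ∀ p : Prog K, Finite p.Lab
  | skip => inferInstanceAs (Finite Unit)
  | push _ _ => inferInstanceAs (Finite Unit)
  | pop _ => inferInstanceAs (Finite Unit)
  | seq p q => by
    have := finite_Lab p; have := finite_Lab q
    exact inferInstanceAs (Finite (p.Lab ⊕ q.Lab))
  | case _ p q r => by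
    have := finite_Lab p; have := finite_Lab q; have := finite_Lab r
    exact inferInstanceAs (Finite (Unit ⊕ p.Lab ⊕ q.Lab ⊕ r.Lab))
  | loop _ p => by
    have := finite_Lab p
    exact inferInstanceAs (Finite (Unit ⊕ p.Lab))

/-- The label at which a program starts. -/
def entry : ∀ p : Prog K, p.Lab
  | skip => ()
  | push _ _ => ()
  | pop _ => ()
  | seq p _ => .inl p.entry
  | case _ _ _ _ => .inl ()
  | loop _ _ => .inl ()

/-- The finite memory holds just the top seen by the last `peek`, for the `goto` that follows it. -/
abbrev MStmt (K L : Type) : Type :=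
  Turing.TM2.Stmt (fun _ : K => Bool ⊕ Empty) L (Option Bool)

/-- The top of a stack, forgetting that there are no auxiliary symbols. -/
def topBit (o : Option (Bool ⊕ Empty)) : Option Bool := o.map (Sum.elim id Empty.elim)

/-- Machine code of a program whose labels are embedded by `e` and which is left towards `x`. -/
def code {L : Type} : (p : Prog K) → (e : p.Lab → L) → (x : L) → p.Lab → MStmt K L
  | skip, _, x, _ => .goto fun _ => x
  | push k b, _, x, _ => .push k (fun _ => .inl b) (.goto fun _ => x)
  | pop k, _, x, _ => .pop k (fun v _ => v) (.goto fun _ => x)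
  | seq p q, e, x, .inl l => code p (fun i => e (.inl i)) (e (.inr q.entry)) l
  | seq _ q, e, x, .inr l => code q (fun i => e (.inr i)) x l
  | case k p q r, e, _, .inl _ => .peek k (fun _ o => topBit o) (.goto fun v =>
      match v with
      | none => e (.inr (.inl p.entry))
      | some false => e (.inr (.inr (.inl q.entry)))
      | some true => e (.inr (.inr (.inr r.entry))))
  | case _ p _ _, e, x, .inr (.inl l) => code p (fun i => e (.inr (.inl i))) x l
  | case _ _ q _, e, x, .inr (.inr (.inl l)) => code q (fun i => e (.inr (.inr (.inl i)))) x l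
  | case _ _ _ r, e, x, .inr (.inr (.inr l)) => code r (fun i => e (.inr (.inr (.inr i)))) x l
  | loop k p, e, x, .inl _ => .peek k (fun _ o => topBit o) (.goto fun v =>
      match v with
      | none => x
      | some _ => e (.inr p.entry))
  | loop _ p, e, _, .inr l => code p (fun i => e (.inr i)) (e (.inl ())) l

end Prog

namespace Exec

variable {K K' : Type} [DecidableEq K] [DecidableEq K']

theorem length_le {p : Prog K} {s s' : K → List Bool} {t : ℕ} (h : Exec p s s' t) (k : K) :
    (s' k).length ≤ (s k).length + t := by
  induction h with
  | skip | loop_nil => omega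
  | push s j b => by_cases hk : k = j <;> simp [hk]
  | pop s j => by_cases hk : k = j <;> simp [hk]; omega
  | _ => omega

/-- Injectivity is needed only on a set containing the stacks in use, so that infinitely many
registers can be folded into the finitely many stacks of a machine. That all other stacks are
untouched lets two programs run side by side. -/
theorem map {p : Prog K} {s s' : K → List Bool} {t : ℕ} (h : Exec p s s' t) (φ : K → K')
    {D : Set K} (hφ : Set.InjOn φ D) (hD : p.regs ⊆ D) (S : K' → List Bool)
    (hS : ∀ k ∈ D, S (φ k) = s k) :
    ∃ S', Exec (p.map φ) S S' t ∧ (∀ k ∈ D, S' (φ k) = s' k) ∧ ∀ k, k ∉ φ '' D → S' k = S k := by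
  induction h generalizing S with
  | skip => exact ⟨S, .skip _, hS, fun _ _ => rfl⟩
  | push s k b =>
    have hk : k ∈ D := hD rfl
    refine ⟨_, .push _ _ _, fun j hj => ?_, fun j hj => ?_⟩
    · by_cases h : j = k
      · subst h; simp [hS j hj]
      · have : φ j ≠ φ k := fun e => h (hφ hj hk e)
        simp [h, this, hS j hj]
    · exact Function.update_of_ne (fun e => hj ⟨k, hk, e.symm⟩) _ _
  | pop s k =>
    have hk : k ∈ D := hD rfl
    refine ⟨_, .pop _ _, fun j hj => ?_, fun j hj => ?_⟩
    · by_cases h : j = k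
      · subst h; simp [hS j hj]
      · have : φ j ≠ φ k := fun e => h (hφ hj hk e)
        simp [h, this, hS j hj]
    · exact Function.update_of_ne (fun e => hj ⟨k, hk, e.symm⟩) _ _
  | seq _ _ ih₁ ih₂ =>
    obtain ⟨S₁, h₁, h₁', h₁''⟩ := ih₁ (fun _ h => hD (.inl h)) S hS
    obtain ⟨S₂, h₂, h₂', h₂''⟩ := ih₂ (fun _ h => hD (.inr h)) S₁ h₁'
    exact ⟨S₂, .seq h₁ h₂, h₂', fun k hk => (h₂'' k hk).trans (h₁'' k hk)⟩
  | case_nil hk _ ih =>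
    obtain ⟨S₁, h₁, h₁', h₁''⟩ := ih (fun _ h => hD (.inr (.inl h))) S hS
    exact ⟨S₁, .case_nil (by rw [hS _ (hD (.inl rfl)), hk]) h₁, h₁', h₁''⟩
  | case_false hk _ ih =>
    obtain ⟨S₁, h₁, h₁', h₁''⟩ := ih (fun _ h => hD (.inr (.inr (.inl h)))) S hS
    exact ⟨S₁, .case_false (by rw [hS _ (hD (.inl rfl)), hk]) h₁, h₁', h₁''⟩
  | case_true hk _ ih =>
    obtain ⟨S₁, h₁, h₁', h₁''⟩ := ih (fun _ h => hD (.inr (.inr (.inr h)))) S hS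
    exact ⟨S₁, .case_true (by rw [hS _ (hD (.inl rfl)), hk]) h₁, h₁', h₁''⟩
  | loop_nil hk =>
    exact ⟨S, .loop_nil (by rw [hS _ (hD (.inl rfl)), hk]), hS, fun _ _ => rfl⟩
  | loop_cons hk _ _ ih₁ ih₂ =>
    obtain ⟨S₁, h₁, h₁', h₁''⟩ := ih₁ (fun _ h => hD (.inr h)) S hS
    obtain ⟨S₂, h₂, h₂', h₂''⟩ := ih₂ hD S₁ h₁'
    exact ⟨S₂, .loop_cons (by rwa [hS _ (hD (.inl rfl))]) h₁ h₂, h₂',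
      fun k hk => (h₂'' k hk).trans (h₁'' k hk)⟩

/-- The machine code of a program does what the program does. -/
theorem steps {p : Prog K} {s s' : K → List Bool} {t : ℕ} (h : Exec p s s' t) {L : Type}
    (prog : L → Prog.MStmt K L) (e : p.Lab → L) (x : L) (hp : ∀ l, prog (e l) = p.code e x l)
    (v : Option Bool) :
    ∃ v', (flip Bind.bind (Turing.TM2.step prog))^[t]
        (some ⟨some (e p.entry), v, fun k => (s k).map Sum.inl⟩) =
      some ⟨some x, v', fun k => (s' k).map Sum.inl⟩ := by
  have one : ∀ (l : L) (v : Option Bool) (S : K → List (Bool ⊕ Empty)),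
      flip Bind.bind (Turing.TM2.step prog) (some ⟨some l, v, S⟩) =
        some (Turing.TM2.stepAux (prog l) v S) := fun _ _ _ => rfl
  have upd : ∀ (s : K → List Bool) (k : K) (l : List Bool),
      (fun j => (Function.update s k l j).map (Sum.inl : Bool → Bool ⊕ Empty)) =
        Function.update (fun j => (s j).map Sum.inl) k (l.map Sum.inl) := by
    intro s k l
    ext1 j
    by_cases h : j = k
    · subst h; simp
    · simp [h]
  induction h generalizing x v with
  | skip s => exact ⟨v, by rw [Function.iterate_one, one, hp]; simp [Prog.code]⟩
  | push s k b => exact ⟨v, by rw [Function.iterate_one, one, hp]; simp [Prog.code, upd]⟩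
  | pop s k => exact ⟨v, by rw [Function.iterate_one, one, hp]; simp [Prog.code, upd]⟩
  | @seq p q s s' s'' t t' _ _ ih₁ ih₂ =>
    obtain ⟨v₁, h₁⟩ := ih₁ (fun i => e (.inl i)) (e (.inr q.entry)) (fun l => hp (.inl l)) v
    obtain ⟨v₂, h₂⟩ := ih₂ (fun i => e (.inr i)) x (fun l => hp (.inr l)) v₁
    exact ⟨v₂, by rw [add_comm, Function.iterate_add_apply]; exact (congrArg _ h₁).trans h₂⟩
  | @case_nil k p q r s s' t hk _ ih =>
    obtain ⟨v₁, h₁⟩ := ih (fun i => e (.inr (.inl i))) x (fun l => hp _) none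
    refine ⟨v₁, ?_⟩
    rw [Function.iterate_succ_apply, ← h₁, one, hp]
    simp [Prog.entry, Prog.code, hk, Prog.topBit]
  | @case_false k p q r s s' t l hk _ ih =>
    obtain ⟨v₁, h₁⟩ := ih (fun i => e (.inr (.inr (.inl i)))) x (fun l => hp _) (some false)
    refine ⟨v₁, ?_⟩
    rw [Function.iterate_succ_apply, ← h₁, one, hp]
    simp [Prog.entry, Prog.code, hk, Prog.topBit]
  | @case_true k p q r s s' t l hk _ ih =>
    obtain ⟨v₁, h₁⟩ := ih (fun i => e (.inr (.inr (.inr i)))) x (fun l => hp _) (some true)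
    refine ⟨v₁, ?_⟩
    rw [Function.iterate_succ_apply, ← h₁, one, hp]
    simp [Prog.entry, Prog.code, hk, Prog.topBit]
  | @loop_nil k p s hk =>
    refine ⟨none, ?_⟩
    rw [Function.iterate_one, one, hp]
    simp [Prog.entry, Prog.code, hk, Prog.topBit]
  | @loop_cons k p s s' s'' t t' hk _ _ ih₁ ih₂ =>
    obtain ⟨b, l, hbl⟩ := List.exists_cons_of_ne_nil hk
    obtain ⟨v₁, h₁⟩ := ih₁ (fun i => e (.inr i)) (e (Prog.loop k p).entry)
      (fun l => hp (.inr l)) (some b)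
    obtain ⟨v₂, h₂⟩ := ih₂ e x hp v₁
    refine ⟨v₂, ?_⟩
    rw [Function.iterate_succ_apply, add_comm t t', Function.iterate_add_apply, ← h₂, ← h₁, one,
      hp]
    simp [Prog.entry, Prog.code, hbl, Prog.topBit]

end Exec

/-- The machine that runs a structured program. -/
noncomputable def Prog.machine {ι : Type} [DecidableEq ι] {m : ℕ} (p : Prog (ι ⊕ Fin m))
    (o : Fin m) :
    Machine ι where
  W := Fin m
  A := Empty
  Λ := Option p.Lab
  σ := Option Bool
  finΛ := Fintype.ofFinite _
  out := o
  main := some p.entry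
  start := none
  prog l := l.elim .halt (p.code some none)

/-- The exit label carries the statement `halt`, which costs the additional step. -/
theorem Exec.outputsIn {ι : Type} [DecidableEq ι] {m : ℕ} {p : Prog (ι ⊕ Fin m)}
    {x : ι → List Bool} {s' : ι ⊕ Fin m → List Bool} {t : ℕ}
    (h : Exec p (Sum.elim x fun _ => []) s' t) (o : Fin m) :
    (p.machine o).OutputsIn x (s' (.inr o)) (t + 1) := by
  obtain ⟨v', h'⟩ := h.steps (p.machine o).prog some none (fun l => rfl) none
  refine ⟨⟨none, v', fun k => (s' k).map Sum.inl⟩, rfl, rfl, ⟨⟨⟨t + 1, ?_⟩, le_rfl⟩⟩⟩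
  rw [add_comm, Function.iterate_add_apply]
  have : (some ((p.machine o).init x) : Option (p.machine o).Cfg) =
      some ⟨some (some p.entry), none,
        fun k => ((Sum.elim x (fun _ : Fin m => []) : ι ⊕ Fin m → List Bool) k).map Sum.inl⟩ := by
    unfold Machine.init
    congr 2
    ext1 k
    cases k <;> rfl
  rw [this]
  refine (congrArg _ h').trans ?_
  rfl

namespace Prog

variable {K : Type}

/-- Move the stack `i` to the stack `j`, which reverses it. -/
def mv (i j : K) : Prog K :=
  loop i (case i skip (seq (pop i) (push j false)) (seq (pop i) (push j true)))

/-- Move the stack `k` to both stacks `i` and `j`, which reverses it. -/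
def mv₂ (k i j : K) : Prog K :=
  loop k (case k skip (seq (pop k) (seq (push i false) (push j false)))
    (seq (pop k) (seq (push i true) (push j true))))

/-- Copy the stacks in the list `l` to the stacks `o, o + 1, …`, using the stack `k`. -/
def copies (k : ℕ) : List ℕ → ℕ → Prog ℕ
  | [], _ => skip
  | i :: l, o => seq (seq (mv i k) (mv₂ k i o)) (copies k l (o + 1))

/-- Empty the first `n` stacks. -/
def clears : ℕ → Prog ℕ
  | 0 => skip
  | n + 1 => seq (clears n) (loop n (pop n))

/-- Move the stacks `o, …, o + n - 1` to the stacks `0, …, n - 1`, using the stack `k`. -/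
def moves (k o : ℕ) : ℕ → Prog ℕ
  | 0 => skip
  | n + 1 => seq (moves k o n) (seq (mv (o + n) k) (mv k n))

/-- Replace the stacks `0, …, B - 1` by the copies of the stacks in `l`. -/
def gather (B : ℕ) (l : List ℕ) : Prog ℕ :=
  seq (copies B l (B + 1)) (seq (clears B) (moves B (B + 1) l.length))

end Prog

namespace Exec

section
variable {K : Type} [DecidableEq K]

theorem of_eq {p : Prog K} {s s' s'' : K → List Bool} {t t' : ℕ} (h : Exec p s s' t)
    (hs : s' = s'') (ht : t = t') : Exec p s s'' t' := hs ▸ ht ▸ h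

theorem mv {i j : K} (hij : i ≠ j) (s : K → List Bool) :
    Exec (.mv i j) s (Function.update (Function.update s i []) j ((s i).reverse ++ s j))
      (4 * (s i).length + 1) := by
  generalize hl : s i = l
  induction l generalizing s with
  | nil =>
    refine (Exec.loop_nil hl).of_eq ?_ rfl
    rw [← hl, Function.update_eq_self, hl]
    simp
  | cons b l ih =>
    have h := ih (Function.update (Function.update s i l) j (b :: s j)) (by simp [hij])
    refine (Exec.loop_cons (s' := Function.update (Function.update s i l) j (b :: s j)) (t := 3)
      (by simp [hl]) ?_ h).of_eq ?_ (by simp; omega)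
    · cases b
      · refine .case_false hl (.seq (.of_eq (.pop _ _) (by rw [hl]) rfl)
          (.of_eq (.push _ _ _) ?_ rfl))
        simp [hij.symm]
      · refine .case_true hl (.seq (.of_eq (.pop _ _) (by rw [hl]) rfl)
          (.of_eq (.push _ _ _) ?_ rfl))
        simp [hij.symm]
    · ext1 k
      by_cases h1 : k = j
      · subst h1; simp
      · by_cases h2 : k = i <;> simp [h1, h2, hij]

theorem mv₂ {k i j : K} (hki : k ≠ i) (hkj : k ≠ j) (hij : i ≠ j) (s : K → List Bool) :
    Exec (.mv₂ k i j) s (Function.update (Function.update (Function.update s k [])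
      i ((s k).reverse ++ s i)) j ((s k).reverse ++ s j)) (5 * (s k).length + 1) := by
  generalize hl : s k = l
  induction l generalizing s with
  | nil =>
    refine (Exec.loop_nil hl).of_eq ?_ rfl
    rw [← hl, Function.update_eq_self, hl]
    simp
  | cons b l ih =>
    have h := ih (Function.update (Function.update (Function.update s k l) i (b :: s i))
      j (b :: s j)) (by simp [hki, hkj])
    refine (Exec.loop_cons (t := 4) (by simp [hl]) ?_ h).of_eq ?_ (by simp; omega)
    · cases b
      · refine .case_false hl (.seq (.of_eq (.pop _ _) (by rw [hl]) rfl)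
          (.seq (.push _ _ _) (.of_eq (.push _ _ _) ?_ rfl)))
        simp [hki.symm, hkj.symm, hij.symm]
      · refine .case_true hl (.seq (.of_eq (.pop _ _) (by rw [hl]) rfl)
          (.seq (.push _ _ _) (.of_eq (.push _ _ _) ?_ rfl)))
        simp [hki.symm, hkj.symm, hij.symm]
    · ext1 a
      by_cases h1 : a = j
      · subst h1; simp
      · by_cases h2 : a = i
        · subst h2; simp [h1]
        · by_cases h3 : a = k <;> simp [h1, h2, h3, hki, hkj]

theorem clear (k : K) (s : K → List Bool) :
    Exec (.loop k (.pop k)) s (Function.update s k []) (2 * (s k).length + 1) := by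
  generalize hl : s k = l
  induction l generalizing s with
  | nil => exact (Exec.loop_nil hl).of_eq (by rw [← hl, Function.update_eq_self]) rfl
  | cons b l ih =>
    refine (Exec.loop_cons (by simp [hl]) (.pop _ _) (ih _ (by simp [hl]))).of_eq (by simp)
      (by simp; omega)

end

/-- Each source is poured into the scratch stack and back, doubled on the way; the two reversals
cancel. -/
theorem copies {k : ℕ} {l : List ℕ} {o N : ℕ} {s : ℕ → List Bool} (hl : ∀ i ∈ l, i < k)
    (hk : k < o) (hsk : s k = []) (hs : ∀ r, o ≤ r → s r = []) (hN : ∀ r, (s r).length ≤ N) :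
    ∃ t ≤ l.length * (9 * N + 2) + 1,
      Exec (.copies k l o) s (fun r => if r < o then s r else (l.map s).getD (r - o) []) t := by
  induction l generalizing o s with
  | nil =>
    refine ⟨1, by simp, (Exec.skip s).of_eq (funext fun r => ?_) rfl⟩
    by_cases h : r < o
    · simp [h]
    · simp [h, hs r (by omega)]
  | cons i l ih =>
    have hi : i < k := hl i (by simp)
    have hc : Exec (.seq (.mv i k) (.mv₂ k i o)) s (Function.update s o (s i))
        (9 * (s i).length + 2) := by
      refine (Exec.seq (.mv hi.ne s) (.mv₂ hi.ne' hk.ne (by omega) _)).of_eq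
        (funext fun r => ?_) ?_
      · by_cases h1 : r = o
        · subst h1; simp [hsk, (show r ≠ k by omega), (show r ≠ i by omega), hs]
        · by_cases h2 : r = i
          · subst h2; simp [h1, hi.ne, hsk]
          · by_cases h3 : r = k
            · subst h3; simp [h1, h2, hsk]
            · simp [h1, h2, h3]
      · simp [hsk]; omega
    obtain ⟨t, ht, h⟩ := ih (o := o + 1) (s := Function.update s o (s i))
      (fun j hj => hl j (by simp [hj])) (by omega) (by simp [hk.ne, hsk])
      (fun r hr => by simp [(show r ≠ o by omega), hs r (by omega)])
      (fun r => by by_cases h : r = o <;> simp [h, hN])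
    have hm : l.map (Function.update s o (s i)) = l.map s := by
      refine List.map_congr_left fun j hj => ?_
      have := hl j (by simp [hj])
      simp [(show j ≠ o by omega)]
    refine ⟨_, ?_, (Exec.seq hc h).of_eq (funext fun r => ?_) rfl⟩
    · have := hN i
      simp only [List.length_cons, add_mul]
      omega
    · simp only [hm]
      by_cases h1 : r < o
      · simp [h1, (show r < o + 1 by omega), (show r ≠ o by omega)]
      · by_cases h2 : r = o
        · subst h2; simp
        · obtain ⟨d, rfl⟩ : ∃ d, r = o + 1 + d := ⟨r - (o + 1), by omega⟩
          simp [(show ¬ o + 1 + d < o by omega), (show ¬ o + 1 + d ≤ o by omega),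
            (show o + 1 + d - o = d + 1 by omega)]

theorem clears (n N : ℕ) {s : ℕ → List Bool} (hN : ∀ r, (s r).length ≤ N) :
    ∃ t ≤ n * (2 * N + 1) + 1,
      Exec (.clears n) s (fun r => if r < n then [] else s r) t := by
  induction n with
  | zero => exact ⟨1, by simp, .of_eq (.skip s) (by simp) rfl⟩
  | succ n ih =>
    obtain ⟨t, ht, h⟩ := ih
    refine ⟨_, ?_, (Exec.seq h (.clear n _)).of_eq (funext fun r => ?_) rfl⟩
    · have := hN n
      simp only [lt_irrefl, if_false, add_mul]
      omega
    · by_cases h1 : r = n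
      · subst h1; simp
      · simp [h1, (show r < n ↔ r < n + 1 by omega)]

theorem moves {k o : ℕ} (n : ℕ) {N : ℕ} {s : ℕ → List Bool} (hN : ∀ r, (s r).length ≤ N)
    (hn : n ≤ k) (hk : k < o) (hs : ∀ r ≤ k, s r = []) :
    ∃ t ≤ n * (8 * N + 2) + 1,
      Exec (.moves k o n) s
        (fun r => if r < n then s (o + r) else if o ≤ r ∧ r < o + n then [] else s r) t := by
  induction n with
  | zero =>
    refine ⟨1, by simp, .of_eq (.skip s) (funext fun r => ?_) rfl⟩
    simp [(show ¬ (o ≤ r ∧ r < o) by omega)]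
  | succ n ih =>
    obtain ⟨t, ht, h⟩ := ih (by omega)
    refine ⟨_, ?_, (Exec.seq h (.seq (.mv (by omega) _) (.mv (by omega) _))).of_eq
      (funext fun r => ?_) rfl⟩
    · have := hN (o + n)
      simp [(show ¬ o + n < n by omega), (show ¬ k < n by omega), (show ¬ o ≤ k by omega), hs, add_mul]
      omega
    · have e1 : ¬ o + n < n := by omega
      have e2 : ¬ k < n := by omega
      have e3 : ¬ o ≤ k := by omega
      have e4 : n ≠ k := by omega
      have e6 : ¬ o ≤ n := by omega
      by_cases h1 : r = n
      · subst h1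
        simp [Function.update_apply, e1, e2, e3, e4, e6, hs r (by omega), hs k le_rfl]
      · by_cases h2 : r = k
        · subst h2; simp [h1, e3, hs, (show ¬ r < n + 1 by omega)]
        · by_cases h3 : r = o + n
          · subst h3
            simp [Function.update_apply, h2, (show ¬ o + n < n + 1 by omega),
              (show o ≠ 0 by omega)]
          · simp [h1, h2, h3, (show r < n ↔ r < n + 1 by omega),
              (show r < o + n ↔ r < o + (n + 1) by omega)]

/-- All copies are made above the registers in use before anything is cleared, so repetitions and
permutations in the list do no harm. -/
theorem gather {B : ℕ} {l : List ℕ} (hl : ∀ i ∈ l, i < B) (hB : l.length ≤ B) :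
    ∃ c : ℕ, ∀ (N : ℕ) (s : ℕ → List Bool), (∀ r, B ≤ r → s r = []) →
      (∀ r, (s r).length ≤ N) → ∃ t ≤ c * N + c,
        Exec (.gather B l) s (fun r => (l.map s).getD r []) t := by
  refine ⟨l.length * 9 + B * 2 + l.length * 8 + l.length * 4 + B + 3, fun N s hs hN => ?_⟩
  obtain ⟨t₁, ht₁, h₁⟩ := copies (o := B + 1) hl (by omega) (hs B le_rfl)
    (fun r hr => hs r (by omega)) hN
  have hN₁ : ∀ r, (if r < B + 1 then s r else (l.map s).getD (r - (B + 1)) []).length ≤ N := by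
    intro r
    split_ifs
    · exact hN r
    · by_cases h : r - (B + 1) < l.length
      · rw [List.getD_eq_getElem _ _ (show r - (B + 1) < (l.map s).length by simpa)]
        simp [hN]
      · simp [h]
  obtain ⟨t₂, ht₂, h₂⟩ := clears B N hN₁
  obtain ⟨t₃, ht₃, h₃⟩ := moves (k := B) (o := B + 1) l.length (N := N)
    (s := fun r => if r < B then [] else if r < B + 1 then s r else (l.map s).getD (r - (B + 1)) [])
    (fun r => by
      by_cases h : r < B
      · simp [h]
      · simpa only [h, if_false] using hN₁ r)
    hB (by omega) (fun r hr => by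
      by_cases h : r < B
      · simp [h]
      · simp [show r = B by omega, hs])
  refine ⟨_, ?_, (Exec.seq h₁ (.seq h₂ h₃)).of_eq (funext fun r => ?_) rfl⟩
  · nlinarith
  · by_cases h : r < l.length
    · simp [h, (show ¬ B + 1 + r < B by omega), (show ¬ B + 1 + r ≤ B by omega)]
    · simp only [h, if_false]
      have e : (l.map s).getD r [] = [] := by simp [h]
      rw [e]
      split_ifs with h1 h2 h3
      · rfl
      · rfl
      · exact hs r (by omega)
      · simp only [not_and, not_lt] at h1
        simp [(show ¬ r - (B + 1) < l.length by have := h1 (by omega); omega)]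

end Exec

/-! Polynomial-time functions between types of tuples of words. -/

/-- A type whose elements are stored in a fixed number of registers, each of which holds a word. -/
class Env (E : Type) where
  width : ℕ
  enc : E → ℕ → List Bool
  enc_of_le : ∀ x r, width ≤ r → enc x r = []

namespace Env

instance : Env (List Bool) where
  width := 1
  enc l r := if r = 0 then l else []
  enc_of_le l r h := by simp [(show r ≠ 0 by omega)]

/-- Numbers are stored in unary. -/
instance : Env ℕ where
  width := 1
  enc n r := if r = 0 then unary n else []
  enc_of_le l r h := by simp [(show r ≠ 0 by omega)]

instance : Env Bool where
  width := 1
  enc b r := if r = 0 then [b] else []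
  enc_of_le l r h := by simp [(show r ≠ 0 by omega)]

instance instProd {E F : Type} [Env E] [Env F] : Env (E × F) where
  width := width E + width F
  enc x r := if r < width E then enc x.1 r else enc x.2 (r - width E)
  enc_of_le x r h := by
    rw [if_neg (by omega)]
    exact enc_of_le _ _ (by omega)

/-- Tuples of fixed length. -/
@[reducible] def tuple (E : Type) [Env E] : ∀ n, Env (Fin n → E)
  | 0 => ⟨0, fun _ _ => [], fun _ _ _ => rfl⟩
  | n + 1 =>
    letI := tuple E n
    ⟨width (E × (Fin n → E)), fun x => enc (x 0, fun i => x i.succ), fun _ => enc_of_le _⟩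

noncomputable instance {E J : Type} [Env E] [Fintype J] : Env (J → E) :=
  letI := tuple E (Fintype.card J)
  ⟨width (Fin (Fintype.card J) → E), fun x => enc fun i => x ((Fintype.equivFin J).symm i),
    fun _ => enc_of_le _⟩

/-- All registers of `x` have length at most `n`. -/
def Le {E : Type} [Env E] (x : E) (n : ℕ) : Prop := ∀ r, (enc x r).length ≤ n

variable {E F J : Type} [Env E] [Env F]

theorem Le.mono {x : E} {m n : ℕ} (h : Le x m) (hmn : m ≤ n) : Le x n :=
  fun r => (h r).trans hmn

@[simp] theorem le_list {l : List Bool} {n : ℕ} : Le l n ↔ l.length ≤ n := by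
  refine ⟨fun h => h 0, fun h r => ?_⟩
  by_cases hr : r = 0 <;> simp [enc, hr, h]

@[simp] theorem le_nat {m n : ℕ} : Le m n ↔ m ≤ n := by
  refine ⟨fun h => by simpa [enc, unary] using h 0, fun h r => ?_⟩
  by_cases hr : r = 0 <;> simp [enc, unary, hr, h]

@[simp] theorem le_bool {b : Bool} {n : ℕ} : Le b n ↔ 1 ≤ n := by
  refine ⟨fun h => h 0, fun h r => ?_⟩
  by_cases hr : r = 0 <;> simp [enc, hr, h]

@[simp] theorem le_prod {x : E} {y : F} {n : ℕ} : Le (x, y) n ↔ Le x n ∧ Le y n := by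
  refine ⟨fun h => ⟨fun r => ?_, fun r => ?_⟩, fun h r => ?_⟩
  · by_cases hr : r < width E
    · simpa [enc, hr] using h r
    · simp [enc_of_le x r (by omega)]
  · simpa [enc] using h (r + width E)
  · by_cases hr : r < width E
    · simpa [enc, hr] using h.1 r
    · simpa [enc, hr] using h.2 _

theorem le_tuple {k : ℕ} {x : Fin k → E} {n : ℕ} :
    letI := tuple E k
    Le x n ↔ ∀ i, Le (x i) n := by
  induction k with
  | zero => exact ⟨fun _ i => i.elim0, fun _ _ => Nat.zero_le _⟩
  | succ k ih =>
    letI := tuple E k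
    have : (letI := tuple E (k + 1); Le x n) ↔ Le (x 0, fun i => x (Fin.succ i)) n := Iff.rfl
    rw [this, le_prod, ih, Fin.forall_fin_succ]

@[simp] theorem le_pi [Fintype J] {x : J → E} {n : ℕ} : Le x n ↔ ∀ j, Le (x j) n := by
  have : Le x n ↔ (letI := tuple E (Fintype.card J)
    Le (fun i => x ((Fintype.equivFin J).symm i)) n) := Iff.rfl
  rw [this, le_tuple]
  exact ((Fintype.equivFin J).symm.surjective.forall (p := fun j => Le (x j) n)).symm

end Env

/-- The function `f` is computed by a structured program in polynomial time. The program finds its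
argument in the first registers, and leaves the value in the first registers and all others
empty. -/
def PT {E F : Type} [Env E] [Env F] (f : E → F) : Prop :=
  ∃ (p : Prog ℕ) (P : Polynomial ℕ), ∀ (n : ℕ) (x : E), Env.Le x n →
    ∃ t ≤ P.eval n, Exec p (Env.enc x) (Env.enc (f x)) t

namespace PT

open Env

variable {E F G J : Type} [Env E] [Env F] [Env G]

/-- Only register contents matter for `PT`, so types with the same encoding, such as a number and
its unary word, can be exchanged. -/
theorem of_enc {E' F' : Type} [Env E'] [Env F'] {f : E → F} (hf : PT f) {g : E' → F'} (i : E' → E)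
    (hi : ∀ x, enc (i x) = enc x) (h : ∀ x, enc (g x) = enc (f (i x))) : PT g := by
  obtain ⟨p, P, hp⟩ := hf
  refine ⟨p, P, fun n x hx => ?_⟩
  have := hp n (i x) (by simpa [Le, hi] using hx)
  rwa [hi, ← h] at this

theorem id : PT (fun x : E => x) := ⟨.skip, 1, fun n x _ => ⟨1, by simp, .skip _⟩⟩

/-- The size of a value of a polynomial-time function is polynomial. -/
theorem le {f : E → F} (hf : PT f) : ∃ P : Polynomial ℕ, ∀ n x, Le x n → Le (f x) (P.eval n) := by
  obtain ⟨p, P, hp⟩ := hf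
  refine ⟨P + .X, fun n x hx r => ?_⟩
  obtain ⟨t, ht, h⟩ := hp n x hx
  have := h.length_le r
  have := hx r
  simp only [Polynomial.eval_add, Polynomial.eval_X]
  omega

theorem comp {g : F → G} {f : E → F} (hg : PT g) (hf : PT f) : PT (fun x => g (f x)) := by
  obtain ⟨B, hB⟩ := hf.le
  obtain ⟨p, P, hp⟩ := hf
  obtain ⟨q, Q, hq⟩ := hg
  refine ⟨.seq p q, P + Q.comp B, fun n x hx => ?_⟩
  obtain ⟨t, ht, h⟩ := hp n x hx
  obtain ⟨t', ht', h'⟩ := hq _ _ (hB n x hx)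
  exact ⟨_, by simpa using add_le_add ht ht', .seq h h'⟩

theorem of_gather (f : E → F) (l : List ℕ) (hl : ∀ i ∈ l, i < width E)
    (h : ∀ x r, enc (f x) r = (l.map (enc x)).getD r []) : PT f := by
  obtain ⟨c, hc⟩ := Exec.gather (B := width E + l.length) (l := l)
    (fun i hi => (hl i hi).trans_le (by omega)) (by omega)
  refine ⟨.gather (width E + l.length) l, .C c * .X + .C c, fun n x hx => ?_⟩
  obtain ⟨t, ht, h'⟩ := hc n (enc x) (fun r hr => enc_of_le _ _ (by omega)) hx
  exact ⟨t, by simpa using ht, h'.of_eq (funext fun r => (h x r).symm) rfl⟩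

theorem fst : PT (fun x : E × F => x.1) := by
  refine of_gather _ (List.range (width E)) (fun i hi => ?_) fun x r => ?_
  · have := List.mem_range.1 hi
    exact this.trans_le (Nat.le_add_right _ _)
  · by_cases h : r < width E
    · simp [h, enc]
    · simp [h, enc_of_le x.1 r (by omega)]

theorem snd : PT (fun x : E × F => x.2) := by
  refine of_gather _ ((List.range (width F)).map (· + width E)) (fun i hi => ?_) fun x r => ?_
  · simp only [List.mem_map, List.mem_range] at hi
    obtain ⟨a, ha, rfl⟩ := hi
    exact (show a + width E < width E + width F by omega)
  · by_cases h : r < width F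
    · simp [h, enc]
    · simp [h, enc_of_le x.2 r (by omega)]

/-- The argument is duplicated onto the even and the odd registers, each function runs on its own
half, and the results are collected. -/
theorem pair {f : E → F} {g : E → G} (hf : PT f) (hg : PT g) : PT (fun x => (f x, g x)) := by
  obtain ⟨p, P, hp⟩ := hf
  obtain ⟨q, Q, hq⟩ := hg
  set l₁ := (List.range (2 * width E)).map (· / 2)
  set l₂ := (List.range (width F)).map (2 * ·) ++ (List.range (width G)).map (2 * · + 1)
  obtain ⟨c₁, hc₁⟩ := Exec.gather (B := 2 * width E) (l := l₁) (fun i hi => by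
    simp only [l₁, List.mem_map, List.mem_range] at hi; obtain ⟨a, ha, rfl⟩ := hi; omega)
    (by simp [l₁])
  obtain ⟨c₂, hc₂⟩ := Exec.gather (B := 2 * width F + 2 * width G) (l := l₂) (fun i hi => by
    simp only [l₂, List.mem_append, List.mem_map, List.mem_range] at hi
    obtain (⟨a, ha, rfl⟩ | ⟨a, ha, rfl⟩) := hi <;> omega)
    (by simp [l₂]; omega)
  refine ⟨.seq (.gather (2 * width E) l₁) (.seq (.seq (p.map (2 * ·)) (q.map (2 * · + 1)))
    (.gather (2 * width F + 2 * width G) l₂)),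
    (.C c₁ * .X + .C c₁) + ((P + Q) + (.C c₂ * (.X + P + Q) + .C c₂)), fun n x hx => ?_⟩
  obtain ⟨t₁, ht₁, h₁⟩ := hc₁ n (enc x) (fun r hr => enc_of_le _ _ (by omega)) hx
  obtain ⟨t₂, ht₂, h₂⟩ := hp n x hx
  obtain ⟨t₃, ht₃, h₃⟩ := hq n x hx
  have e₁ : (fun r => (l₁.map (enc x)).getD r []) = fun r => enc x (r / 2) := by
    ext1 r
    by_cases h : r < 2 * width E
    · simp [l₁, h]
    · simp [l₁, h, enc_of_le x (r / 2) (by omega)]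
  rw [e₁] at h₁
  obtain ⟨S₂, hS₂, hS₂', hS₂''⟩ := h₂.map (2 * ·) (D := Set.univ)
    (fun a _ b _ h => by simpa using h) (Set.subset_univ _) (fun r => enc x (r / 2))
    (fun k _ => by simp)
  obtain ⟨S₃, hS₃, hS₃', hS₃''⟩ := h₃.map (2 * · + 1) (D := Set.univ)
    (fun a _ b _ h => by simpa using h) (Set.subset_univ _) S₂
    (fun k _ => by
      rw [hS₂'']
      · congr 1; omega
      · rintro ⟨a, -, ha⟩; simp only at ha; omega)
  have hf : ∀ k, S₃ (2 * k) = enc (f x) k := fun k => by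
    rw [hS₃'', hS₂' k trivial]
    rintro ⟨a, -, ha⟩; simp only at ha; omega
  have hg : ∀ k, S₃ (2 * k + 1) = enc (g x) k := fun k => hS₃' k trivial
  have hlen : ∀ r, (S₃ r).length ≤ n + P.eval n + Q.eval n := fun r => by
    have h₁ := hS₂.length_le r
    have h₂ := hS₃.length_le r
    have := hx (r / 2)
    omega
  obtain ⟨t₄, ht₄, h₄⟩ := hc₂ _ S₃ (fun r hr => by
    obtain ⟨k, rfl | rfl⟩ := Nat.even_or_odd' r
    · rw [hf, enc_of_le _ _ (by omega)]
    · rw [hg, enc_of_le _ _ (by omega)]) hlen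
  refine ⟨_, ?_, (Exec.seq h₁ (.seq (.seq hS₂ hS₃) h₄)).of_eq (funext fun r => ?_) rfl⟩
  · simp only [Polynomial.eval_add, Polynomial.eval_mul, Polynomial.eval_C, Polynomial.eval_X]
    gcongr
  · by_cases h : r < width F
    · simp [l₂, h, enc, List.getElem?_append, hf]
    · by_cases h' : r - width F < width G
      · simp [l₂, h, h', enc, List.getElem?_append, hg]
      · simp [l₂, h, h', enc, List.getElem?_append, enc_of_le (g x) (r - width F) (by omega)]

theorem tuple_apply {n : ℕ} (i : Fin n) :
    letI := tuple E n
    PT (fun x : Fin n → E => x i) := by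
  induction n with
  | zero => exact i.elim0
  | succ n ih =>
    letI := tuple E n
    letI := tuple E (n + 1)
    have h : PT (fun x : Fin (n + 1) → E => (x 0, fun i : Fin n => x i.succ)) :=
      of_enc (PT.id (E := E × (Fin n → E))) (fun x => (x 0, fun i => x i.succ)) (fun _ => rfl)
        fun _ => rfl
    refine Fin.cases ?_ (fun i => ?_) i
    · exact fst.comp h
    · exact (ih i).comp (snd.comp h)

theorem tuple_mk {n : ℕ} {f : E → Fin n → F} (hf : ∀ i, PT (fun x => f x i)) :
    @PT _ _ _ (tuple F n) f := by
  induction n with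
  | zero => exact @of_gather _ _ _ (tuple F 0) f [] (by simp) fun x r => rfl
  | succ n ih =>
    exact @of_enc _ _ _ (@instProd _ _ _ (tuple F n)) _ _ _ (tuple F (n + 1)) _
      (@pair _ _ _ _ _ (tuple F n) _ _ (hf 0) (ih (f := fun x i => f x i.succ) fun i => hf i.succ))
      f (fun x => x) (fun _ => rfl) fun _ => rfl

theorem apply [Fintype J] (j : J) : PT (fun x : J → E => x j) := by
  letI := tuple E (Fintype.card J)
  refine of_enc (tuple_apply (Fintype.equivFin J j)) (fun x i => x ((Fintype.equivFin J).symm i))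
    (fun _ => rfl) fun _ => ?_
  simp

theorem pi [Fintype J] {f : E → J → F} (hf : ∀ j, PT (fun x => f x j)) : PT f :=
  @of_enc _ _ _ (tuple F (Fintype.card J)) _ _ _ _ _
    (tuple_mk (f := fun x i => f x ((Fintype.equivFin J).symm i)) fun _ => hf _) f (fun x => x)
    (fun _ => rfl) fun _ => rfl

theorem cons (b : Bool) {f : E → List Bool} (hf : PT f) : PT (fun x => b :: f x) := by
  refine comp (g := fun l => b :: l) ⟨.push 0 b, 1, fun n x _ => ⟨1, by simp, ?_⟩⟩ hf
  refine (Exec.push _ _ _).of_eq (funext fun r => ?_) rfl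
  by_cases h : r = 0 <;> simp [enc, h]

theorem tail {f : E → List Bool} (hf : PT f) : PT (fun x => (f x).tail) := by
  refine comp (g := fun l => l.tail) ⟨.pop 0, 1, fun n x _ => ⟨1, by simp, ?_⟩⟩ hf
  refine (Exec.pop _ _).of_eq (funext fun r => ?_) rfl
  by_cases h : r = 0 <;> simp [enc, h]

theorem nil : PT (fun _ : E => ([] : List Bool)) :=
  of_gather _ [] (by simp) fun x r => by simp [enc]

/-- Distinction by the top of a word. -/
theorem cases {c : E → List Bool} (hc : PT c) {f : E → F} {g : Bool → E → F} (hf : PT f)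
    (hg : ∀ b, PT (g b)) :
    PT (fun x => match c x with
      | [] => f x
      | b :: _ => g b x) := by
  obtain ⟨p, P, hp⟩ := hf.comp (snd (E := List Bool))
  obtain ⟨q, Q, hq⟩ := (hg false).comp (snd (E := List Bool))
  obtain ⟨r, R, hr⟩ := (hg true).comp (snd (E := List Bool))
  refine comp (f := fun x => (c x, x)) (g := fun x : List Bool × E => match x.1 with
      | [] => f x.2
      | b :: _ => g b x.2)
    ⟨.case 0 p q r, P + Q + R + 1, fun n x hx => ?_⟩ (hc.pair PT.id)
  obtain ⟨l, x⟩ := x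
  simp only [Polynomial.eval_add, Polynomial.eval_one]
  match l, hx with
  | [], hx =>
    obtain ⟨t, ht, h⟩ := hp n _ hx
    exact ⟨t + 1, by omega, .case_nil rfl h⟩
  | false :: l, hx =>
    obtain ⟨t, ht, h⟩ := hq n _ hx
    exact ⟨t + 1, by omega, .case_false rfl h⟩
  | true :: l, hx =>
    obtain ⟨t, ht, h⟩ := hr n _ hx
    exact ⟨t + 1, by omega, .case_true rfl h⟩

/-- Iteration, as often as the length of a word says. -/
theorem iterate {f : E → E} (hf : PT f) (B : Polynomial ℕ)
    (hB : ∀ n k x, k ≤ n → Le x n → Le (f^[k] x) (B.eval n)) :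
    PT (fun x : List Bool × E => f^[x.1.length] x.2) := by
  obtain ⟨p, P, hp⟩ := hf
  refine snd.comp (f := fun x : List Bool × E => (([] : List Bool), f^[x.1.length] x.2))
    ⟨.loop 0 (.seq (.pop 0) (p.map (· + 1))),
    .X * (P.comp B + 2) + 1, fun n x hx => ?_⟩
  obtain ⟨l, x⟩ := x
  rw [Env.le_prod, Env.le_list] at hx
  obtain ⟨hm, hx⟩ := hx
  -- The induction starts at any stage `j` of one fixed orbit, so every pass is charged at the same
  -- size bound, computed from the original argument.
  have key : ∀ (j : ℕ) (l : List Bool), j + l.length ≤ n →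
      ∃ t ≤ l.length * (P.eval (B.eval n) + 2) + 1,
      Exec (.loop 0 (.seq (.pop 0) (p.map (· + 1)))) (enc (l, f^[j] x))
        (enc (([] : List Bool), f^[j + l.length] x)) t := by
    intro j l
    induction l generalizing j with
    | nil => exact fun _ => ⟨1, by simp, .loop_nil rfl⟩
    | cons b l ih =>
      intro hjm
      rw [List.length_cons] at hjm
      obtain ⟨t, ht, h⟩ := ih (j + 1) (by omega)
      obtain ⟨t', ht', h'⟩ := hp _ _ (hB n j x (by omega) hx)
      obtain ⟨S, hS, hS', hS''⟩ := h'.map (· + 1) (D := Set.univ)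
        (fun a _ b _ h => by simpa using h) (Set.subset_univ _) (enc (l, f^[j] x))
        (fun k _ => by simp [enc, width])
      refine ⟨_, ?_, .loop_cons (s' := enc (l, f^[j + 1] x)) (by simp [enc, width])
        (.seq ((Exec.pop _ _).of_eq ?_ rfl) (hS.of_eq ?_ rfl)) (h.of_eq ?_ rfl)⟩
      · rw [List.length_cons, add_mul]; omega
      · ext1 r
        cases r <;> simp [enc, width]
      · ext1 r
        cases r with
        | zero => rw [hS'']; · rfl
                  · rintro ⟨a, -, ha⟩; simp at ha
        | succ r =>
          rw [hS' r trivial, Function.iterate_succ_apply']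
          simp [enc, width]
      · rw [List.length_cons, add_assoc, add_comm 1]
  obtain ⟨t, ht, h⟩ := key 0 l (by omega)
  refine ⟨t, ht.trans ?_, by simpa using h⟩
  simp only [Polynomial.eval_add, Polynomial.eval_mul, Polynomial.eval_X, Polynomial.eval_comp,
    Polynomial.eval_ofNat, Polynomial.eval_one]
  gcongr

end PT

/-! ### Tests, constants, iteration with parameters and folds -/

namespace PT

open Env

variable {E F G J : Type} [Env E] [Env F] [Env G]

theorem congr {f g : E → F} (hf : PT f) (h : ∀ x, f x = g x) : PT g :=
  (funext h : f = g) ▸ hf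

theorem fst' {f : E → F × G} (hf : PT f) : PT (fun x => (f x).1) := fst.comp hf

theorem snd' {f : E → F × G} (hf : PT f) : PT (fun x => (f x).2) := snd.comp hf

theorem constList (l : List Bool) : PT (fun _ : E => l) := by
  induction l with
  | nil => exact nil
  | cons b l ih => exact ih.cons b

theorem constNat (n : ℕ) : PT (fun _ : E => n) :=
  (constList (unary n)).of_enc (fun x => x) (fun _ => rfl) fun _ => rfl

theorem constBool (b : Bool) : PT (fun _ : E => b) :=
  (constList [b]).of_enc (fun x => x) (fun _ => rfl) fun _ => rfl

theorem unary {f : E → ℕ} (hf : PT f) : PT (fun x => unary (f x)) :=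
  hf.of_enc (fun x => x) (fun _ => rfl) fun _ => rfl

theorem singleton {f : E → Bool} (hf : PT f) : PT (fun x => [f x]) :=
  hf.of_enc (fun x => x) (fun _ => rfl) fun _ => rfl

theorem ite {c : E → Prop} [DecidablePred c] (hc : PT (fun x => decide (c x))) {f g : E → F}
    (hf : PT f) (hg : PT g) : PT (fun x => if c x then f x else g x) := by
  refine (cases hc.singleton hf (g := fun b x => bif b then f x else g x) fun b => ?_).congr
    fun x => ?_
  · cases b
    · exact hg
    · exact hf
  · by_cases h : c x <;> simp [h]

theorem and {c d : E → Prop} [DecidablePred c] [DecidablePred d] (hc : PT (fun x => decide (c x)))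
    (hd : PT (fun x => decide (d x))) : PT (fun x => decide (c x ∧ d x)) :=
  (hc.ite hd (constBool false)).congr fun x => by by_cases h : c x <;> simp [h]

theorem isNil {f : E → List Bool} (hf : PT f) : PT (fun x => decide (f x = [])) :=
  (hf.cases (constBool true) (g := fun _ _ => false) fun _ => constBool _).congr fun x => by
    cases h : f x <;> simp

theorem eqZero {f : E → ℕ} (hf : PT f) : PT (fun x => decide (f x = 0)) :=
  hf.unary.isNil.congr fun x => by simp [_root_.unary, List.replicate_eq_nil_iff]

theorem head {f : E → List Bool} (hf : PT f) : PT (fun x => (f x).head?.getD false) :=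
  (hf.cases (constBool false) (g := fun b _ => b) fun _ => constBool _).congr fun x => by
    cases h : f x <;> simp

theorem eqBool {f g : E → Bool} (hf : PT f) (hg : PT g) : PT (fun x => decide (f x = g x)) :=
  (hf.singleton.cases (constBool false)
    (g := fun b x => match [g x] with
      | [] => false
      | c :: _ => decide (b = c)) fun b =>
    (hg.singleton.cases (constBool false) (g := fun c _ => decide (b = c)) fun _ =>
      constBool _)).congr fun x => rfl

theorem eqConst {f : E → List Bool} (hf : PT f) (w : List Bool) :
    PT (fun x => decide (f x = w)) := by
  induction w generalizing f with
  | nil => exact hf.isNil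
  | cons b w ih =>
    refine (hf.cases (constBool false) (g := fun c x => if c = b then decide ((f x).tail = w)
      else false) fun c => ?_).congr fun x => ?_
    · by_cases h : c = b
      · simpa [h] using ih hf.tail
      · simpa [h] using constBool false
    · cases h : f x with
      | nil => simp
      | cons c l => by_cases h : c = b <;> simp [h]

theorem consBool {b : E → Bool} {f : E → List Bool} (hb : PT b) (hf : PT f) :
    PT (fun x => b x :: f x) :=
  (hb.singleton.cases nil (g := fun b x => b :: f x) fun b => hf.cons b).congr fun _ => rfl

theorem succ {f : E → ℕ} (hf : PT f) : PT (fun x => f x + 1) :=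
  (hf.unary.cons true).of_enc (fun x => x) (fun _ => rfl) fun _ => rfl

theorem length {f : E → List Bool} (hf : PT f) : PT (fun x => (f x).length) := by
  refine ((iterate (f := fun n : ℕ => n + 1) (succ id) (.X + .X) fun n k x hk hx => ?_).comp
    (hf.pair (constNat 0))).congr fun x => ?_
  · rw [Env.le_nat] at *
    simp; omega
  · simp

/-- Iteration with parameters, where the size grows slowly. -/
theorem iter {f : F → E → E} (hf : PT (fun x : F × E => f x.1 x.2)) (C : Polynomial ℕ)
    (hC : ∀ n m y e, n ≤ m → Le y n → Le e m → Le (f y e) (m + C.eval n))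
    {k : F → ℕ} (hk : PT k) {x : F → E} (hx : PT x) : PT (fun y => (f y)^[k y] (x y)) := by
  have e : ∀ (k : ℕ) (y : F) (e : E),
      (fun z : F × E => (z.1, f z.1 z.2))^[k] (y, e) = (y, (f y)^[k] e) := by
    intro k y e
    induction k with
    | zero => rfl
    | succ k ih => rw [Function.iterate_succ_apply', ih, ← Function.iterate_succ_apply' (f y)]
  have h : PT (fun z : List Bool × (F × E) =>
      (fun z : F × E => (z.1, f z.1 z.2))^[z.1.length] z.2) := by
    refine iterate (fst.pair hf) (.X + .X * C) fun n k z hk hz => ?_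
    obtain ⟨y, a⟩ := z
    rw [Env.le_prod] at hz
    -- The growth per step depends on the initial size alone, so it adds up over the iterations
    -- instead of compounding.
    have : Le ((f y)^[k] a) (n + k * C.eval n) := by
      clear hk
      induction k with
      | zero => simpa using hz.2
      | succ k ih =>
        rw [Function.iterate_succ_apply']
        exact (hC n _ y _ (by omega) hz.1 ih).mono (by rw [add_mul]; omega)
    rw [e, Env.le_prod]
    simp only [Polynomial.eval_add, Polynomial.eval_mul, Polynomial.eval_X]
    exact ⟨hz.1.mono (by omega), this.mono (by gcongr)⟩
  exact (h.comp (hk.unary.pair (id.pair hx))).snd'.congr fun y => by simp [e, _root_.unary]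

/-- A fold is the iteration of a step that consumes one letter of the remaining word; the step
chooses between two fixed programs by that letter. -/
theorem foldl {f : F → E → Bool → E} (hf : ∀ b, PT (fun x : F × E => f x.1 x.2 b))
    (C : Polynomial ℕ) (hC : ∀ n m y e b, n ≤ m → Le y n → Le e m → Le (f y e b) (m + C.eval n))
    {l : F → List Bool} (hl : PT l) {x : F → E} (hx : PT x) :
    PT (fun y => (l y).foldl (f y) (x y)) := by
  let step : F → List Bool × E → List Bool × E := fun y z => match z.1 with
    | [] => z
    | b :: _ => (z.1.tail, f y z.2 b)
  have hs : PT (fun z : F × (List Bool × E) => step z.1 z.2) := by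
    refine cases (E := F × (List Bool × E)) (c := fun z => z.2.1) (f := fun z => z.2)
      (g := fun b z => (z.2.1.tail, f z.1 z.2.2 b)) (fst.comp snd) snd fun b => ?_
    exact (fst.comp snd).tail.pair ((hf b).comp (fst.pair (snd.comp snd)))
  have key : ∀ y l e, (step y)^[l.length] (l, e) = ([], l.foldl (f y) e) := by
    intro y l
    induction l with
    | nil => exact fun e => rfl
    | cons b l ih => exact fun e => by simpa [step] using ih (f y e b)
  refine (iter hs C ?_ hl.length (hl.pair hx)).snd'.congr fun y => by rw [key]
  intro n m y z hnm hy hz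
  obtain ⟨l, e⟩ := z
  rw [Env.le_prod, le_list] at hz
  cases l with
  | nil => exact Env.le_prod.2 ⟨by simp, hz.2.mono (by omega)⟩
  | cons b l =>
    have := hz.1
    simp only [List.length_cons] at this
    exact Env.le_prod.2 ⟨by simp; omega, hC n m y e b hnm hy hz.2⟩

end PT

/-! ### Operations on words and unary arithmetic -/

namespace PT

open Env

variable {E F G J : Type} [Env E] [Env F] [Env G]

theorem reverse {f : E → List Bool} (hf : PT f) : PT (fun x => (f x).reverse) := by
  refine (foldl (f := fun (_ : E) l b => b :: l) (fun b => snd.cons b) 1 (fun n m y e b _ _ h => ?_)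
    hf nil).congr fun x => ?_
  · rw [le_list] at *; simpa using h
  · have : ∀ l a : List Bool, l.foldl (fun l b => b :: l) a = l.reverse ++ a := by
      intro l
      induction l with
      | nil => exact fun _ => rfl
      | cons b l ih => exact fun a => by simp [ih]
    simp [this]

theorem append {f g : E → List Bool} (hf : PT f) (hg : PT g) : PT (fun x => f x ++ g x) := by
  refine (foldl (f := fun (_ : E) l b => b :: l) (fun b => snd.cons b) 1 (fun n m y e b _ _ h => ?_)
    hf.reverse hg).congr fun x => ?_
  · rw [le_list] at *; simpa using h
  · have : ∀ l a : List Bool, l.foldl (fun l b => b :: l) a = l.reverse ++ a := by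
      intro l
      induction l with
      | nil => exact fun _ => rfl
      | cons b l ih => exact fun a => by simp [ih]
    simp [this]

theorem drop {n : E → ℕ} {f : E → List Bool} (hn : PT n) (hf : PT f) :
    PT (fun x => (f x).drop (n x)) := by
  refine (iter (f := fun (_ : E) (l : List Bool) => l.tail) snd.tail 0 (fun n m y e _ _ h => ?_) hn
    hf).congr fun x => ?_
  · rw [le_list] at *; simp; omega
  · have : ∀ k (l : List Bool), List.tail^[k] l = l.drop k := by
      intro k
      induction k with
      | zero => simp
      | succ k ih => intro l; rw [Function.iterate_succ_apply, ih]; simp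
    exact this _ _

theorem sub {f g : E → ℕ} (hf : PT f) (hg : PT g) : PT (fun x => f x - g x) :=
  (hg.drop hf.unary).length.congr fun x => by simp [_root_.unary]

theorem take {n : E → ℕ} {f : E → List Bool} (hn : PT n) (hf : PT f) :
    PT (fun x => (f x).take (n x)) :=
  ((hf.length.sub hn).drop hf.reverse).reverse.congr fun x => by
    rw [List.drop_reverse, List.reverse_reverse]
    by_cases h : n x ≤ (f x).length
    · rw [Nat.sub_sub_self h]
    · rw [show (f x).length - n x = 0 by omega, Nat.sub_zero, List.take_of_length_le le_rfl,
        List.take_of_length_le (by omega)]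

theorem add {f g : E → ℕ} (hf : PT f) (hg : PT g) : PT (fun x => f x + g x) :=
  (hf.unary.append hg.unary).length.congr fun x => by simp [_root_.unary]

theorem mul {f g : E → ℕ} (hf : PT f) (hg : PT g) : PT (fun x => f x * g x) := by
  refine (iter (f := fun (x : ℕ × ℕ) (b : ℕ) => b + x.2) (snd.add fst.snd') .X
    (fun n m y e _ hy h => ?_) (k := fun x => x.1) fst (x := fun _ => 0) (constNat 0)).comp
      (hf.pair hg) |>.congr fun x => ?_
  · rw [Env.le_prod, le_nat, le_nat] at hy
    rw [le_nat] at *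
    simp; omega
  · have : ∀ a b k : ℕ, (fun b => b + a)^[k] b = b + k * a := by
      intro a b k
      induction k with
      | zero => simp
      | succ k ih => rw [Function.iterate_succ_apply', ih]; ring
    simp [this]

theorem le_decide {f g : E → ℕ} (hf : PT f) (hg : PT g) : PT (fun x => decide (f x ≤ g x)) :=
  (hf.sub hg).eqZero.congr fun x => by simp [Nat.sub_eq_zero_iff_le]

theorem lt_decide {f g : E → ℕ} (hf : PT f) (hg : PT g) : PT (fun x => decide (f x < g x)) :=
  hf.succ.le_decide hg

theorem polyEval (P : Polynomial ℕ) {f : E → ℕ} (hf : PT f) : PT (fun x => P.eval (f x)) := by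
  induction P using Polynomial.induction_on' with
  | add p q hp hq => exact (hp.add hq).congr fun x => by simp
  | monomial k a =>
    induction k with
    | zero => exact (constNat a).congr fun x => by simp
    | succ k ih => exact (ih.mul hf).congr fun x => by simp [pow_succ, mul_assoc]

/-- Finitely many values can be changed. -/
theorem patch (n : ℕ) (v : List Bool → Bool) {c : E → List Bool} (hc : PT c) {g : E → List Bool}
    (hg : PT g) : PT (fun x => if (c x).length < n then [v (c x)] else g x) := by
  induction n generalizing v c with
  | zero => exact hg.congr fun x => by simp
  | succ n ih =>
    refine (hc.cases (constList [v []]) (g := fun b x => if (c x).tail.length < n then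
      [v (b :: (c x).tail)] else g x) fun b => ih (fun l => v (b :: l)) hc.tail).congr fun x => ?_
    rcases h : c x with _ | ⟨b, l⟩
    · simp
    · simp only [List.length_cons, Nat.add_lt_add_iff_right, List.tail_cons]
      by_cases h' : l.length < n <;> simp [h']

end PT

/-! ### Coding of pairs -/

/-- The two components of a pair of words. -/
def unpairStep (z : List Bool × List Bool) : List Bool × List Bool :=
  match z.1 with
  | [] => z
  | b :: l => match l with
    | [] => z
    | c :: _ => if b = c then (l.tail, b :: z.2) else z

/-- The two components of a pair of words. -/
def unpairWord (v : List Bool) : List Bool × List Bool :=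
  (fun z : List Bool × List Bool => (z.2.reverse, z.1.tail.tail)) (unpairStep^[v.length] (v, []))

/-- Equal pairs are consumed up to the separator, whose letters differ and at which the step stands
still; iterating more often than needed is therefore harmless. -/
theorem unpairWord_pairWord (w a : List Bool) : unpairWord (pairWord w a) = (w, a) := by
  have h₁ : ∀ w a c : List Bool, unpairStep^[w.length] (w.flatMap (fun b => [b, b]) ++ a, c) =
      (a, w.reverse ++ c) := by
    intro w a
    induction w with
    | nil => exact fun _ => rfl
    | cons b w ih =>
      intro c
      rw [List.length_cons, Function.iterate_succ_apply]
      simpa [unpairStep] using ih (b :: c)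
  have h₂ : ∀ k (c : List Bool), unpairStep^[k] (false :: true :: a, c) =
      (false :: true :: a, c) := by
    intro k c
    exact Function.iterate_fixed (by simp [unpairStep]) k
  have h₃ : w.length ≤ (pairWord w a).length := by
    have : (w.flatMap (fun b => [b, b])).length = 2 * w.length := by
      induction w with
      | nil => rfl
      | cons b w ih => simp [ih]; omega
    simp [pairWord, this]; omega
  obtain ⟨k, hk⟩ := Nat.exists_eq_add_of_le h₃
  rw [unpairWord, hk, add_comm, Function.iterate_add_apply]
  rw [pairWord, h₁, h₂]
  simp

namespace PT

open Env

variable {E F G J : Type} [Env E] [Env F] [Env G]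

theorem unpairWord {f : E → List Bool} (hf : PT f) : PT (fun x => unpairWord (f x)) := by
  have hs : PT unpairStep := by
    refine cases (E := List Bool × List Bool) (c := fun z => z.1) (f := fun z => z)
      (g := fun b z => match z.1.tail with
        | [] => z
        | c :: _ => if b = c then (z.1.tail.tail, b :: z.2) else z) fst id (fun b => ?_) |>.congr
          fun z => ?_
    · refine cases (E := List Bool × List Bool) (c := fun z => z.1.tail) (f := fun z => z)
        (g := fun c z => if b = c then (z.1.tail.tail, b :: z.2) else z) fst.tail id fun c => ?_
      by_cases h : b = c
      · simpa [h] using fst.tail.tail.pair (snd.cons c)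
      · simpa [h] using id
    · rcases z with ⟨_ | ⟨b, _ | ⟨c, l⟩⟩, a⟩ <;> simp [unpairStep]
  have := iter (f := fun (_ : E) z => unpairStep z) (hs.comp snd) 1 (fun n m y z _ _ h => ?_)
    hf.length (hf.pair nil)
  · exact this.snd'.reverse.pair this.fst'.tail.tail
  · obtain ⟨l, a⟩ := z
    rw [Env.le_prod, le_list, le_list] at h
    rcases l with _ | ⟨b, _ | ⟨c, l⟩⟩
    · simpa [unpairStep] using h.2.trans (by omega)
    · simp only [unpairStep, Env.le_prod, le_list, Polynomial.eval_one]; omega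
    · simp only [List.length_cons] at h
      by_cases hb : b = c
      · simp only [unpairStep, hb, if_true, Env.le_prod, le_list, List.tail_cons, List.length_cons,
          Polynomial.eval_one]
        omega
      · simp only [unpairStep, hb, if_false, Env.le_prod, le_list, List.length_cons,
          Polynomial.eval_one]
        omega

theorem pairWord {f g : E → List Bool} (hf : PT f) (hg : PT g) :
    PT (fun x => pairWord (f x) (g x)) := by
  refine (foldl (f := fun (_ : E) l b => b :: b :: l) (fun b => (snd.cons b).cons b) 2
    (fun n m y e b _ _ h => ?_) hf.reverse ((hg.cons true).cons false)).congr fun x => ?_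
  · rw [le_list] at *; simp; omega
  · have : ∀ l a : List Bool, l.reverse.foldl (fun l b => b :: b :: l) a =
        l.flatMap (fun b => [b, b]) ++ a := by
      intro l
      induction l with
      | nil => exact fun _ => rfl
      | cons b l ih => exact fun a => by simp [ih]
    rw [this]
    rfl

end PT

/-! Binary arithmetic. -/

/-- Natural numbers that are stored in binary, the lowest bit first. -/
@[ext] structure BNat where
  val : ℕ

namespace BNat

instance : Env BNat where
  width := 1
  enc n r := if r = 0 then n.val.bits else []
  enc_of_le l r h := by simp [(show r ≠ 0 by omega)]

/-- The value of a binary word, the lowest bit first. -/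
def ofBits : List Bool → ℕ
  | [] => 0
  | b :: l => Nat.bit b (ofBits l)

theorem ofBits_bits (n : ℕ) : ofBits n.bits = n := by
  induction n using Nat.binaryRec' with
  | zero => simp [ofBits]
  | bit b n h ih => rw [Nat.bits_append_bit _ _ h, ofBits, ih]

theorem ofBits_lt (l : List Bool) : ofBits l < 2 ^ l.length := by
  induction l with
  | nil => simp [ofBits]
  | cons b l ih => cases b <;> simp [ofBits, Nat.bit, pow_succ] <;> omega

theorem ofBits_concat (l : List Bool) (b : Bool) :
    ofBits (l ++ [b]) = ofBits l + 2 ^ l.length * b.toNat := by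
  induction l with
  | nil => cases b <;> simp [ofBits, Nat.bit]
  | cons c l ih => cases c <;> simp [ofBits, Nat.bit, ih, pow_succ] <;> ring

/-- One step of the addition (or subtraction) algorithm. -/
def addStep (op : Bool → Bool → Bool → Bool × Bool)
    (z : (List Bool × List Bool) × (Bool × List Bool)) :
    (List Bool × List Bool) × (Bool × List Bool) :=
  let r := op (z.1.1.head?.getD false) (z.1.2.head?.getD false) z.2.1
  ((z.1.1.tail, z.1.2.tail), (r.2, r.1 :: z.2.2))

theorem ofBits_eq_head_add (l : List Bool) :
    ofBits l = (l.head?.getD false).toNat + 2 * ofBits l.tail := by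
  cases l with
  | nil => simp [ofBits]
  | cons b l => cases b <;> simp [ofBits, Nat.bit]; omega

/-- Addition and subtraction are the cases `e = 1` and `e = -1`. The digits written so far, plus the
shifted value of what remains including the carry, form an invariant; the hypothesis is its
one-digit case. -/
theorem addStep_spec (op : Bool → Bool → Bool → Bool × Bool) (e : ℤ)
    (h : ∀ a b c : Bool, (a.toNat : ℤ) + e * (b.toNat + c.toNat) =
      (op a b c).1.toNat + 2 * (e * (op a b c).2.toNat)) (k : ℕ)
    (x y : List Bool) (c : Bool) (acc : List Bool) :
    let z := (addStep op)^[k] ((x, y), (c, acc))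
    z.1.1 = x.drop k ∧ z.1.2 = y.drop k ∧
      (ofBits z.2.2.reverse + 2 ^ z.2.2.length *
        (ofBits z.1.1 + e * (ofBits z.1.2 + z.2.1.toNat)) : ℤ)
        = ofBits acc.reverse + 2 ^ acc.length * (ofBits x + e * (ofBits y + c.toNat)) := by
  induction k generalizing x y c acc with
  | zero => simp
  | succ k ih =>
    intro z
    have hz : z = (addStep op)^[k] (addStep op ((x, y), (c, acc))) := Function.iterate_succ_apply ..
    have := ih x.tail y.tail (op (x.head?.getD false) (y.head?.getD false) c).2
      ((op (x.head?.getD false) (y.head?.getD false) c).1 :: acc)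
    rw [hz, addStep]
    refine ⟨by simpa using this.1, by simpa using this.2.1, this.2.2.trans ?_⟩
    have h' := h (x.head?.getD false) (y.head?.getD false) c
    rw [ofBits_eq_head_add x, ofBits_eq_head_add y, List.reverse_cons, ofBits_concat]
    push_cast
    rw [List.length_cons, List.length_reverse, pow_succ]
    linear_combination (-2 ^ acc.length) * h'

end BNat

namespace PT

open Env BNat

variable {E F G J : Type} [Env E] [Env F] [Env G]

/-- Binary numbers are stored without zeros at the high end, so a word has to be normalized: the
fold starts with the highest bit and discards zeros as long as nothing has been kept. -/
theorem ofBits {f : E → List Bool} (hf : PT f) : PT (fun x => BNat.mk (ofBits (f x))) := by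
  have h : PT (fun x => (f x).reverse.foldl
      (fun l b => if l = [] ∧ decide (b = false) = true then [] else b :: l) []) := by
    refine foldl (f := fun (_ : E) l b => if l = [] ∧ decide (b = false) = true then [] else b :: l)
      (fun b => ?_) 1 (fun n m y e b _ _ h => ?_) hf.reverse nil
    · exact (snd.isNil.and (constBool _)).ite nil (snd.cons b)
    · rw [le_list] at *
      split_ifs
      · simp
      · simpa using h
  refine h.of_enc (fun x => x) (fun _ => rfl) fun x => ?_
  have : ∀ l : List Bool, l.reverse.foldl
      (fun l b => if l = [] ∧ decide (b = false) = true then [] else b :: l) [] =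
        (BNat.ofBits l).bits := by
    intro l
    induction l with
    | nil => simp [BNat.ofBits]
    | cons b l ih =>
      rw [List.reverse_cons, List.foldl_append, ih]
      by_cases h : BNat.ofBits l = 0
      · cases b <;> simp [BNat.ofBits, h]
      · have h' : (BNat.ofBits l).bits ≠ [] := fun e => h (by
          rw [← BNat.ofBits_bits (BNat.ofBits l), e]; rfl)
        simp [BNat.ofBits, h', Nat.bits_append_bit (BNat.ofBits l) b (fun e => absurd e h)]
  rw [this]
  rfl

theorem bits {f : E → BNat} (hf : PT f) : PT (fun x => (f x).val.bits) :=
  hf.of_enc (fun x => x) (fun _ => rfl) fun _ => rfl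

theorem bool {c : E → Bool} (hc : PT c) {g : Bool → E → F} (hg : ∀ b, PT (g b)) :
    PT (fun x => g (c x) x) :=
  (hc.singleton.cases (hg false) hg).congr fun _ => rfl

theorem addStep (op : Bool → Bool → Bool → Bool × Bool) : PT (addStep op) := by
  have h : PT (fun z : (List Bool × List Bool) × (Bool × List Bool) =>
      op (z.1.1.head?.getD false) (z.1.2.head?.getD false) z.2.1) := by
    refine bool (E := (List Bool × List Bool) × (Bool × List Bool))
      (g := fun a z => op a (z.1.2.head?.getD false) z.2.1) fst.fst'.head fun a => ?_
    refine bool (E := (List Bool × List Bool) × (Bool × List Bool))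
      (g := fun b z => op a b z.2.1) fst.snd'.head fun b => ?_
    exact bool (E := (List Bool × List Bool) × (Bool × List Bool)) (g := fun c _ => op a b c)
      snd.fst' fun c => (constBool _).pair (constBool _)
  exact (fst.fst'.tail.pair fst.snd'.tail).pair (h.snd'.pair (h.fst'.consBool snd.snd'))

theorem addAlg (op : Bool → Bool → Bool → Bool × Bool) {f g : E → BNat} (hf : PT f) (hg : PT g) :
    PT (fun x => (BNat.addStep op)^[(f x).val.bits.length + (g x).val.bits.length]
      (((f x).val.bits, (g x).val.bits), (false, []))) := by
  refine iter (f := fun (_ : E) z => BNat.addStep op z) ((addStep op).comp snd) 1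
    (fun n m y z _ _ h => ?_) (hf.bits.length.add hg.bits.length)
    ((hf.bits.pair hg.bits).pair ((constBool _).pair nil))
  obtain ⟨⟨a, b⟩, c, d⟩ := z
  simp only [BNat.addStep, Env.le_prod, le_list, le_bool, List.length_tail, List.length_cons,
    Polynomial.eval_one] at *
  omega

theorem addB {f g : E → BNat} (hf : PT f) (hg : PT g) :
    PT (fun x => BNat.mk ((f x).val + (g x).val)) := by
  have h := addAlg (fun a b c => (xor a (xor b c), (a && b) || (a && c) || (b && c))) hf hg
  refine (h.snd'.fst'.consBool h.snd'.snd').reverse.ofBits.congr fun x => ?_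
  have := addStep_spec (fun a b c => (xor a (xor b c), (a && b) || (a && c) || (b && c))) 1
    (by decide) ((f x).val.bits.length + (g x).val.bits.length) (f x).val.bits (g x).val.bits
    false []
  obtain ⟨h₁, h₂, h₃⟩ := this
  rw [h₁, h₂, List.drop_of_length_le (by omega), List.drop_of_length_le (by omega)] at h₃
  simp only [BNat.ofBits_bits] at h₃
  ext
  rw [List.reverse_cons, ofBits_concat, List.length_reverse]
  simp [BNat.ofBits] at h₃
  exact_mod_cast h₃

/-- A borrow left at the end means that the true difference is negative; the truncated difference is
then zero, the empty word. -/
theorem subB {f g : E → BNat} (hf : PT f) (hg : PT g) :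
    PT (fun x => BNat.mk ((f x).val - (g x).val)) := by
  have h := addAlg (fun a b c => (xor a (xor b c), (!a && b) || (!a && c) || (b && c))) hf hg
  refine (bool (g := fun b x => bif b then [] else (((BNat.addStep
    (fun a b c => (xor a (xor b c), (!a && b) || (!a && c) || (b && c))))^[(f x).val.bits.length +
      (g x).val.bits.length] (((f x).val.bits, (g x).val.bits), (false, []))).2.2).reverse)
      h.snd'.fst' fun b => ?_).ofBits.congr fun x => ?_
  · cases b
    · exact h.snd'.snd'.reverse
    · exact nil
  have := addStep_spec (fun a b c => (xor a (xor b c), (!a && b) || (!a && c) || (b && c))) (-1)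
    (by decide) ((f x).val.bits.length + (g x).val.bits.length) (f x).val.bits (g x).val.bits
    false []
  obtain ⟨h₁, h₂, h₃⟩ := this
  rw [h₁, h₂, List.drop_of_length_le (by omega), List.drop_of_length_le (by omega)] at h₃
  simp only [BNat.ofBits_bits] at h₃
  ext
  simp only [BNat.ofBits, List.reverse_nil, List.length_nil] at h₃
  revert h₃
  generalize (BNat.addStep _)^[_] _ = z
  obtain ⟨_, c, acc⟩ := z
  intro h₃
  have hlt := ofBits_lt acc.reverse
  rw [List.length_reverse] at hlt
  cases c
  · simp at h₃ ⊢
    omega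
  · simp [BNat.ofBits] at h₃ ⊢
    have : (BNat.ofBits acc.reverse : ℤ) < 2 ^ acc.length := by exact_mod_cast hlt
    omega

theorem constB (n : ℕ) : PT (fun _ : E => BNat.mk n) :=
  (constList n.bits).of_enc (fun x => x) (fun _ => rfl) fun _ => rfl

theorem constMulB (k : ℕ) {f : E → BNat} (hf : PT f) : PT (fun x => BNat.mk (k * (f x).val)) := by
  induction k with
  | zero => exact (constB 0).congr fun x => by simp
  | succ k ih => exact (ih.addB hf).congr fun x => by ext; simp [add_mul]

theorem sumB {J : Type} (s : Finset J) {f : J → E → BNat} (hf : ∀ j, PT (f j)) :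
    PT (fun x => BNat.mk (∑ j ∈ s, (f j x).val)) := by
  classical
  induction s using Finset.induction_on with
  | empty => exact (constB 0).congr fun x => by simp
  | insert a s ha ih => exact ((hf a).addB ih).congr fun x => by ext; simp [ha]

theorem eqZeroB {f : E → BNat} (hf : PT f) : PT (fun x => decide ((f x).val = 0)) :=
  hf.bits.isNil.congr fun x => by
    have : (f x).val.bits = [] ↔ (f x).val = 0 :=
      ⟨fun h => by rw [← BNat.ofBits_bits (f x).val, h]; rfl, fun h => by simp [h]⟩
    simp [this]

theorem leB {f g : E → BNat} (hf : PT f) (hg : PT g) :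
    PT (fun x => decide ((f x).val ≤ (g x).val)) :=
  (hf.subB hg).eqZeroB.congr fun x => by simp [Nat.sub_eq_zero_iff_le]

end PT

theorem Env.le_bnat {x : BNat} {n : ℕ} : Env.Le x n ↔ x.val.bits.length ≤ n := by
  refine ⟨fun h => h 0, fun h r => ?_⟩
  by_cases hr : r = 0 <;> simp [enc, hr, h]

/-! Machines for polynomial-time functions. -/

theorem Function.update_update_eq {K α : Type} [DecidableEq K] (s : K → α) (i j : K) (a b : α) :
    Function.update (Function.update s i a) j b =
      fun k => if k = j then b else if k = i then a else s k := by
  ext1 k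
  simp only [Function.update_apply]

namespace PT

open Env

variable {E : Type} [Env E]

/-- A program mentions finitely many registers, so reduction modulo a larger number is injective on
them. At least two work stacks are provided, since two words may have to be loaded. -/
theorem exists_prog {f : E → List Bool} (hf : PT f) (ι : Type) [DecidableEq ι] :
    ∃ (m : ℕ) (p : Prog (ι ⊕ Fin (m + 2))) (P : Polynomial ℕ),
      ∀ (n : ℕ) (x : E) (S : ι ⊕ Fin (m + 2) → List Bool), Le x n →
        (∀ i : Fin (m + 2), S (.inr i) = enc x i) →
          ∃ t ≤ P.eval n, ∃ S', Exec p S S' t ∧ S' (.inr 0) = f x := by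
  obtain ⟨p, P, hp⟩ := hf
  obtain ⟨m, hm⟩ := p.finite_regs.bddAbove
  refine ⟨m, p.map fun r => .inr (Fin.ofNat (m + 2) r), P, fun n x S hx hS => ?_⟩
  obtain ⟨t, ht, h⟩ := hp n x hx
  obtain ⟨S', hS', h', -⟩ := h.map (fun r => (.inr (Fin.ofNat (m + 2) r) : ι ⊕ Fin (m + 2)))
    (D := {r | r < m + 2}) (fun a ha b hb hab => by
      have := congrArg Fin.val (Sum.inr_injective hab)
      simpa [Fin.ofNat, Nat.mod_eq_of_lt ha, Nat.mod_eq_of_lt hb] using this)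
    (fun r hr => by have := hm hr; simp; omega) S
    (fun k hk => by rw [hS]; simp [Fin.ofNat, Nat.mod_eq_of_lt hk])
  exact ⟨t, ht, S', hS', h' 0 (by simp)⟩

/-- Moving the input to a work stack reverses it; composing with `reverse` compensates. -/
theorem exists_machine {f : List Bool → List Bool} (hf : PT f) :
    ∃ (M : Machine Unit) (P : Polynomial ℕ), ∀ w,
      M.OutputsIn (fun _ => w) (f w) (P.eval w.length) := by
  obtain ⟨m, p, P, hp⟩ := (hf.comp (reverse (f := fun w : List Bool => w) id)).exists_prog Unit
  refine ⟨(Prog.seq (.mv (.inl ()) (.inr 0)) p).machine 0, 4 * .X + 1 + P + 1, fun w => ?_⟩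
  have h₁ := Exec.mv (i := (.inl () : Unit ⊕ Fin (m + 2))) (j := .inr 0) (by simp)
    (Sum.elim (fun _ => w) fun _ => [])
  rw [Function.update_update_eq] at h₁
  obtain ⟨t, ht, S', hS', h'⟩ := hp w.length w.reverse
    (fun k => if k = .inr 0 then w.reverse ++ [] else if k = .inl () then [] else
      Sum.elim (fun _ => w) (fun _ => []) k) (by simp) (fun i => by
      by_cases hi : i = 0
      · subst hi; simp [enc]
      · have : (i : ℕ) ≠ 0 := fun e => hi (Fin.ext e)
        simp [enc, hi, this])
  have := (Exec.seq h₁ hS').outputsIn 0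
  rw [h', List.reverse_reverse] at this
  obtain ⟨c, hc, hc', ⟨⟨e, he⟩⟩⟩ := this
  refine ⟨c, hc, hc', ⟨⟨e, he.trans ?_⟩⟩⟩
  simp
  omega

end PT

namespace Prog

variable {K : Type}

/-- Move one letter from the stack `i` to the stack `j`. -/
def mvTop (i j : K) : Prog K :=
  case i skip (seq (pop i) (push j false)) (seq (pop i) (push j true))

end Prog

theorem Exec.mvTop_nil {K : Type} [DecidableEq K] {i j : K} {s : K → List Bool} (h : s i = []) :
    Exec (.mvTop i j) s s 2 := .case_nil h (.skip s)

theorem Exec.mvTop_cons {K : Type} [DecidableEq K] {i j : K} (hij : i ≠ j) {s : K → List Bool}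
    {b : Bool} {l : List Bool} (h : s i = b :: l) :
    Exec (.mvTop i j) s (fun k => if k = j then b :: s j else if k = i then l else s k) 3 := by
  cases b
  · refine .case_false h (.seq (.of_eq (.pop _ _) (by rw [h]) rfl) (.of_eq (.push _ _ _) ?_ rfl))
    simp [hij.symm, Function.update_update_eq]
  · refine .case_true h (.seq (.of_eq (.pop _ _) (by rw [h]) rfl) (.of_eq (.push _ _ _) ?_ rfl))
    simp [hij.symm, Function.update_update_eq]

/-- The input stacks and the first two work stacks. -/
def loadState (m : ℕ) (x z u v : List Bool) : Fin 2 ⊕ Fin (m + 2) → List Bool :=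
  Sum.elim ![x, z] fun i => if i = 0 then u else if i = 1 then v else []

/-- Move the second input, and as many letters of the first input, to the work stacks. -/
def Prog.load (m : ℕ) : Prog (Fin 2 ⊕ Fin (m + 2)) :=
  .loop (.inl 1) (.seq (.mvTop (.inl 1) (.inr 1)) (.mvTop (.inl 0) (.inr 0)))

theorem Exec.load (m : ℕ) (x z u v : List Bool) :
    ∃ t ≤ 7 * z.length + 1, Exec (.load m) (loadState m x z u v)
      (loadState m (x.drop z.length) [] ((x.take z.length).reverse ++ u) (z.reverse ++ v)) t := by
  induction z generalizing x u v with
  | nil => exact ⟨1, by simp, .of_eq (.loop_nil (by simp [loadState])) (by simp) rfl⟩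
  | cons b z ih =>
    have h₁ : Exec (.mvTop (.inl 1) (.inr 1)) (loadState m x (b :: z) u v)
        (loadState m x z u (b :: v)) 3 := by
      refine (Exec.mvTop_cons (by simp) (b := b) (l := z) (by simp [loadState])).of_eq ?_ rfl
      ext1 k
      rcases k with k | k
      · fin_cases k <;> simp [loadState]
      · by_cases h : k = 1
        · subst h; simp [loadState]
        · simp [loadState, h]
    have h₂ : ∃ t ≤ 3, Exec (.mvTop (.inl 0) (.inr 0)) (loadState m x z u (b :: v))
        (loadState m x.tail z ((x.take 1).reverse ++ u) (b :: v)) t := by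
      cases x with
      | nil => exact ⟨2, by omega, .mvTop_nil rfl⟩
      | cons c x =>
        refine ⟨3, le_rfl, (Exec.mvTop_cons (by simp) (b := c) (l := x)
          (by simp [loadState])).of_eq ?_ rfl⟩
        ext1 k
        rcases k with k | k
        · fin_cases k <;> simp [loadState]
        · by_cases h : k = 0
          · subst h; simp [loadState]
          · simp [loadState, h]
    obtain ⟨t₂, ht₂, h₂⟩ := h₂
    obtain ⟨t, ht, h⟩ := ih x.tail ((x.take 1).reverse ++ u) (b :: v)
    refine ⟨_, ?_, .loop_cons (by simp [loadState]) (.seq h₁ h₂) (h.of_eq ?_ rfl)⟩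
    · simp; omega
    · cases x <;> simp

/-- The first input is read only as far as the second is long, so the time is bounded by the second
alone. This yields running times uniform in the length of the prefix of `β` that is offered. The
words arrive reversed on the work stacks. -/
theorem PT.exists_machine₂ {f : List Bool × List Bool → List Bool} (hf : PT f) :
    ∃ (M : Machine (Fin 2)) (P : Polynomial ℕ), ∀ x z,
      M.OutputsIn ![x, z] (f ((x.take z.length).reverse, z.reverse)) (P.eval z.length) := by
  obtain ⟨m, p, P, hp⟩ := hf.exists_prog (Fin 2)
  refine ⟨(Prog.seq (.load m) p).machine 0, 7 * .X + 1 + P + 1, fun x z => ?_⟩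
  obtain ⟨t₁, ht₁, h₁⟩ := Exec.load m x z [] []
  obtain ⟨t, ht, S', hS', h'⟩ := hp z.length ((x.take z.length).reverse, z.reverse)
    (loadState m (x.drop z.length) [] ((x.take z.length).reverse ++ []) (z.reverse ++ []))
    (by simp) (fun i => by
      rcases i with ⟨_ | _ | i, hi⟩
      · simp [loadState, Env.enc, Env.width]
      · simp [loadState, Env.enc, Env.width]
      · have h₀ : (⟨i + 1 + 1, hi⟩ : Fin (m + 2)) ≠ 0 := fun h => by
          simpa using congrArg Fin.val h
        have h₁ : (⟨i + 1 + 1, hi⟩ : Fin (m + 2)) ≠ 1 := fun h => by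
          simpa using congrArg Fin.val h
        simp [loadState, Env.enc, Env.width, h₀, h₁])
  have e : (Sum.elim ![x, z] fun _ => [] : Fin 2 ⊕ Fin (m + 2) → List Bool) =
      loadState m x z [] [] := by
    ext1 k
    rcases k with k | k <;> simp [loadState]
  have := (e ▸ Exec.seq h₁ hS').outputsIn 0
  rw [h'] at this
  obtain ⟨c, hc, hc', ⟨⟨e, he⟩⟩⟩ := this
  refine ⟨c, hc, hc', ⟨⟨e, he.trans ?_⟩⟩⟩
  simp
  omega

/-! Bit stack machines: all control is on the stacks. -/

/-- What happens to a stack in one step. -/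
inductive Act
  | keep
  | pop
  | push (b : Bool)

/-- The effect of an action. -/
def Act.app : Act → List Bool → List Bool
  | keep, l => l
  | pop, l => l.tail
  | push b, l => b :: l

/-- A machine that has only stacks; an action on each stack is determined by the tops. -/
def Bsm (J : Type) : Type := (J → Option Bool) → J → Act

/-- The tops of all stacks. -/
def tops {J : Type} (s : J → List Bool) : J → Option Bool := fun j => (s j).head?

def Bsm.step {J : Type} (δ : Bsm J) (s : J → List Bool) : J → List Bool :=
  fun j => (δ (tops s) j).app (s j)

namespace PT

open Env

variable {E F : Type} [Env E] [Env F]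

/-- There are finitely many stacks, so the tops can be found by successive case distinctions; in
each case they are a constant. -/
theorem tops {J : Type} [Fintype J] {f : (J → Option Bool) → (J → List Bool) → F}
    (hf : ∀ τ, PT (f τ)) : PT (fun s => f (tops s) s) := by
  classical
  have key : ∀ (l : List J) (f : (J → Option Bool) → (J → List Bool) → F), (∀ τ, PT (f τ)) →
      PT (fun s => f (fun j => if j ∈ l then (s j).head? else none) s) := by
    intro l
    induction l with
    | nil => exact fun f hf => by simpa using hf _
    | cons a l ih =>
      intro f hf
      refine (cases (apply a) (ih (fun τ => f (Function.update τ a none)) fun τ => hf _)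
        (g := fun b s => f (Function.update (fun j => if j ∈ l then (s j).head? else none) a
          (some b)) s) fun b => ih (fun τ => f (Function.update τ a (some b))) fun τ => hf _).congr
            fun s => ?_
      cases h : s a with
      | nil =>
        simp only
        congr 1
        ext1 j
        by_cases hj : j = a
        · subst hj; simp [h]
        · simp [hj]
      | cons b t =>
        simp only
        congr 1
        ext1 j
        by_cases hj : j = a
        · subst hj; simp [h]
        · simp [hj]
  refine (key Finset.univ.toList f hf).congr fun s => ?_
  congr 1
  ext1 j
  simp [_root_.tops]

theorem bsmStep {J : Type} [Fintype J] (δ : Bsm J) : PT δ.step := by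
  refine tops (f := fun τ s j => (δ τ j).app (s j)) fun τ => pi fun j => ?_
  cases h : δ τ j with
  | keep => exact apply j
  | pop => exact (apply j).tail
  | push b => exact (apply j).cons b

theorem bsmRun {J : Type} [Fintype J] (δ : Bsm J) {k : E → ℕ} (hk : PT k)
    {s : E → J → List Bool} (hs : PT s) : PT (fun x => δ.step^[k x] (s x)) := by
  refine iter (f := fun (_ : E) s => δ.step s) ((bsmStep δ).comp snd) 1 (fun n m y s _ _ h => ?_)
    hk hs
  rw [Env.le_pi] at *
  intro j
  have := h j
  rw [le_list] at *
  simp only [Bsm.step, Polynomial.eval_one]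
  cases δ (_root_.tops s) j <;> simp [Act.app] <;> omega

theorem mapBool (g : Bool → Bool) {f : E → List Bool} (hf : PT f) :
    PT (fun x => (f x).map g) := by
  refine (foldl (f := fun (_ : E) l b => g b :: l) (fun b => snd.cons _) 1
    (fun n m y e b _ _ h => ?_) hf nil).reverse.congr fun x => ?_
  · rw [le_list] at *; simpa using h
  · have : ∀ l a : List Bool, l.foldl (fun l b => g b :: l) a = (l.map g).reverse ++ a := by
      intro l
      induction l with
      | nil => exact fun _ => rfl
      | cons b l ih => exact fun a => by simp [ih]
    simp [this]

end PT

/-! ### From machines to bit stack machines -/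

namespace Machine

open Turing.TM2

variable {ι : Type} [DecidableEq ι] (M : Machine ι)

abbrev Sym : Type := Bool ⊕ M.A

abbrev St : Type := Stmt (fun _ : ι ⊕ M.W => M.Sym) M.Λ M.σ

/-- The control states: a statement of the program and a memory state. -/
def Ctrl : Type := {q : M.St // ∃ l, q ∈ stmts₁ (M.prog l)} × M.σ

instance : Finite M.Ctrl := by
  have : {q : M.St | ∃ l, q ∈ stmts₁ (M.prog l)}.Finite := by
    have h : {q : M.St | ∃ l, q ∈ stmts₁ (M.prog l)} = ⋃ l, (stmts₁ (M.prog l) : Set M.St) := by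
      ext; simp
    rw [h]
    exact Set.finite_iUnion fun l => Finset.finite_toSet _
  have : Finite {q : M.St // ∃ l, q ∈ stmts₁ (M.prog l)} := this
  exact inferInstanceAs (Finite ({q : M.St // ∃ l, q ∈ stmts₁ (M.prog l)} × M.σ))

/-- The stacks of the bit stack machine: one for each control state, and one for each symbol and
each stack. -/
abbrev J : Type := M.Ctrl ⊕ ((ι ⊕ M.W) × M.Sym)

/-- The control state that follows after one operation. -/
def next : M.St → M.σ → (ι ⊕ M.W → Option M.Sym) → Option (M.St × M.σ)
  | .push _ _ q, v, _ => some (q, v)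
  | .peek k f q, v, T => some (q, f v (T k))
  | .pop k f q, v, T => some (q, f v (T k))
  | .load a q, v, _ => some (q, a v)
  | .branch f q₁ q₂, v, _ => some (bif f v then q₁ else q₂, v)
  | .goto f, v, _ => some (M.prog (f v), v)
  | .halt, _, _ => none

/-- The effect of one operation on the stacks. -/
def sact : M.St → M.σ → ι ⊕ M.W → List M.Sym → List M.Sym
  | .push k f _, v, k', l => if k' = k then f v :: l else l
  | .pop k _ _, _, k', l => if k' = k then l.tail else l
  | _, _, _, l => l

open Classical in
/-- The effect of one operation on the bit stacks. -/
noncomputable def bact : M.St → M.σ → (ι ⊕ M.W) × M.Sym → Act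
  | .push k f _, v, k' => if k'.1 = k then .push (decide (f v = k'.2)) else .keep
  | .pop k _ _, _, k' => if k'.1 = k then .pop else .keep
  | _, _, _ => .keep

/-- Configurations between single operations. -/
abbrev FCfg : Type := Option (M.St × M.σ) × (ι ⊕ M.W → List M.Sym)

/-- One operation. -/
def fstep (c : M.FCfg) : M.FCfg :=
  match c.1 with
  | none => c
  | some (q, v) => (M.next q v fun k => (c.2 k).head?, fun k => M.sact q v k (c.2 k))

open Classical in
/-- A configuration on bit stacks. -/
noncomputable def encode (c : M.FCfg) : M.J → List Bool
  | .inl x => if c.1 = some (x.1.1, x.2) then [true] else []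
  | .inr (k, a) => (c.2 k).map fun b => decide (b = a)

open Classical in
/-- The bit stack machine of a machine. -/
noncomputable def bsm : Bsm M.J := fun τ =>
  if h : ∃ x, τ (.inl x) = some true then
    let c := h.choose
    let c' := M.next c.1.1 c.2 fun k =>
      if h : ∃ a, τ (.inr (k, a)) = some true then some h.choose else none
    fun
    | .inl x =>
      if c' = some (x.1.1, x.2) then if x = c then .keep else .push true
      else if x = c then .pop else .keep
    | .inr x => M.bact c.1.1 c.2 x
  else fun _ => .keep

/-- The control state is one of the program. -/
def Valid (c : M.FCfg) : Prop := ∀ q v, c.1 = some (q, v) → ∃ l, q ∈ stmts₁ (M.prog l)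

variable {M}

theorem Valid.fstep {c : M.FCfg} (h : M.Valid c) : M.Valid (M.fstep c) := by
  classical
  obtain ⟨c, S⟩ := c
  intro q' v' he
  cases c with
  | none => simp [Machine.fstep] at he
  | some c =>
    obtain ⟨q, v⟩ := c
    obtain ⟨l, hl⟩ := h q v rfl
    have sub := stmts₁_trans hl
    simp only [Machine.fstep] at he
    cases q with
    | push k f q | peek k f q | pop k f q | load k q =>
      simp only [next, Option.some.injEq, Prod.mk.injEq] at he
      exact ⟨l, sub (by rw [stmts₁, ← he.1]; exact Finset.mem_insert_of_mem stmts₁_self)⟩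
    | branch f q₁ q₂ =>
      simp only [next, Option.some.injEq, Prod.mk.injEq] at he
      refine ⟨l, sub ?_⟩
      rw [stmts₁, ← he.1]
      cases f v
      · exact Finset.mem_insert_of_mem (Finset.mem_union_right _ stmts₁_self)
      · exact Finset.mem_insert_of_mem (Finset.mem_union_left _ stmts₁_self)
    | goto f =>
      simp only [next, Option.some.injEq, Prod.mk.injEq] at he
      exact ⟨f v, by rw [← he.1]; exact stmts₁_self⟩
    | halt => simp [next] at he

/-- Empty stacks stay empty. The simulating network relies on this at the times when no
configuration is passing through. -/
theorem bsm_idle : M.bsm (fun _ => none) = fun _ => .keep := by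
  simp [bsm]

/-- In an encoded configuration at most one control stack is nonempty, and among the stacks
belonging to one stack of the machine at most one has top `true`. The choices in the definition of
`bsm` are therefore forced. -/
theorem bsm_step_encode {c : M.FCfg} (h : M.Valid c) :
    M.bsm.step (M.encode c) = M.encode (M.fstep c) := by
  classical
  obtain ⟨c, S⟩ := c
  have ht : ∀ x, tops (M.encode (c, S)) (.inl x) = some true ↔ c = some (x.1.1, x.2) := by
    intro x
    simp only [tops, encode]
    split_ifs with h <;> simp [h]
  cases c with
  | none =>
    have : ¬ ∃ x, tops (M.encode (none, S)) (.inl x) = some true := by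
      rintro ⟨x, hx⟩
      rw [ht] at hx
      cases hx
    ext1 j
    rw [Bsm.step, bsm, dif_neg this]
    rfl
  | some c =>
    obtain ⟨q, v⟩ := c
    obtain ⟨l, hl⟩ := h q v rfl
    have hex : ∃ x, tops (M.encode (some (q, v), S)) (.inl x) = some true :=
      ⟨(⟨q, l, hl⟩, v), (ht _).2 rfl⟩
    have hc : hex.choose = (⟨q, l, hl⟩, v) := by
      have := (ht _).1 hex.choose_spec
      simp only [Option.some.injEq, Prod.mk.injEq] at this
      exact Prod.ext (Subtype.ext this.1.symm) this.2.symm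
    have hT : ∀ k, (if h : ∃ a, tops (M.encode (some (q, v), S)) (.inr (k, a)) = some true
        then some h.choose else none) = (S k).head? := by
      intro k
      have hk : ∀ a, tops (M.encode (some (q, v), S)) (.inr (k, a)) = some true ↔
          (S k).head? = some a := by
        intro a
        simp only [tops, encode]
        cases S k <;> simp
      split_ifs with h
      · exact ((hk _).1 h.choose_spec).symm
      · cases hS : S k with
        | nil => rfl
        | cons a t => exact absurd ⟨a, (hk a).2 (by simp [hS])⟩ h
    ext1 j
    rw [Bsm.step, bsm, dif_pos hex, hc]
    simp only [hT]
    rcases j with x | ⟨k, a⟩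
    · have hx : x = (⟨q, l, hl⟩, v) ↔ (q, v) = (x.1.1, x.2) := by
        constructor
        · rintro rfl; rfl
        · intro e
          simp only [Prod.mk.injEq] at e
          exact Prod.ext (Subtype.ext e.1.symm) e.2.symm
      simp only [encode, fstep, hx, Option.some.injEq]
      by_cases h₁ : (M.next q v fun k => (S k).head?) = some (x.1.1, x.2) <;>
        by_cases h₂ : (q, v) = (x.1.1, x.2) <;> simp only [h₁, h₂, if_true, if_false, Act.app] <;>
        rfl
    · simp only [encode, fstep]
      cases q <;> simp only [bact, sact] <;> try rfl
      all_goals split_ifs <;> simp [Act.app]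

/-- The configuration between operations at the start of a machine step. -/
def abs (M : Machine ι) (c : M.Cfg) : M.FCfg := (some (c.l.elim .halt M.prog, c.var), c.stk)

/-- The number of operations in a statement. -/
def depth : M.St → ℕ
  | .push _ _ q => depth q + 1
  | .peek _ _ q => depth q + 1
  | .pop _ _ q => depth q + 1
  | .load _ q => depth q + 1
  | .branch _ q₁ q₂ => max (depth q₁) (depth q₂) + 1
  | .goto _ => 1
  | .halt => 0

/-- The statement `halt` counts as no operation, since `abs` represents a halted configuration by a
pending `halt`. -/
theorem exists_iterate_fstep (q : M.St) (v : M.σ) (S : ι ⊕ M.W → List M.Sym) :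
    ∃ n ≤ depth q, M.fstep^[n] (some (q, v), S) = M.abs (stepAux q v S) := by
  induction q generalizing v S with
  | push k f q ih =>
    obtain ⟨n, hn, h⟩ := ih v (Function.update S k (f v :: S k))
    refine ⟨n + 1, by simp [depth, hn], ?_⟩
    rw [Function.iterate_succ_apply, stepAux, ← h]
    congr 1
    refine Prod.ext rfl (funext fun j => ?_)
    by_cases hj : j = k
    · subst hj; simp [fstep, sact]
    · simp [fstep, sact, hj]
  | pop k f q ih =>
    obtain ⟨n, hn, h⟩ := ih (f v (S k).head?) (Function.update S k (S k).tail)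
    refine ⟨n + 1, by simp [depth, hn], ?_⟩
    rw [Function.iterate_succ_apply, stepAux, ← h]
    congr 1
    refine Prod.ext rfl (funext fun j => ?_)
    by_cases hj : j = k
    · subst hj; simp [fstep, sact]
    · simp [fstep, sact, hj]
  | peek k f q ih =>
    obtain ⟨n, hn, h⟩ := ih (f v (S k).head?) S
    exact ⟨n + 1, by simp [depth, hn], h⟩
  | load a q ih =>
    obtain ⟨n, hn, h⟩ := ih (a v) S
    exact ⟨n + 1, by simp [depth, hn], h⟩
  | branch f q₁ q₂ ih₁ ih₂ =>
    cases hf : f v with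
    | true =>
      obtain ⟨n, hn, h⟩ := ih₁ v S
      refine ⟨n + 1, by simp [depth, hn], ?_⟩
      rw [Function.iterate_succ_apply, stepAux, hf, cond_true, ← h]
      simp [fstep, next, hf, sact]
    | false =>
      obtain ⟨n, hn, h⟩ := ih₂ v S
      refine ⟨n + 1, by simp [depth, hn], ?_⟩
      rw [Function.iterate_succ_apply, stepAux, hf, cond_false, ← h]
      simp [fstep, next, hf, sact]
  | goto f => exact ⟨1, le_rfl, rfl⟩
  | halt => exact ⟨0, le_rfl, rfl⟩

theorem exists_bound (M : Machine ι) : ∃ C : ℕ, ∀ (n : ℕ) (c c' : M.Cfg),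
    (flip Bind.bind (step M.prog))^[n] (some c) = some c' →
      ∃ k ≤ C * n, M.fstep^[k] (M.abs c) = M.abs c' := by
  obtain ⟨C, hC⟩ := (Set.finite_range fun l => depth (M.prog l)).bddAbove
  refine ⟨C, fun n => ?_⟩
  induction n with
  | zero =>
    intro c c' h
    obtain rfl : c = c' := by simpa using h
    exact ⟨0, by simp, rfl⟩
  | succ n ih =>
    intro c c' h
    rw [Function.iterate_succ_apply'] at h
    obtain ⟨c₁, h₁, h₂⟩ : ∃ c₁, (flip Bind.bind (step M.prog))^[n] (some c) = some c₁ ∧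
        step M.prog c₁ = some c' := by
      cases he : (flip Bind.bind (step M.prog))^[n] (some c) with
      | none => rw [he] at h; cases h
      | some c₁ => rw [he] at h; exact ⟨c₁, rfl, h⟩
    obtain ⟨k, hk, hk'⟩ := ih c c₁ h₁
    obtain ⟨l, v, S⟩ := c₁
    cases l with
    | none => cases h₂
    | some l =>
      rw [step, Option.some.injEq] at h₂
      obtain ⟨j, hj, hj'⟩ := exists_iterate_fstep (M.prog l) v S
      refine ⟨j + k, ?_, ?_⟩
      · have : depth (M.prog l) ≤ C := hC ⟨l, rfl⟩
        rw [mul_add]; omega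
      · rw [Function.iterate_add_apply, hk', ← h₂]
        exact hj'

open Classical in
/-- The bit stacks at the start of a computation. -/
noncomputable def bsmInit (M : Machine ι) (x : ι → List Bool) : M.J → List Bool
  | .inl c => if (M.prog M.main, M.start) = (c.1.1, c.2) then [true] else []
  | .inr (.inl i, a) => (x i).map fun b => decide (Sum.inl b = a)
  | .inr (.inr _, _) => []

/-- The tops of the bit stacks show that the machine halts. -/
def HaltTops (M : Machine ι) (τ : M.J → Option Bool) : Prop :=
  ∃ c : M.Ctrl, c.1.1 = .halt ∧ τ (.inl c) = some true

/-- The stack of the bit stack machine on which the output is found. -/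
def outJ (M : Machine ι) : M.J := .inr (.inr M.out, .inl true)

/-- Executing the pending `halt` empties the control, and nothing changes afterwards. So the halting
condition holds at exactly one time, which a network needs to answer just once, and the output
persists, which allows running with a clock. -/
theorem exists_bsm_run (M : Machine ι) : ∃ C : ℕ, ∀ x y t, M.OutputsIn x y t →
    ∃ n ≤ C * t, (∀ k, n ≤ k → M.bsm.step^[k] (M.bsmInit x) M.outJ = y) ∧
      ∀ k, M.HaltTops (tops (M.bsm.step^[k] (M.bsmInit x))) ↔ k = n := by
  classical
  obtain ⟨C, hC⟩ := M.exists_bound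
  refine ⟨C, fun x y t ⟨c, hc, hc', ⟨⟨⟨m, hm⟩, hmt⟩⟩⟩ => ?_⟩
  obtain ⟨n, hn, h⟩ := hC m _ _ hm
  have hinit : M.bsmInit x = M.encode (M.abs (M.init x)) := by
    ext1 j
    rcases j with c | ⟨i | w, a⟩
    · simp [bsmInit, encode, abs, Machine.init]
    · simp [bsmInit, encode, abs, Machine.init]
    · simp [bsmInit, encode, abs, Machine.init]
  have hval : ∀ k, M.Valid (M.fstep^[k] (M.abs (M.init x))) := by
    intro k
    induction k with
    | zero =>
      intro q v e
      simp only [abs, Machine.init, Function.iterate_zero, id_eq, Option.elim_some,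
        Option.some.injEq, Prod.mk.injEq] at e
      exact ⟨M.main, by rw [← e.1]; exact stmts₁_self⟩
    | succ k ih => rw [Function.iterate_succ_apply']; exact ih.fstep
  have hrun : ∀ k, M.bsm.step^[k] (M.bsmInit x) = M.encode (M.fstep^[k] (M.abs (M.init x))) := by
    intro k
    induction k with
    | zero => exact hinit
    | succ k ih =>
      rw [Function.iterate_succ_apply', Function.iterate_succ_apply', ih, bsm_step_encode (hval k)]
  have hn' : M.fstep^[n] (M.abs (M.init x)) = (some (.halt, c.var), c.stk) := by
    rw [h, abs, hc]; rfl
  have hafter : ∀ k, M.fstep^[n + 1 + k] (M.abs (M.init x)) = (none, c.stk) := by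
    intro k
    rw [add_comm, Function.iterate_add_apply, Function.iterate_succ_apply', hn']
    exact Function.iterate_fixed rfl k
  have hhalt : ∀ k, M.HaltTops (tops (M.bsm.step^[k] (M.bsmInit x))) ↔
      ∃ v, (M.fstep^[k] (M.abs (M.init x))).1 = some (.halt, v) := by
    intro k
    rw [hrun]
    have ht : ∀ x c, tops (M.encode c) (.inl x) = some true ↔ c.1 = some (x.1.1, x.2) := by
      intro x c
      simp only [tops, encode]
      split_ifs with h <;> simp [h]
    constructor
    · rintro ⟨c, hc, hc'⟩
      rw [ht, hc] at hc'
      exact ⟨_, hc'⟩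
    · rintro ⟨v, hv⟩
      obtain ⟨l, hl⟩ := hval k _ _ hv
      exact ⟨(⟨.halt, l, hl⟩, v), rfl, (ht _ _).2 hv⟩
  refine ⟨n, hn.trans (Nat.mul_le_mul_left _ hmt), fun k hk => ?_, fun k => ?_⟩
  · rw [hrun]
    have hS : (M.fstep^[k] (M.abs (M.init x))).2 = c.stk := by
      rcases hk.eq_or_lt with rfl | hk
      · rw [hn']
      · obtain ⟨j, rfl⟩ := Nat.exists_eq_add_of_le hk
        rw [hafter]
    -- The output consists of bits, and comparing them with `true` gives the word itself.
    simp only [outJ, encode, hS, hc', List.map_map]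
    convert List.map_id y using 2
    ext b
    simp
  · rw [hhalt]
    constructor
    · rintro ⟨v, hv⟩
      rcases lt_trichotomy k n with hk | hk | hk
      · obtain ⟨j, rfl⟩ := Nat.exists_eq_add_of_le hk
        have h₁ : M.fstep^[k + 1] (M.abs (M.init x)) =
            (none, (M.fstep^[k] (M.abs (M.init x))).2) := by
          rw [Function.iterate_succ_apply']
          generalize M.fstep^[k] (M.abs (M.init x)) = d at hv
          obtain ⟨d, S⟩ := d
          subst hv
          rfl
        rw [Nat.succ_eq_add_one, add_comm, Function.iterate_add_apply, h₁,
          Function.iterate_fixed rfl j] at hn'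
        cases hn'
      · exact hk
      · obtain ⟨j, rfl⟩ := Nat.exists_eq_add_of_le hk
        rw [hafter] at hv
        cases hv
    · rintro rfl
      exact ⟨_, by rw [hn']⟩

end Machine

namespace PT

open Env

variable {E : Type} [Env E]

/-- A machine can be simulated, with a clock. -/
theorem exists_sim {ι : Type} [DecidableEq ι] [Fintype ι] (M : Machine ι) {x : E → ι → List Bool}
    (hx : PT x) {k : E → ℕ} (hk : PT k) :
    ∃ f : E → List Bool, PT f ∧ ∀ e y, M.OutputsIn (x e) y (k e) → f e = y := by
  classical
  have : Fintype M.Ctrl := Fintype.ofFinite _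
  obtain ⟨C, hC⟩ := M.exists_bsm_run
  refine ⟨fun e => M.bsm.step^[C * k e] (M.bsmInit (x e)) M.outJ, ?_, fun e y h => ?_⟩
  · refine (apply M.outJ).comp (bsmRun M.bsm ((constNat C).mul hk) (pi fun j => ?_))
    rcases j with c | ⟨i | w, a⟩
    · exact constList _
    · exact mapBool _ ((apply i).comp hx)
    · exact constList _
  · obtain ⟨n, hn, h₁, -⟩ := hC _ _ _ h
    exact h₁ _ hn

end PT

/-! ### Polynomial bounds, the class P, and advice with computable length -/

theorem exists_polynomial_of_mem_poly {f : ℕ → ℕ} (hf : f ∈ poly) :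
    ∃ P : Polynomial ℕ, ∀ n, f n ≤ P.eval n := by
  obtain ⟨p, hp⟩ := hf
  have : ∀ p : Polynomial ℤ, ∃ P : Polynomial ℕ, ∀ n : ℕ, p.eval (n : ℤ) ≤ P.eval n := by
    intro p
    induction p using Polynomial.induction_on' with
    | add p q hp hq =>
      obtain ⟨P, hP⟩ := hp
      obtain ⟨Q, hQ⟩ := hq
      exact ⟨P + Q, fun n => by simpa using add_le_add (hP n) (hQ n)⟩
    | monomial k a =>
      -- Absolute values of the coefficients turn an integer polynomial into a bound by a natural
      -- one.
      refine ⟨.monomial k a.natAbs, fun n => ?_⟩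
      simp only [Polynomial.eval_monomial, Nat.cast_mul, Nat.cast_pow, Int.natCast_natAbs]
      exact mul_le_mul_of_nonneg_right (le_abs_self a) (by positivity)
  obtain ⟨P, hP⟩ := this p
  exact ⟨P, fun n => by exact_mod_cast (hp n).trans_le (hP n)⟩

theorem eval_mem_poly (P : Polynomial ℕ) : (fun n => P.eval n) ∈ poly :=
  ⟨P.map (Nat.castRingHom ℤ), fun n => by simp⟩

theorem Machine.OutputsIn.mono {ι : Type} [DecidableEq ι] {M : Machine ι} {x : ι → List Bool}
    {y : List Bool} {s t : ℕ} (h : M.OutputsIn x y s) (hst : s ≤ t) : M.OutputsIn x y t := by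
  obtain ⟨c, hc, hc', ⟨⟨e, he⟩⟩⟩ := h
  exact ⟨c, hc, hc', ⟨⟨e, he.trans hst⟩⟩⟩

open Classical in
theorem mem_classP_iff {L : Language Bool} :
    L ∈ classP ↔ ∃ f : List Bool → List Bool, PT f ∧ ∀ w, f w = [decide (w ∈ L)] := by
  constructor
  · rintro ⟨M, t, ht, hM⟩
    obtain ⟨P, hP⟩ := exists_polynomial_of_mem_poly ht
    obtain ⟨f, hf, hf'⟩ := PT.exists_sim M (x := fun (w : List Bool) (_ : Unit) => w)
      (PT.pi fun _ => PT.id) (PT.polyEval P (PT.length PT.id))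
    refine ⟨f, hf, fun w => hf' w _ ?_⟩
    by_cases hw : w ∈ L
    · simpa [hw] using ((hM w).1 hw).mono (hP _)
    · simpa [hw] using ((hM w).2 hw).mono (hP _)
  · rintro ⟨f, hf, hf'⟩
    obtain ⟨M, P, hM⟩ := hf.exists_machine
    refine ⟨M, _, eval_mem_poly P, fun w => ⟨fun hw => ?_, fun hw => ?_⟩⟩
    · simpa [hf', hw] using hM w
    · simpa [hf', hw] using hM w

/-- The language of the words on which a function has the value `[true]`. -/
def langOf (d : List Bool → List Bool) : Language Bool := {w | d w = [true]}

theorem mem_langOf {d : List Bool → List Bool} {w : List Bool} : w ∈ langOf d ↔ d w = [true] :=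
  Iff.rfl

theorem langOf_mem_classP {d : List Bool → List Bool} (hd : PT d) : langOf d ∈ classP := by
  classical
  refine mem_classP_iff.2 ⟨fun w => if d w = [true] then [true] else [false],
    (hd.eqConst _).ite (PT.constList _) (PT.constList _), fun w => ?_⟩
  by_cases h : d w = [true] <;> simp [h, mem_langOf]

theorem PolyTimeComputable.pt {g : ℕ → ℕ} (hg : PolyTimeComputable g) : PT g := by
  obtain ⟨M, t, ht, hM⟩ := hg
  obtain ⟨P, hP⟩ := exists_polynomial_of_mem_poly ht
  obtain ⟨f, hf, hf'⟩ := PT.exists_sim M (x := fun (n : ℕ) (_ : Unit) => unary n)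
    (PT.pi fun _ => PT.id.unary) (PT.polyEval P PT.id)
  refine hf.length.congr fun n => ?_
  rw [hf' n _ ((hM n).mono (hP n))]
  simp [unary]

/-- A computable bound lets the verifier cut any extension of an advice word back to the word
itself. In the other direction, a later advice word is one of the admitted extensions. -/
theorem weakAdviceStarClass_eq {𝓕 : Set (ℕ → ℕ)} (h : ∀ f ∈ 𝓕, PolyTimeComputable f) :
    weakAdviceStarClass classP 𝓕 = adviceStarClass classP 𝓕 := by
  classical
  ext L
  constructor
  · rintro ⟨f, hf, L', hL', α, hα, hL⟩
    obtain ⟨d, hd, hd'⟩ := mem_classP_iff.1 hL'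
    let e : List Bool → List Bool := fun v =>
      d (pairWord (unpairWord v).1 ((unpairWord v).2.take (f (unpairWord v).1.length)))
    have he : PT e := by
      have hu : PT unpairWord := PT.unpairWord PT.id
      exact hd.comp (hu.fst'.pairWord (((h f hf).pt.comp hu.fst'.length).take hu.snd'))
    have key : ∀ n w a, w.length = n → α n <+: a → (pairWord w a ∈ langOf e ↔ w ∈ L) := by
      intro n w a hw ha
      have hta : a.take (f n) = α n := by
        rw [← hα.2 n]; exact (List.prefix_iff_eq_take.1 ha).symm
      rw [(hL n w hw).1, mem_langOf]
      simp only [e]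
      rw [unpairWord_pairWord, hw, hta, hd']
      simp
    refine ⟨f, hf, _, langOf_mem_classP he, α, hα, fun n w hw => ⟨?_, fun k _ a ha _ => ?_⟩⟩
    · exact (key n w _ hw List.prefix_rfl).symm
    · rw [key n w _ hw List.prefix_rfl, key n w a hw ha]
  · rintro ⟨f, hf, L', hL', α, hα, hL⟩
    exact ⟨f, hf, L', hL', α, hα, fun n w hw => ⟨(hL n w hw).1, fun k hk =>
      (hL n w hw).2 k hk (α k) (hα.1 n k hk) List.prefix_rfl⟩⟩

/-! Networks whose cells are indexed by an arbitrary finite type. -/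

theorem linSigmoid_eq (x : ℝ) : linSigmoid x = max 0 (min x 1) := by
  unfold linSigmoid
  split_ifs with h₁ h₂
  · rw [max_eq_left]; exact (min_le_left _ _).trans h₁.le
  · rw [min_eq_left h₂, max_eq_right (not_lt.1 h₁)]
  · rw [min_eq_right (not_le.1 h₂).le, max_eq_right zero_le_one]

theorem linSigmoid_of_mem {x : ℝ} (h₀ : 0 ≤ x) (h₁ : x ≤ 1) : linSigmoid x = x := by
  rw [linSigmoid_eq, min_eq_left h₁, max_eq_right h₀]

theorem linSigmoid_of_nonpos {x : ℝ} (h : x ≤ 0) : linSigmoid x = 0 := by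
  rw [linSigmoid_eq, max_eq_left]; exact (min_le_left _ _).trans h

theorem linSigmoid_of_one_le {x : ℝ} (h : 1 ≤ x) : linSigmoid x = 1 := by
  rw [linSigmoid_eq, min_eq_right h, max_eq_right zero_le_one]

theorem linSigmoid_mem (x : ℝ) : linSigmoid x ∈ Set.Icc (0 : ℝ) 1 := by
  rw [linSigmoid_eq]
  exact ⟨le_max_left _ _, max_le zero_le_one (min_le_right _ _)⟩

/-- A network with static rational weights except for the bias of the cell `c`. -/
structure Net (I : Type) where
  /-- the cell with the special bias -/
  c : I
  inp : I → Fin 2 → ℚ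
  bias : I → ℚ
  res : I → I → ℚ
  out : Fin 2 → I → ℚ
  ini : I → ℚ
  ini_mem : ∀ i, (ini i : ℝ) ∈ Set.Icc (0 : ℝ) 1

namespace Net

variable {I : Type} [Fintype I] [DecidableEq I] (N : Net I) (β : ℕ → ℝ) (w : List Bool)

/-- The state when the special bias is `β`. -/
noncomputable def state : ℕ → I → ℝ
  | 0 => fun i => N.ini i
  | t + 1 => fun i => linSigmoid (N.inp i 0 * RNN.input w t 0 + N.inp i 1 * RNN.input w t 1 +
      (if i = N.c then β t else N.bias i) + ∑ j, N.res i j * state t j)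

/-- The cells are numbered so that the one with the special bias gets the number `0`. -/
theorem exists_RNN : ∃ M : RNN, M.RationalExceptBias ∧ (∀ t, M.Win t 0 2 = β t) ∧
    ∀ w t j, M.output w t j = hardThreshold (∑ i, N.out j i * N.state β w (t + 1) i) := by
  obtain ⟨K, hK⟩ : ∃ K, Fintype.card I = K + 1 :=
    have : Nonempty I := ⟨N.c⟩
    Nat.exists_eq_succ_of_ne_zero Fintype.card_ne_zero
  obtain ⟨e, he⟩ : ∃ e : I ≃ Fin (K + 1), e N.c = 0 :=
    ⟨(Fintype.equivFinOfCardEq hK).trans (Equiv.swap (Fintype.equivFinOfCardEq hK N.c) 0), by simp⟩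
  have hc : ∀ i, e.symm i = N.c ↔ i = 0 := fun i => by rw [Equiv.symm_apply_eq, he]
  let M : RNN :=
    { K := K
      Win := fun t i => ![N.inp (e.symm i) 0, N.inp (e.symm i) 1,
        if i = 0 then β t else N.bias (e.symm i)]
      Wres := fun _ i j => N.res (e.symm i) (e.symm j)
      Wout := fun _ j i => N.out j (e.symm i)
      h₀ := fun i => N.ini (e.symm i)
      h₀_mem := fun i => N.ini_mem _ }
  have hM : ∀ w t i, M.state w t i = N.state β w t (e.symm i) := by
    intro w t
    induction t with
    | zero => exact fun i => rfl
    | succ t ih =>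
      intro i
      simp only [RNN.state, Net.state, Matrix.mulVec, dotProduct, hc]
      congr 1
      rw [Fin.sum_univ_three, ← e.symm.sum_comp]
      simp [M, ih]
  refine ⟨M, ⟨fun i j hij => ?_, fun i j => ⟨_, fun t => rfl⟩, fun i j => ⟨_, fun t => rfl⟩,
    fun i => ⟨_, rfl⟩⟩, fun t => by simp [M], fun w t j => ?_⟩
  · fin_cases j
    · exact ⟨_, fun t => rfl⟩
    · exact ⟨_, fun t => rfl⟩
    · exact ⟨N.bias (e.symm i), fun t => by
        have : i ≠ 0 := fun h => hij ⟨h, rfl⟩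
        simp [M, this]⟩
  · simp only [RNN.output, Matrix.mulVec, dotProduct, hM]
    rw [← e.symm.sum_comp]

end Net

theorem RNN.input_mem (w : List Bool) (t : ℕ) (j : Fin 2) :
    RNN.input w t j ∈ Set.Icc (0 : ℝ) 1 := by
  unfold RNN.input
  fin_cases j <;> split_ifs <;> simp

/-! ### Reading the base-4 digits of a real bias -/

theorem summable_delta4 (s : ℕ → Bool) :
    Summable fun i : ℕ => (2 * (if s i then 1 else 0) + 1 : ℝ) / 4 ^ (i + 1) := by
  refine Summable.of_nonneg_of_le (fun i => by positivity) (fun i => ?_)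
    ((summable_geometric_of_lt_one (r := (1 / 4 : ℝ)) (by norm_num) (by norm_num)).mul_left 3)
  rw [one_div, inv_pow, ← div_eq_mul_inv, pow_succ]
  have : (2 * (if s i then 1 else 0) + 1 : ℝ) ≤ 3 := by split_ifs <;> norm_num
  rw [div_le_div_iff₀ (by positivity) (by positivity)]
  nlinarith [pow_pos (show (0 : ℝ) < 4 by norm_num) i]

theorem delta4_eq (s : ℕ → Bool) :
    delta4 s = ((2 * (if s 0 then 1 else 0) + 1) + delta4 fun i => s (i + 1)) / 4 := by
  unfold delta4
  rw [(summable_delta4 s).tsum_eq_zero_add, add_div (_ + _), ← tsum_div_const]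
  congr 1
  · simp
  · refine tsum_congr fun i => ?_
    rw [pow_succ _ (i + 1), div_div]

/-- The extreme cases have all digits equal to 1 or all equal to 3. Both bounds are needed for the
digit-reading cells to saturate exactly. -/
theorem delta4_mem (s : ℕ → Bool) : delta4 s ∈ Set.Icc (1 / 3 : ℝ) 1 := by
  have h := hasSum_geometric_of_lt_one (r := (1 / 4 : ℝ)) (by norm_num) (by norm_num)
  constructor
  · have h₁ := h.mul_left (1 / 4)
    have e : (1 / 4 * (1 - 1 / 4)⁻¹ : ℝ) = 1 / 3 := by norm_num
    rw [e] at h₁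
    refine hasSum_le (fun i => ?_) h₁ (summable_delta4 s).hasSum
    rw [pow_succ, one_div_pow, div_mul_div_comm, one_mul, mul_comm (4 : ℝ)]
    have : (1 : ℝ) ≤ 2 * (if s i then 1 else 0) + 1 := by split_ifs <;> norm_num
    gcongr
  · have h₁ := h.mul_left (3 / 4)
    have e : (3 / 4 * (1 - 1 / 4)⁻¹ : ℝ) = 1 := by norm_num
    rw [e] at h₁
    refine hasSum_le (fun i => ?_) (summable_delta4 s).hasSum h₁
    rw [pow_succ, one_div_pow, div_mul_div_comm, mul_one, mul_comm (4 : ℝ)]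
    have : (2 * (if s i then 1 else 0) + 1 : ℝ) ≤ 3 := by split_ifs <;> norm_num
    gcongr

/-- The cells that read the digits of a real number and delay the input. -/
inductive Gad
  | c | k | k' | q | y | z | b | u₀ | u₁ | v₀ | v₁
  deriving DecidableEq

instance : Fintype Gad :=
  ⟨{.c, .k, .k', .q, .y, .z, .b, .u₀, .u₁, .v₀, .v₁}, fun x => by cases x <;> decide⟩

theorem Gad.sum (f : Gad → ℝ) :
    ∑ g, f g = f c + f k + f k' + f q + f y + f z + f b + f u₀ + f u₁ + f v₀ + f v₁ := by
  rw [show (Finset.univ : Finset Gad) = {c, k, k', q, y, z, b, u₀, u₁, v₀, v₁} from rfl]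
  simp [Finset.sum_insert]
  ring

/-- The network that simulates a network with the bias bits `e` by reading the digits of its own
bias. -/
def gadgetNet {m : ℕ} (win : Fin (m + 1) → Fin 3 → ℚ) (wres : Fin (m + 1) → Fin (m + 1) → ℚ)
    (wout : Fin 2 → Fin (m + 1) → ℚ) (h : Fin (m + 1) → ℚ) (C : ℚ)
    (hh : ∀ i, (h i : ℝ) ∈ Set.Icc (0 : ℝ) 1) : Net (Fin (m + 1) ⊕ Gad) where
  c := .inr .c
  inp
    | .inr .u₀ => ![1, 0]
    | .inr .u₁ => ![0, 1]
    | _ => 0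
  bias
    | .inr .k => 1
    | .inr .q => 1
    | .inr .y => -1
    | .inr .z => -3
    | .inr .b => -3 / 2
    | _ => 0
  res
    | .inl i => fun
      | .inl j => wres i j
      | .inr .v₀ => win i 0
      | .inr .v₁ => win i 1
      -- Cell `k` is on from time 1 and `k'` from time 2. At time 2 the simulated cells thus receive
      -- their initial values; from then on the two contributions of `h i` cancel and the ordinary
      -- bias remains.
      | .inr .k' => (if i = 0 then 0 else win i 2) - h i
      | .inr .k => h i
      | .inr .b => if i = 0 then 1 else 0
      | _ => 0
    | .inr .c => fun
      | .inr .k => -1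
      | _ => 0
    | .inr .k' => fun
      | .inr .k => 1
      | _ => 0
    | .inr .q => fun
      | .inr .k' => -1
      | _ => 0
    | .inr .y => fun
      | .inr .y => 4
      | .inr .z => 4
      | .inr .b => -4
      | .inr .c => 4
      | _ => 0
    | .inr .z => fun
      | .inr .y => 4
      | .inr .z => 4
      | .inr .b => -4
      | .inr .c => 4
      | _ => 0
    | .inr .b => fun
      | .inr .y => 3
      | .inr .z => 3
      | .inr .b => -3
      | .inr .c => 3
      | _ => 0
    | .inr .v₀ => fun
      | .inr .u₀ => 1
      | _ => 0
    | .inr .v₁ => fun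
      | .inr .u₁ => 1
      | _ => 0
    | _ => fun _ => 0
  out j
    | .inl i => wout j i
    -- Cell `q` is on up to time 2, which mutes the outputs before the simulation has made its first
    -- step.
    | .inr .q => -C
    | _ => 0
  ini
    | .inr .q => 1
    | _ => 0
  ini_mem i := by
    rcases i with i | i
    · simp
    · cases i <;> simp

section Gadget

variable {m : ℕ} {win : Fin (m + 1) → Fin 3 → ℚ} {wres : Fin (m + 1) → Fin (m + 1) → ℚ}
  {wout : Fin 2 → Fin (m + 1) → ℚ} {h : Fin (m + 1) → ℚ} {C : ℚ}
  {hh : ∀ i, (h i : ℝ) ∈ Set.Icc (0 : ℝ) 1} (e : ℕ → Bool) (w : List Bool)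

local notation "S" => Net.state (gadgetNet win wres wout h C hh) (fun _ => delta4 e) w

theorem gadget_step (t : ℕ) :
    S (t + 1) (.inr .c) = linSigmoid (delta4 e - S t (.inr .k)) ∧
    S (t + 1) (.inr .k) = linSigmoid 1 ∧
    S (t + 1) (.inr .k') = linSigmoid (S t (.inr .k)) ∧
    S (t + 1) (.inr .q) = linSigmoid (1 - S t (.inr .k')) ∧
    S (t + 1) (.inr .y) = linSigmoid (4 * (S t (.inr .y) + S t (.inr .z) - S t (.inr .b) +
      S t (.inr .c)) - 1) ∧
    S (t + 1) (.inr .z) = linSigmoid (4 * (S t (.inr .y) + S t (.inr .z) - S t (.inr .b) +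
      S t (.inr .c)) - 3) ∧
    S (t + 1) (.inr .b) = linSigmoid (3 * (S t (.inr .y) + S t (.inr .z) - S t (.inr .b) +
      S t (.inr .c)) - 3 / 2) ∧
    S (t + 1) (.inr .u₀) = linSigmoid (RNN.input w t 0) ∧
    S (t + 1) (.inr .u₁) = linSigmoid (RNN.input w t 1) ∧
    S (t + 1) (.inr .v₀) = linSigmoid (S t (.inr .u₀)) ∧
    S (t + 1) (.inr .v₁) = linSigmoid (S t (.inr .u₁)) ∧
    ∀ i, S (t + 1) (.inl i) = linSigmoid (win i 0 * S t (.inr .v₀) + win i 1 * S t (.inr .v₁) +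
      ((if i = 0 then 0 else win i 2) - h i) * S t (.inr .k') + h i * S t (.inr .k) +
      (if i = 0 then S t (.inr .b) else 0) + ∑ j, wres i j * S t (.inl j)) := by
  refine ⟨?_, ?_, ?_, ?_, ?_, ?_, ?_, ?_, ?_, ?_, ?_, fun i => ?_⟩
  all_goals
    rw [Net.state]
    generalize Net.state (gadgetNet win wres wout h C hh) (fun _ => delta4 e) w t = s
    refine congrArg linSigmoid ?_
  on_goal 12 => by_cases hi : i = 0
  all_goals simp [gadgetNet, Gad.sum, *]
  all_goals ring

theorem gadget_zero : (∀ i, S 0 (.inl i) = 0) ∧ ∀ g, S 0 (.inr g) = if g = .q then 1 else 0 := by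
  refine ⟨fun i => by simp [Net.state, gadgetNet], fun g => ?_⟩
  cases g <;> simp [Net.state, gadgetNet]

theorem gadget_one : (∀ i, S 1 (.inl i) = 0) ∧ S 1 (.inr .c) = delta4 e ∧ S 1 (.inr .k) = 1 ∧
    S 1 (.inr .k') = 0 ∧ S 1 (.inr .q) = 1 ∧ S 1 (.inr .y) = 0 ∧ S 1 (.inr .z) = 0 ∧
    S 1 (.inr .b) = 0 ∧ S 1 (.inr .u₀) = RNN.input w 0 0 ∧ S 1 (.inr .u₁) = RNN.input w 0 1 ∧
    S 1 (.inr .v₀) = 0 ∧ S 1 (.inr .v₁) = 0 := by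
  obtain ⟨h₁, h₂, h₃, h₄, h₅, h₆, h₇, h₈, h₉, h₁₀, h₁₁, h₁₂⟩ :=
    gadget_step (win := win) (wres := wres) (wout := wout) (h := h) (C := C) (hh := hh) e w 0
  obtain ⟨z₁, z₂⟩ := gadget_zero (win := win) (wres := wres) (wout := wout) (h := h) (C := C)
    (hh := hh) e w
  have hd := delta4_mem e
  have hl : linSigmoid 0 = 0 := linSigmoid_of_nonpos le_rfl
  have hl' : linSigmoid 1 = 1 := linSigmoid_of_one_le le_rfl
  simp only [zero_add, z₁, z₂] at h₁ h₂ h₃ h₄ h₅ h₆ h₇ h₈ h₉ h₁₀ h₁₁ h₁₂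
  refine ⟨fun i => ?_, ?_, ?_, ?_, ?_, ?_, ?_, ?_, ?_, ?_, ?_, ?_⟩
  · rw [h₁₂]; simp [hl]
  · rw [h₁]; simp [linSigmoid_of_mem (show 0 ≤ delta4 e by linarith [hd.1]) hd.2]
  · rw [h₂, hl']
  · rw [h₃]; simp [hl]
  · rw [h₄]; simp [hl']
  · rw [h₅]; simp; exact linSigmoid_of_nonpos (by norm_num)
  · rw [h₆]; simp; exact linSigmoid_of_nonpos (by norm_num)
  · rw [h₇]; simp; exact linSigmoid_of_nonpos (by norm_num)
  · rw [h₈]; exact linSigmoid_of_mem (RNN.input_mem w 0 0).1 (RNN.input_mem w 0 0).2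
  · rw [h₉]; exact linSigmoid_of_mem (RNN.input_mem w 0 1).1 (RNN.input_mem w 0 1).2
  · rw [h₁₀]; simp [hl]
  · rw [h₁₁]; simp [hl]

/-- The digit that is read at time `t`. -/
theorem gadget_digit {x y z b c : ℝ} {s : ℕ → Bool} (hx : x = delta4 s)
    (hy : y = linSigmoid (4 * x - 1)) (hz : z = linSigmoid (4 * x - 3))
    (hb : b = linSigmoid (3 * x - 3 / 2)) (hc : c = 0) :
    b = (if s 0 then 1 else 0) ∧ y + z - b + c = delta4 fun i => s (i + 1) := by
  have h₁ := delta4_eq s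
  have h₂ := delta4_mem fun i => s (i + 1)
  rw [← hx] at h₁
  generalize delta4 (fun i => s (i + 1)) = x' at *
  obtain ⟨h₂, h₂'⟩ := h₂
  cases hs : s 0 with
  | true =>
    simp only [hs, if_true] at h₁
    -- For `b` the argument is `(3 + 3 x') / 4`, which reaches 1 precisely because the remainder
    -- `x'` is at least `1 / 3`.
    rw [linSigmoid_of_one_le (by linarith)] at hy hb
    rw [linSigmoid_of_mem (by linarith) (by linarith)] at hz
    simp only [if_true]
    exact ⟨hb, by linarith⟩
  | false =>
    simp only [hs, Bool.false_eq_true, if_false] at h₁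
    rw [linSigmoid_of_mem (by linarith) (by linarith)] at hy
    rw [linSigmoid_of_nonpos (by linarith)] at hz hb
    simp only [Bool.false_eq_true, if_false]
    exact ⟨hb, by linarith⟩

/-- The simulated run lags by two steps: the real is loaded in one and its first digit isolated in
the next. The input is delayed by the same amount, and the remainder, kept as a combination of four
cells, is the encoding of the shifted word. -/
theorem gadget_inv (g : ℕ → Fin (m + 1) → ℝ) (hg₀ : ∀ i, g 0 i = h i)
    (hg : ∀ t i, g (t + 1) i = linSigmoid (win i 0 * RNN.input w t 0 + win i 1 * RNN.input w t 1 +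
      (if i = 0 then (if e t then 1 else 0) else win i 2 : ℝ) + ∑ j, wres i j * g t j)) (t : ℕ) :
    (∀ i, S (t + 2) (.inl i) = g t i) ∧ S (t + 2) (.inr .c) = 0 ∧ S (t + 2) (.inr .k) = 1 ∧
    S (t + 2) (.inr .k') = 1 ∧ S (t + 2) (.inr .q) = (if t = 0 then 1 else 0) ∧
    S (t + 2) (.inr .y) + S (t + 2) (.inr .z) - S (t + 2) (.inr .b) + S (t + 2) (.inr .c) =
      delta4 (fun i => e (i + (t + 1))) ∧
    S (t + 2) (.inr .b) = (if e t then 1 else 0) ∧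
    S (t + 2) (.inr .u₀) = RNN.input w (t + 1) 0 ∧ S (t + 2) (.inr .u₁) = RNN.input w (t + 1) 1 ∧
    S (t + 2) (.inr .v₀) = RNN.input w t 0 ∧ S (t + 2) (.inr .v₁) = RNN.input w t 1 := by
  have hl : linSigmoid 0 = 0 := linSigmoid_of_nonpos le_rfl
  have hl' : linSigmoid 1 = 1 := linSigmoid_of_one_le le_rfl
  have hi : ∀ t j, linSigmoid (RNN.input w t j) = RNN.input w t j := fun t j =>
    linSigmoid_of_mem (RNN.input_mem w t j).1 (RNN.input_mem w t j).2
  induction t with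
  | zero =>
    obtain ⟨h₁, h₂, h₃, h₄, h₅, h₆, h₇, h₈, h₉, h₁₀, h₁₁, h₁₂⟩ :=
      gadget_step (win := win) (wres := wres) (wout := wout) (h := h) (C := C) (hh := hh) e w 1
    obtain ⟨z₁, z₂, z₃, z₄, z₅, z₆, z₇, z₈, z₉, z₁₀, z₁₁, z₁₂⟩ :=
      gadget_one (win := win) (wres := wres) (wout := wout) (h := h) (C := C) (hh := hh) e w
    simp only [z₁, z₂, z₃, z₄, z₆, z₇, z₈, z₉, z₁₀, z₁₁, z₁₂, Nat.reduceAdd, hi, hl',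
      add_zero, zero_add, sub_zero, sub_self]
      at h₁ h₂ h₃ h₄ h₅ h₆ h₇ h₈ h₉ h₁₀ h₁₁ h₁₂
    have hc : S 2 (.inr .c) = 0 := by
      rw [h₁]; exact linSigmoid_of_nonpos (by linarith [(delta4_mem e).2])
    obtain ⟨d₁, d₂⟩ := gadget_digit (x := delta4 e) (s := e) rfl h₅ h₆ h₇ hc
    refine ⟨fun i => ?_, hc, h₂, h₃, by simpa using h₄, d₂, d₁, h₈, h₉, h₁₀, h₁₁⟩
    rw [zero_add, h₁₂, hg₀]
    simp [linSigmoid_of_mem (hh i).1 (hh i).2]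
  | succ t ih =>
    obtain ⟨h₁, h₂, h₃, h₄, h₅, h₆, h₇, h₈, h₉, h₁₀, h₁₁, h₁₂⟩ :=
      gadget_step (win := win) (wres := wres) (wout := wout) (h := h) (C := C) (hh := hh) e w
        (t + 2)
    obtain ⟨z₁, z₂, z₃, z₄, z₅, z₆, z₇, z₈, z₉, z₁₀, z₁₁⟩ := ih
    rw [z₆] at h₅ h₆ h₇
    simp only [z₁, z₃, z₄, z₇, z₈, z₉, z₁₀, z₁₁, hi, hl, hl', sub_self]
      at h₁ h₂ h₃ h₄ h₅ h₆ h₇ h₈ h₉ h₁₀ h₁₁ h₁₂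
    have hc : S (t + 2 + 1) (.inr .c) = 0 := by
      rw [h₁]; exact linSigmoid_of_nonpos (by linarith [(delta4_mem e).2])
    obtain ⟨d₁, d₂⟩ := gadget_digit rfl h₅ h₆ h₇ hc
    refine ⟨fun i => ?_, hc, h₂, h₃, by simpa using h₄, ?_, ?_, h₈, h₉, h₁₀, h₁₁⟩
    · refine (h₁₂ i).trans ?_
      rw [hg]
      congr 2
      split_ifs <;> ring
    · refine d₂.trans ?_
      congr 1
      ext i
      congr 1
      ring
    · refine d₁.trans ?_
      simp

end Gadget

theorem hardThreshold_of_neg {x : ℝ} (h : x < 0) : hardThreshold x = some false := if_pos h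

theorem classENN_subset_classANN (E : Set (ℕ → Bool)) :
    classENN E poly ⊆ classANN (delta4 '' E) poly := by
  rintro L ⟨e, he, f, hf, N, ⟨⟨hin, hres, hout, hini⟩, hbias⟩, hN⟩
  obtain ⟨P, hP⟩ := exists_polynomial_of_mem_poly hf
  have hin' : ∀ i j, ∃ q : ℚ, ¬(i = 0 ∧ j = 2) → ∀ t, N.Win t i j = q := by
    intro i j
    by_cases hij : i = 0 ∧ j = 2
    · exact ⟨0, fun h => absurd hij h⟩
    · exact (hin i j hij).imp fun q hq _ => hq
  choose win hwin using hin'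
  choose wres hwres using hres
  choose wout hwout using hout
  choose h hh using hini
  -- Larger than any output sum of activations in `[0, 1]`, so the muting cell makes the early
  -- outputs negative.
  let C : ℚ := 1 + ∑ j, ∑ i, |wout j i|
  have hmem : ∀ i, (h i : ℝ) ∈ Set.Icc (0 : ℝ) 1 := fun i => hh i ▸ N.h₀_mem i
  have hC : ∀ j (x : Fin (N.K + 1) → ℝ), (∀ i, x i ∈ Set.Icc (0 : ℝ) 1) →
      ∑ i, (wout j i : ℝ) * x i < C := by
    intro j x hx
    have h₁ : ∑ i, (wout j i : ℝ) * x i ≤ ∑ i, |(wout j i : ℝ)| := by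
      refine Finset.sum_le_sum fun i _ =>
        (mul_le_mul_of_nonneg_right (le_abs_self _) (hx i).1).trans (mul_le_of_le_one_right (abs_nonneg _) (hx i).2)
    have h₂ : ∑ i, |(wout j i : ℝ)| ≤ ∑ j, ∑ i, |(wout j i : ℝ)| :=
      Finset.single_le_sum (f := fun j => ∑ i, |(wout j i : ℝ)|)
        (fun j _ => Finset.sum_nonneg fun i _ => abs_nonneg _) (Finset.mem_univ j)
    have h₃ : (C : ℝ) = 1 + ∑ j, ∑ i, |(wout j i : ℝ)| := by simp [C]
    linarith
  obtain ⟨M, hM₁, hM₂, hM₃⟩ :=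
    (gadgetNet win wres wout h C hmem).exists_RNN fun _ => delta4 e
  have hinv := fun w => gadget_inv (win := win) (wres := wres) (wout := wout) (C := C) (hh := hmem)
    e w (N.state w) (fun i => hh i) (fun t i => by
      rw [RNN.state]
      simp only [Matrix.mulVec, dotProduct, Fin.sum_univ_three, hwres]
      rw [hwin i 0 (by simp), hwin i 1 (by simp)]
      by_cases hi : i = 0
      · subst hi
        rw [hbias]
        simp
      · rw [hwin i 2 (by simp [hi])]
        simp [hi])
  have hstate : ∀ w t i, N.state w t i ∈ Set.Icc (0 : ℝ) 1 := by
    intro w t i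
    cases t with
    | zero => exact N.h₀_mem i
    | succ t => exact linSigmoid_mem _
  have hsum : ∀ w t j, ∑ i, ((gadgetNet win wres wout h C hmem).out j i : ℝ) *
      (gadgetNet win wres wout h C hmem).state (fun _ => delta4 e) w t i =
      ∑ i, wout j i * (gadgetNet win wres wout h C hmem).state (fun _ => delta4 e) w t (.inl i) -
      C * (gadgetNet win wres wout h C hmem).state (fun _ => delta4 e) w t (.inr .q) := by
    intro w t j
    rw [Fintype.sum_sum_type, Gad.sum]
    simp [gadgetNet, sub_eq_add_neg]
  have h₀ : ∀ w j, M.output w 0 j = some false := by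
    intro w j
    rw [hM₃, hsum]
    obtain ⟨z₁, -, -, -, z₅, -⟩ := gadget_one (win := win) (wres := wres) (wout := wout) (h := h)
      (C := C) (hh := hmem) e w
    simp only [zero_add, z₁, z₅]
    have := hC j (fun _ => 0) (by simp)
    exact hardThreshold_of_neg (by linarith)
  have h₁ : ∀ w j, M.output w 1 j = some false := by
    intro w j
    rw [hM₃, hsum]
    obtain ⟨z₁, -, -, -, z₅, -⟩ := hinv w 0
    simp only [zero_add] at z₁ z₅
    simp only [Nat.reduceAdd, z₁, z₅, if_true]
    have := hC j _ (hstate w 0)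
    exact hardThreshold_of_neg (by linarith)
  have h₂ : ∀ w t, M.output w (t + 2) = N.output w t := by
    intro w t
    ext1 j
    rw [hM₃, hsum, RNN.output]
    obtain ⟨z₁, -, -, -, z₅, -⟩ := hinv w (t + 1)
    simp only [show t + 2 + 1 = t + 1 + 2 from rfl, z₁, z₅, Matrix.mulVec, dotProduct, hwout]
    simp
  have hans : ∀ w b τ, N.Answers w b τ → M.Answers w b (τ + 2) := by
    rintro w b τ ⟨hτ, ht⟩
    refine ⟨by omega, fun t => ?_⟩
    match t with
    | 0 =>
      rw [if_neg (by omega)]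
      ext1 j
      rw [h₀]
      fin_cases j <;> rfl
    | 1 =>
      rw [if_neg (by omega)]
      ext1 j
      rw [h₁]
      fin_cases j <;> rfl
    | t + 2 =>
      rw [h₂, ht]
      simp only [show t + 2 + 1 = τ + 2 ↔ t + 1 = τ by omega]
  refine ⟨_, ⟨e, he, rfl⟩, _, eval_mem_poly (P + 2), M, ⟨hM₁, hM₂⟩, fun w => ?_⟩
  have hb : ∀ τ ≤ f w.length, τ + 2 ≤ (P + 2).eval w.length := fun τ h => by
    have := hP w.length
    simp
    omega
  refine ⟨fun hw => ?_, fun hw => ?_⟩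
  · obtain ⟨τ, hτ, ha⟩ := (hN w).1 hw
    exact ⟨_, hb τ hτ, hans _ _ _ ha⟩
  · obtain ⟨τ, hτ, ha⟩ := (hN w).2 hw
    exact ⟨_, hb τ hτ, hans _ _ _ ha⟩

/-! Bit stack machines as networks. -/

theorem RNN.input_one (w : List Bool) (t : ℕ) :
    RNN.input w t 1 = if t < w.length then 1 else 0 := by
  unfold RNN.input
  split_ifs <;> simp

/-- The base-4 encoding of finite words. -/
noncomputable def enc4 : List Bool → ℝ
  | [] => 0
  | b :: l => (2 * (if b then 1 else 0) + 1 + enc4 l) / 4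

theorem enc4_mem (l : List Bool) : enc4 l ∈ Set.Icc (0 : ℝ) 1 := by
  induction l with
  | nil => simp [enc4]
  | cons b l ih =>
    obtain ⟨h₀, h₁⟩ := ih
    cases b <;> simp only [enc4, Bool.false_eq_true, if_true, if_false] <;>
      constructor <;> linarith

/-- Linear forms with rational coefficients. -/
def RatLin {I : Type} [Fintype I] (F : (I → ℝ) → ℝ) : Prop :=
  ∃ q : I → ℚ, ∀ s, F s = ∑ i, q i * s i

namespace RatLin

variable {I : Type} [Fintype I] {F G : (I → ℝ) → ℝ}

theorem proj (i : I) : RatLin (fun s => s i) := by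
  classical
  exact ⟨fun j => if j = i then 1 else 0, fun s => by simp [apply_ite (Rat.cast : ℚ → ℝ)]⟩

theorem zero : RatLin (fun _ : I → ℝ => 0) := ⟨0, fun s => by simp⟩

theorem add (hF : RatLin F) (hG : RatLin G) : RatLin (fun s => F s + G s) := by
  obtain ⟨q, hq⟩ := hF
  obtain ⟨r, hr⟩ := hG
  exact ⟨q + r, fun s => by simp [hq, hr, add_mul, Finset.sum_add_distrib]⟩

theorem mul (hF : RatLin F) (a : ℚ) {b : ℝ} (h : (a : ℝ) = b := by norm_num) :
    RatLin (fun s => b * F s) := by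
  obtain ⟨q, hq⟩ := hF
  exact ⟨fun i => a * q i, fun s => by simp [hq, ← h, Finset.mul_sum, mul_assoc]⟩

theorem sub (hF : RatLin F) (hG : RatLin G) : RatLin (fun s => F s - G s) := by
  simpa [sub_eq_add_neg] using hF.add (hG.mul (-1) (b := -1))

theorem sum {κ : Type} (S : Finset κ) {F : κ → (I → ℝ) → ℝ} (h : ∀ k, RatLin (F k)) :
    RatLin (fun s => ∑ k ∈ S, F k s) := by
  classical
  induction S using Finset.induction_on with
  | empty => simpa using zero
  | insert k S hk ih => simpa [Finset.sum_insert hk] using (h k).add ih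

theorem ite (p : Prop) [Decidable p] (hF : RatLin F) (hG : RatLin G) :
    RatLin (fun s => if p then F s else G s) := by
  split_ifs <;> assumption

end RatLin

/-- How a stack is initialized: with the reverse of one of the two input words, letter by letter
transformed, or with a constant. -/
inductive Src
  | chan (i : Bool) (g : Bool → Bool)
  | const (l : Bool)

/-- The cells of the network that simulates a bit stack machine. -/
inductive Cell (J : Type)
  | one | e | u | v | r | r'
  | A (j : J) | B (j : J) | I (j : J)
  | n (j : J) | b (j : J) | c₁ (j : J)
  | b₂ (j : J) | c₂ (j : J) | o (τ : J → Option Bool)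
  | K (j : J) | P (j : J) | Q (a : Bool) (j : J)

namespace Cell

instance {J : Type} [Finite J] : Finite (Cell J) := by
  have f : Function.Surjective (fun x : (Fin 18 × Bool) × (Option J × (J → Option Bool)) =>
      match x with
      | ((0, _), _) => Cell.one
      | ((1, _), _) => .e
      | ((2, _), _) => .u
      | ((3, _), _) => .v
      | ((4, _), _) => .r
      | ((5, _), _) => .r'
      | ((6, _), some j, _) => .A j
      | ((7, _), some j, _) => .B j
      | ((8, _), some j, _) => .I j
      | ((9, _), some j, _) => .n j
      | ((10, _), some j, _) => .b j
      | ((11, _), some j, _) => .c₁ j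
      | ((12, _), some j, _) => .b₂ j
      | ((13, _), some j, _) => .c₂ j
      | ((14, _), _, τ) => .o τ
      | ((15, _), some j, _) => .K j
      | ((16, _), some j, _) => .P j
      | ((17, a), some j, _) => .Q a j
      | _ => .one) := by
    have τ₀ : J → Option Bool := fun _ => none
    intro x
    cases x with
    | one => exact ⟨((0, true), none, τ₀), rfl⟩
    | e => exact ⟨((1, true), none, τ₀), rfl⟩
    | u => exact ⟨((2, true), none, τ₀), rfl⟩
    | v => exact ⟨((3, true), none, τ₀), rfl⟩
    | r => exact ⟨((4, true), none, τ₀), rfl⟩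
    | r' => exact ⟨((5, true), none, τ₀), rfl⟩
    | A j => exact ⟨((6, true), some j, τ₀), rfl⟩
    | B j => exact ⟨((7, true), some j, τ₀), rfl⟩
    | I j => exact ⟨((8, true), some j, τ₀), rfl⟩
    | n j => exact ⟨((9, true), some j, τ₀), rfl⟩
    | b j => exact ⟨((10, true), some j, τ₀), rfl⟩
    | c₁ j => exact ⟨((11, true), some j, τ₀), rfl⟩
    | b₂ j => exact ⟨((12, true), some j, τ₀), rfl⟩
    | c₂ j => exact ⟨((13, true), some j, τ₀), rfl⟩
    | o τ => exact ⟨((14, true), none, τ), rfl⟩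
    | K j => exact ⟨((15, true), some j, τ₀), rfl⟩
    | P j => exact ⟨((16, true), some j, τ₀), rfl⟩
    | Q a j => exact ⟨((17, a), some j, τ₀), rfl⟩
  exact Finite.of_surjective _ f

open Classical in
section

variable {J : Type} [Fintype J] (δ : Bsm J) (src : J → Src) (s : Cell J → ℝ)

/-- The number of a bit. -/
def num (b : Bool) : ℝ := if b then 1 else 0

/-- Cell `A` holds the stack while letters arrive, cell `B` once the input has ended. The constant
`3 / 4` encodes the one-letter word `true`. -/
noncomputable def load (j : J) : ℝ :=
  match src j with
  | .chan _ _ => s (A j) + s (B j)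
  | .const l => 3 / 4 * num l * s one

/-- Any map on bits is affine in the bit, so the transformed letter is a linear form. -/
noncomputable def bit (j : J) : ℝ :=
  match src j with
  | .chan i g => num (g false) * s one + (num (g true) - num (g false)) * (if i then s u else s e)
  | .const _ => 0

/-- In an actual run the cells of the actions not taken are zero, and the injected initial stack `I`
meets empty stacks; the sum is the encoded stack. -/
noncomputable def content (j : J) : ℝ := s (K j) + s (P j) + s (Q false j) + s (Q true j) + s (I j)

noncomputable def sel (a : Act) (j : J) : ℝ := ∑ τ, if δ τ j = a then s (o τ) else 0

noncomputable def lit (j : J) : Option Bool → ℝ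
  | none => s one - s (n j)
  | some true => s (b j)
  | some false => s (n j) - s (b j)

/-- Gating is by subtraction: with a closed gate, enough is subtracted that the activation is cut to
0. The stacks circulate with period three: contents; emptiness, top bits and a copy; recognized tops
and a second copy; contents again, through one cell per possible action. -/
noncomputable def fwd : Cell J → ℝ
  | one => s one
  | e => 0
  | u => 0
  | v => 0
  | r => 0
  | r' => s r
  | A j => 1 / 4 * (s (A j) + s (B j) + 2 * bit src s j + s one) - (s one - s v)
  | B j => s (A j) + s (B j) - s v
  | I j => load src s j - (s one - (s r' - s r))
  | n j => 4 * content s j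
  | b j => 4 * content s j - 2 * s one
  | c₁ j => content s j
  | b₂ j => s (b j)
  | c₂ j => s (c₁ j)
  | o τ => ∑ j, (lit s j (τ j) - s one) + s one
  | K j => s (c₂ j) - (s one - sel δ s .keep j)
  | P j => 4 * s (c₂ j) - 2 * s (b₂ j) - s one - 4 * (s one - sel δ s .pop j)
  | Q a j => 1 / 4 * (s (c₂ j) + (2 * num a + 1) * s one) - (s one - sel δ s (.push a) j)

open RatLin in
theorem ratLin_fwd [Fintype (Cell J)] (i : Cell J) : RatLin fun s => fwd δ src s i := by
  have hnum : ∀ b, ∃ q : ℚ, (q : ℝ) = num b := fun b =>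
    ⟨if b then 1 else 0, by unfold num; split_ifs <;> simp⟩
  choose q hq using hnum
  have hload : ∀ j, RatLin fun s => load src s j := by
    intro j
    unfold load
    cases src j with
    | chan i g => exact (proj _).add (proj _)
    | const l => exact (proj _).mul (3 / 4 * q l) (by simp [hq])
  have hbit : ∀ j, RatLin fun s => bit src s j := by
    intro j
    unfold bit
    cases src j with
    | chan i g =>
      exact ((proj _).mul (q (g false)) (hq _)).add
        ((RatLin.ite _ (proj _) (proj _)).mul (q (g true) - q (g false)) (by simp [hq]))
    | const l => exact zero
  have hcontent : ∀ j, RatLin fun s : Cell J → ℝ => content s j := fun j =>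
    ((((proj _).add (proj _)).add (proj _)).add (proj _)).add (proj _)
  have hsel : ∀ a j, RatLin fun s => sel δ s a j := fun a j =>
    sum _ fun τ => RatLin.ite _ (proj _) zero
  have hlit : ∀ j x, RatLin fun s : Cell J → ℝ => lit s j x := by
    intro j x
    match x with
    | none => exact (proj _).sub (proj _)
    | some true => exact proj _
    | some false => exact (proj _).sub (proj _)
  cases i with
  | one => exact proj _
  | e => exact zero
  | u => exact zero
  | v => exact zero
  | r => exact zero
  | r' => exact proj _
  | A j =>
    exact (((((proj _).add (proj _)).add ((hbit j).mul 2)).add (proj _)).mul (1 / 4)).sub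
      ((proj _).sub (proj _))
  | B j => exact ((proj _).add (proj _)).sub (proj _)
  | I j => exact (hload j).sub ((proj _).sub ((proj _).sub (proj _)))
  | n j => exact (hcontent j).mul 4
  | b j => exact ((hcontent j).mul 4).sub ((proj _).mul 2)
  | c₁ j => exact hcontent j
  | b₂ j => exact proj _
  | c₂ j => exact proj _
  | o τ => exact (sum _ fun j => (hlit j _).sub (proj _)).add (proj _)
  | K j => exact (proj _).sub ((proj _).sub (hsel _ j))
  | P j =>
    exact ((((proj _).mul 4).sub ((proj _).mul 2)).sub (proj _)).sub
      (((proj _).sub (hsel _ j)).mul 4)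
  | Q a j =>
    exact (((proj _).add ((proj _).mul (2 * q a + 1) (by simp [hq]))).mul (1 / 4)).sub
      ((proj _).sub (hsel _ j))


/-- The external input of the cells. -/
def ext (b x₀ x₁ : ℝ) : Cell J → ℝ
  | e => b
  | u => x₀
  | v => x₁
  | r => x₁
  | _ => 0

/-- Cell `r` starts at 1, so that the end of the input is seen as a falling edge even for the empty
word. The cell recognizing empty tops is on, in accordance with empty stacks. -/
noncomputable def ini : Cell J → ℚ
  | one => 1
  | r => 1
  | o τ => if τ = fun _ => none then 1 else 0
  | _ => 0

/-- When exactly one of the cells `o τ` is on, the value is `1` or `-1` and avoids the gap of the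
threshold. -/
noncomputable def test (H : (J → Option Bool) → Prop) : ℝ :=
  2 * (∑ τ, if H τ then s (o τ) else 0) - s one

theorem exists_RNN (β : ℕ → ℝ) (H : Fin 2 → (J → Option Bool) → Prop) :
    ∃ M : RNN, M.RationalExceptBias ∧ (∀ t, M.Win t 0 2 = β t) ∧ ∀ w, ∃ s : ℕ → Cell J → ℝ,
      (∀ i, s 0 i = ini i) ∧
      (∀ t i, s (t + 1) i = linSigmoid (ext (β t) (RNN.input w t 0) (RNN.input w t 1) i +
        fwd δ src (s t) i)) ∧
      ∀ t j, M.output w t j = hardThreshold (test (s (t + 1)) (H j)) := by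
  have : Fintype (Cell J) := Fintype.ofFinite _
  choose q hq using ratLin_fwd δ src
  have hH : ∀ j, RatLin fun s : Cell J → ℝ => test s (H j) := fun j =>
    ((RatLin.sum _ fun τ => RatLin.ite _ (RatLin.proj _) RatLin.zero).mul 2).sub (RatLin.proj _)
  choose p hp using hH
  let N : Net (Cell J) :=
    { c := e
      inp := fun i => match i with
        | u => ![1, 0]
        | v => ![0, 1]
        | r => ![0, 1]
        | _ => 0
      bias := 0
      res := q
      out := p
      ini := ini
      ini_mem := fun i => by
        cases i <;> simp [ini]
        split_ifs <;> simp }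
  obtain ⟨M, hM₁, hM₂, hM₃⟩ := N.exists_RNN β
  refine ⟨M, hM₁, hM₂, fun w => ⟨N.state β w, fun i => rfl, fun t i => ?_, fun t j => ?_⟩⟩
  · have := hq i (N.state β w t)
    simp only at this
    rw [this, Net.state]
    cases i <;> simp [N, ext]
  · rw [hM₃]
    exact congrArg _ (hp j (N.state β w (t + 1))).symm

end

section

variable {J : Type} [Fintype J] {δ : Bsm J} {src : J → Src} {s : ℕ → Cell J → ℝ}
  {e : ℕ → Bool} {w : List Bool}

/-- `s` is the run of the network on the input `w` with the bias bits `e`. -/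
structure Run (δ : Bsm J) (src : J → Src) (e : ℕ → Bool) (w : List Bool) (s : ℕ → Cell J → ℝ) :
    Prop where
  zero : ∀ i, s 0 i = ini i
  succ : ∀ t i, s (t + 1) i = linSigmoid (ext (num (e t)) (RNN.input w t 0) (RNN.input w t 1) i +
    fwd δ src (s t) i)

theorem num_mem (b : Bool) : num b ∈ Set.Icc (0 : ℝ) 1 := by cases b <;> simp [num]

namespace Run

variable (h : Run δ src e w s)
include h

theorem one (t : ℕ) : s t .one = 1 := by
  induction t with
  | zero => simp [h.zero, ini]
  | succ t ih => simp [h.succ, ext, fwd, ih, linSigmoid_of_one_le]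

theorem e_succ (t : ℕ) : s (t + 1) .e = num (e t) := by
  simp [h.succ, ext, fwd, linSigmoid_of_mem (num_mem (e t)).1 (num_mem (e t)).2]

theorem u_succ (t : ℕ) (ht : t < w.length) : s (t + 1) .u = num w[t] := by
  have : RNN.input w t 0 = num w[t] := by simp [RNN.input, ht, num]
  simp [h.succ, ext, fwd, this, linSigmoid_of_mem (num_mem w[t]).1 (num_mem w[t]).2]

theorem v_succ (t : ℕ) : s (t + 1) .v = if t < w.length then 1 else 0 := by
  simp only [h.succ, ext, fwd, RNN.input_one, add_zero]
  exact linSigmoid_of_mem (by split_ifs <;> simp) (by split_ifs <;> simp)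

theorem r_eq (t : ℕ) : s t .r = if t ≤ w.length then 1 else 0 := by
  cases t with
  | zero => simp [h.zero, ini]
  | succ t =>
    simp only [h.succ, ext, fwd, RNN.input_one, add_zero, Nat.succ_le_iff]
    exact linSigmoid_of_mem (by split_ifs <;> simp) (by split_ifs <;> simp)

theorem r'_succ (t : ℕ) : s (t + 1) .r' = if t ≤ w.length then 1 else 0 := by
  simp only [h.succ, ext, fwd, h.r_eq, zero_add]
  exact linSigmoid_of_mem (by split_ifs <;> simp) (by split_ifs <;> simp)

end Run

/-- The letters that are presented on a channel. -/
def letter (e : ℕ → Bool) (w : List Bool) (i : Bool) (t : ℕ) : Bool :=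
  if i then w.getD t false else e t

/-- The initial stacks after `t` letters. -/
def initial (src : J → Src) (e : ℕ → Bool) (w : List Bool) (t : ℕ) (j : J) : List Bool :=
  match src j with
  | .chan i g => ((List.range t).map fun k => g (letter e w i k)).reverse
  | .const l => if l then [true] else []

namespace Run

variable (h : Run δ src e w s)
include h

/-- While the validation bit is on, `A` prepends the current letter and `B` is cut to 0; afterwards
`A` is cut to 0 and `B` keeps the finished word. -/
theorem load_eq (t : ℕ) (j : J) :
    load src (s (t + 1)) j = enc4 (initial src e w (min t w.length) j) := by
  unfold load initial
  split
  next i g hj =>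
    induction t with
    | zero =>
      have h₁ : s 1 (.A j) = 0 := by
        rw [h.succ]
        refine linSigmoid_of_nonpos ?_
        simp [ext, fwd, bit, hj, h.zero, ini]
        have := (num_mem (g false)).2
        linarith
      have h₂ : s 1 (.B j) = 0 := by
        rw [h.succ]
        refine linSigmoid_of_nonpos ?_
        simp [ext, fwd, h.zero, ini]
      simp [h₁, h₂, enc4]
    | succ t ih =>
      have hmem := enc4_mem ((List.range (min t w.length)).map fun k => g (letter e w i k)).reverse
      rw [h.succ (t + 1) (.A j), h.succ (t + 1) (.B j)]
      simp only [ext, fwd, ih, h.one, h.v_succ, zero_add]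
      by_cases ht : t < w.length
      · have hb : bit src (s (t + 1)) j = num (g (letter e w i t)) := by
          simp only [bit, hj, h.one, h.e_succ, h.u_succ t ht, letter, List.getD_eq_getElem _ _ ht]
          cases i
          · cases e t <;> simp [num]
          · cases w[t] <;> simp [num]
        rw [hb, min_eq_left ht.le, min_eq_left (Nat.succ_le_of_lt ht)]
        rw [min_eq_left ht.le] at hmem
        rw [List.range_succ, List.map_append, List.reverse_append]
        simp only [ht, if_true, List.map_cons, List.map_nil, List.reverse_cons, List.reverse_nil,
          List.nil_append, List.cons_append, enc4]
        have := num_mem (g (letter e w i t))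
        rw [linSigmoid_of_mem, linSigmoid_of_nonpos]
        · rw [num]; ring
        · linarith [hmem.2]
        · linarith [hmem.1, this.1]
        · linarith [hmem.2, this.2]
      · rw [min_eq_right (not_lt.1 ht), min_eq_right (by omega)]
        rw [min_eq_right (not_lt.1 ht)] at hmem
        have hb : bit src (s (t + 1)) j ≤ 1 := by
          have h₁ : s (t + 1) .u ∈ Set.Icc (0 : ℝ) 1 := by rw [h.succ]; exact linSigmoid_mem _
          have h₂ : s (t + 1) .e ∈ Set.Icc (0 : ℝ) 1 := by rw [h.succ]; exact linSigmoid_mem _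
          simp only [bit, hj, h.one]
          have h₃ : ∀ x ∈ Set.Icc (0 : ℝ) 1,
              num (g false) * 1 + (num (g true) - num (g false)) * x ≤ 1 := by
            rintro x ⟨hx, hx'⟩
            cases g false <;> cases g true <;> simp [num] <;> linarith
          split_ifs
          exacts [h₃ _ h₁, h₃ _ h₂]
        simp only [ht, if_false]
        rw [linSigmoid_of_nonpos, linSigmoid_of_mem]
        · ring
        · linarith [hmem.1]
        · linarith [hmem.2]
        · linarith [hmem.2]
  next l hj => cases l <;> norm_num [num, h.one, enc4]

/-- The difference of `r'` and `r` is 1 only at time `w.length + 1`, and it opens the gate of the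
loader for that single step. -/
theorem I_eq (t : ℕ) (j : J) : s t (.I j) =
    if t = w.length + 2 then enc4 (initial src e w w.length j) else 0 := by
  match t with
  | 0 => simp [h.zero, ini]
  | 1 =>
    rw [if_neg (by omega), h.succ, linSigmoid_of_nonpos]
    have : load src (s 0) j ≤ 1 := by
      unfold load
      cases src j with
      | chan i g => simp [h.zero, ini]
      | const l =>
        have := (num_mem l).2
        rw [h.one]
        linarith
    have h₁ : s 0 .r' = 0 := by simp [h.zero, ini]
    simp only [ext, fwd, h.one, h.r_eq, h₁]
    simp
    linarith
  | t + 2 =>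
    rw [h.succ]
    have hm := fun m => enc4_mem (initial src e w m j)
    simp only [ext, fwd, h.one, h.r_eq, h.r'_succ, h.load_eq, zero_add, Nat.add_left_inj]
    rcases lt_trichotomy t w.length with ht | ht | ht
    · simp only [ht.le, Nat.succ_le_of_lt ht, ht.ne, if_true, if_false]
      exact linSigmoid_of_nonpos (by linarith [(hm (min t w.length)).2])
    · subst ht
      simp only [le_refl, Nat.not_succ_le_self, if_true, if_false, min_self]
      rw [linSigmoid_of_mem] <;> linarith [(hm w.length).1, (hm w.length).2]
    · simp only [not_le.2 ht, ht.ne', show ¬ t + 1 ≤ w.length by omega, if_false]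
      exact linSigmoid_of_nonpos (by linarith [(hm (min t w.length)).2])

end Run

/-- The number `1` for nonempty words. -/
def nonempty : List Bool → ℝ
  | [] => 0
  | _ :: _ => 1

/-- The number of the first letter. -/
def hd : List Bool → ℝ
  | [] => 0
  | x :: _ => num x

theorem linSigmoid_nonempty (l : List Bool) : linSigmoid (4 * enc4 l) = nonempty l := by
  cases l with
  | nil => exact linSigmoid_of_nonpos (by simp [enc4])
  | cons b l =>
    refine linSigmoid_of_one_le ?_
    have := (enc4_mem l).1
    cases b <;> simp [enc4] <;> linarith

theorem linSigmoid_hd (l : List Bool) : linSigmoid (4 * enc4 l - 2) = hd l := by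
  have h := enc4_mem l.tail
  match l with
  | [] => exact linSigmoid_of_nonpos (by simp [enc4])
  | false :: l =>
    simp only [List.tail_cons] at h
    have := linSigmoid_of_nonpos (x := 4 * enc4 (false :: l) - 2) (by simp [enc4]; linarith [h.2])
    simpa [hd, num] using this
  | true :: l =>
    simp only [List.tail_cons] at h
    have := linSigmoid_of_one_le (x := 4 * enc4 (true :: l) - 2) (by simp [enc4]; linarith [h.1])
    simpa [hd, num] using this

-- The four summands are the candidates for keeping, popping and the two pushes. The gates of the
-- wrong ones subtract enough to make them nonpositive, and the right one is the exact encoding.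
-- Popping an empty stack yields `-1`, which is cut to 0.
open Classical in
theorem sum_app (a : Act) (l : List Bool) :
    linSigmoid (enc4 l - (1 - if a = .keep then 1 else 0)) +
    linSigmoid (4 * enc4 l - 2 * hd l - 1 - 4 * (1 - if a = .pop then 1 else 0)) +
    linSigmoid (1 / 4 * (enc4 l + (2 * num false + 1) * 1) -
      (1 - if a = .push false then 1 else 0)) +
    linSigmoid (1 / 4 * (enc4 l + (2 * num true + 1) * 1) - (1 - if a = .push true then 1 else 0)) =
    enc4 (a.app l) := by
  obtain ⟨h₀, h₁⟩ := enc4_mem l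
  have hh : 0 ≤ hd l := by
    match l with
    | [] => exact le_rfl
    | x :: l => exact (num_mem x).1
  have hk : linSigmoid (enc4 l - (1 - 0)) = 0 := linSigmoid_of_nonpos (by linarith)
  have hp : linSigmoid (4 * enc4 l - 2 * hd l - 1 - 4 * (1 - 0)) = 0 :=
    linSigmoid_of_nonpos (by linarith)
  have hq : ∀ b, linSigmoid (1 / 4 * (enc4 l + (2 * num b + 1) * 1) - (1 - 0)) = 0 := fun b =>
    linSigmoid_of_nonpos (by have := (num_mem b).2; linarith)
  have hq' : ∀ b, linSigmoid (1 / 4 * (enc4 l + (2 * num b + 1) * 1) - (1 - 1)) =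
      enc4 (b :: l) := fun b => by
    have := num_mem b
    rw [linSigmoid_of_mem (by linarith [this.1]) (by linarith [this.2]), enc4, ← num]
    ring
  match a with
  | .keep =>
    have hk' : linSigmoid (enc4 l - (1 - 1)) = enc4 l := by
      rw [sub_self, sub_zero, linSigmoid_of_mem h₀ h₁]
    simp only [if_true, reduceCtorEq, if_false, hk', hp, hq, Act.app, add_zero]
  | .pop =>
    simp only [if_true, reduceCtorEq, if_false, hk, hq, Act.app, zero_add, add_zero]
    match l with
    | [] => exact linSigmoid_of_nonpos (by simp [enc4, hd])
    | x :: l =>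
      have := enc4_mem l
      have e : 4 * enc4 (x :: l) - 2 * hd (x :: l) - 1 - 4 * (1 - 1) = enc4 l := by
        simp only [enc4, hd, num]; ring
      rw [e, linSigmoid_of_mem this.1 this.2, List.tail_cons]
  | .push x =>
    cases x <;> simp only [if_true, reduceCtorEq, Act.push.injEq, if_false, hk, hp, hq, hq',
      Act.app, zero_add, add_zero]

theorem lit_eq {s : Cell J → ℝ} {j : J} {l : List Bool} (h₁ : s .one = 1)
    (hn : s (.n j) = nonempty l) (hb : s (.b j) = hd l) (x : Option Bool) :
    lit s j x = if l.head? = x then 1 else 0 := by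
  match l, x with
  | [], none => simp [lit, h₁, hn, nonempty]
  | [], some true => simp [lit, hb, hd]
  | [], some false => simp [lit, hb, hn, hd, nonempty]
  | x :: _, none => simp [lit, h₁, hn, nonempty]
  | x :: _, some true => cases x <;> simp [lit, hb, hd, num]
  | x :: _, some false => cases x <;> simp [lit, hb, hn, hd, num, nonempty]

/-- A conjunction of bits is a threshold of their sum: a single mismatch already brings the value
down to 0. -/
theorem linSigmoid_match [DecidableEq (J → Option Bool)] (τ τ' : J → Option Bool) :
    linSigmoid (∑ j, ((if τ j = τ' j then 1 else 0) - 1 : ℝ) + 1) = if τ = τ' then 1 else 0 := by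
  classical
  split_ifs with hτ
  · subst hτ
    simp [linSigmoid_of_one_le]
  · refine linSigmoid_of_nonpos ?_
    obtain ⟨j, hj⟩ := Function.ne_iff.1 hτ
    rw [← Finset.add_sum_erase _ _ (Finset.mem_univ j), if_neg hj]
    have : ∑ x ∈ Finset.univ.erase j, ((if τ x = τ' x then 1 else 0) - 1 : ℝ) ≤ 0 :=
      Finset.sum_nonpos fun i _ => by split_ifs <;> norm_num
    linarith

namespace Run

variable (h : Run δ src e w s)
include h

-- Here `D t` are the stacks whose tops are recognized at time `t`, so the contents are two stages
-- ahead. The loop of length three carries three independent threads; an injected stack enters by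
-- addition.
open Classical in
theorem pipeline (D : ℕ → J → List Bool) (h₀ : ∀ t ≤ 2, D t = fun _ => [])
    (hD : ∀ t j, enc4 (D (t + 3) j) = enc4 (δ.step (D t) j) + s (t + 1) (.I j)) (t : ℕ) :
    (∀ j, content (s t) j = enc4 (D (t + 2) j)) ∧
    (∀ j, s t (.n j) = nonempty (D (t + 1) j)) ∧
    (∀ j, s t (.b j) = hd (D (t + 1) j)) ∧
    (∀ j, s t (.c₁ j) = enc4 (D (t + 1) j)) ∧
    (∀ j, s t (.b₂ j) = hd (D t j)) ∧
    (∀ j, s t (.c₂ j) = enc4 (D t j)) ∧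
    ∀ τ, s t (.o τ) = if tops (D t) = τ then 1 else 0 := by
  induction t with
  | zero =>
    have : tops (fun _ : J => ([] : List Bool)) = fun _ => none := rfl
    simp [h.zero, ini, content, h₀, enc4, nonempty, hd]
    intro τ
    simp [this, apply_ite (Rat.cast : ℚ → ℝ), eq_comm]
  | succ t ih =>
    obtain ⟨i₁, i₂, i₃, i₄, i₅, i₆, i₇⟩ := ih
    have hsel : ∀ a j, sel δ (s t) a j = if δ (tops (D t)) j = a then 1 else 0 := by
      intro a j
      rw [sel, Finset.sum_eq_single (tops (D t))]
      · simp [i₇]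
      · intro τ _ hτ
        simp [i₇, hτ.symm]
      · simp
    refine ⟨fun j => ?_, fun j => ?_, fun j => ?_, fun j => ?_, fun j => ?_, fun j => ?_,
      fun τ => ?_⟩
    · rw [hD, Bsm.step, ← sum_app, content]
      congr 1
      simp only [h.succ t (.K j), h.succ t (.P j), h.succ t (.Q _ j), ext, fwd, zero_add, i₅, i₆,
        h.one, hsel]
    · rw [h.succ, ← linSigmoid_nonempty]
      simp only [ext, fwd, zero_add, i₁]
    · rw [h.succ, ← linSigmoid_hd]
      simp only [ext, fwd, zero_add, i₁, h.one, mul_one]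
    · have := enc4_mem (D (t + 2) j)
      rw [h.succ]
      simp only [ext, fwd, zero_add, i₁]
      exact linSigmoid_of_mem this.1 this.2
    · rw [h.succ, ← linSigmoid_hd]
      simp only [ext, fwd, zero_add, i₃]
      rw [linSigmoid_hd]
      refine linSigmoid_of_mem ?_ ?_ <;> rw [← linSigmoid_hd]
      exacts [(linSigmoid_mem _).1, (linSigmoid_mem _).2]
    · have := enc4_mem (D (t + 1) j)
      rw [h.succ]
      simp only [ext, fwd, zero_add, i₄]
      exact linSigmoid_of_mem this.1 this.2
    · rw [h.succ, ← linSigmoid_match]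
      simp only [ext, fwd, zero_add, lit_eq (h.one t) (i₂ _) (i₃ _), h.one]
      rfl

-- The only injection starts one of the three threads. The other two, and the time before the
-- injection, consist of empty stacks, which stay empty by `hδ`.
open Classical in
theorem o_eq (hδ : δ (fun _ => none) = fun _ => .keep) (t : ℕ) (τ : J → Option Bool) :
    s t (.o τ) = if tops (if w.length + 4 ≤ t ∧ 3 ∣ t - (w.length + 4) then
      δ.step^[(t - (w.length + 4)) / 3] (initial src e w w.length) else fun _ => []) = τ
      then 1 else 0 := by
  have h₁ : δ.step (fun _ => []) = fun _ => [] := by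
    ext1 j
    have : tops (fun _ : J => ([] : List Bool)) = fun _ => none := rfl
    rw [Bsm.step, this, hδ]
    rfl
  refine (h.pipeline (fun t => if w.length + 4 ≤ t ∧ 3 ∣ t - (w.length + 4) then
      δ.step^[(t - (w.length + 4)) / 3] (initial src e w w.length) else fun _ => [])
      (fun t ht => if_neg (by omega)) (fun t j => ?_) t).2.2.2.2.2.2 τ
  rw [h.I_eq]
  by_cases ht : t + 1 = w.length + 2
  · rw [if_neg (by omega : ¬ (w.length + 4 ≤ t ∧ _)), if_pos (by omega), if_pos ht, h₁,
      show t + 3 - (w.length + 4) = 0 by omega]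
    simp [enc4]
  · rw [if_neg ht, add_zero]
    by_cases ht' : w.length + 4 ≤ t ∧ 3 ∣ t - (w.length + 4)
    · rw [if_pos ht', if_pos (by omega), show (t + 3 - (w.length + 4)) / 3 =
        (t - (w.length + 4)) / 3 + 1 by omega, Function.iterate_succ_apply']
    · rw [if_neg ht', if_neg (by omega), h₁]

end Run

end

end Cell

open Cell in
/-- A bit stack machine that halts in polynomial time gives a network. -/
theorem mem_classENN_of_bsm {J : Type} [Fintype J] {δ : Bsm J} (src : J → Src)
    (hδ : δ (fun _ => none) = fun _ => .keep)
    (H : (J → Option Bool) → Prop) (hH : ¬ H fun _ => none) (j : J) (P : Polynomial ℕ)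
    {L : Language Bool} {e : ℕ → Bool} [DecidablePred (· ∈ L)]
    (h : ∀ w, ∃ k ≤ P.eval w.length,
      (∀ i, H (tops (δ.step^[i] (initial src e w w.length))) ↔ i = k) ∧
      (δ.step^[k] (initial src e w w.length) j).head? = some (decide (w ∈ L))) :
    L ∈ classENN {e} poly := by
  classical
  obtain ⟨M, hM₁, hM₂, hM₃⟩ := exists_RNN δ src (fun t => num (e t))
    -- The data output is also tied to halting, since it must be 0 at all other times.
    ![fun τ => H τ ∧ τ j = some true, H]
  refine ⟨e, rfl, _, eval_mem_poly (.X + 3 * P + 6), M, ⟨hM₁, hM₂⟩, ?_⟩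
  suffices key : ∀ w, ∃ τ ≤ (.X + 3 * P + 6 : Polynomial ℕ).eval w.length,
      M.Answers w (decide (w ∈ L)) τ by
    refine fun w => ⟨fun hw => ?_, fun hw => ?_⟩
    · simpa [hw] using key w
    · simpa [hw] using key w
  intro w
  obtain ⟨s, hs₁, hs₂, hs₃⟩ := hM₃ w
  have hs : Run δ src e w s := ⟨hs₁, hs₂⟩
  obtain ⟨k, hk, hk₁, hk₂⟩ := h w
  refine ⟨w.length + 4 + 3 * k, by simp; omega, by omega, fun t => ?_⟩
  obtain ⟨D, hD⟩ : ∃ D, D = if w.length + 4 ≤ t + 1 ∧ 3 ∣ t + 1 - (w.length + 4) then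
      δ.step^[(t + 1 - (w.length + 4)) / 3] (initial src e w w.length) else fun _ => [] := ⟨_, rfl⟩
  have htest : ∀ G, test (s (t + 1)) G = if G (tops D) then 1 else -1 := by
    intro G
    have := fun τ => hs.o_eq hδ (t + 1) τ
    rw [← hD] at this
    rw [test, hs.one, Finset.sum_eq_single (tops D)]
    · rw [this]
      split_ifs <;> simp at * <;> norm_num
    · intro τ _ hτ
      simp [this, hτ.symm]
    · simp
  have hth : ∀ G : Prop, hardThreshold (if G then 1 else -1) = some (decide G) := by
    intro G
    unfold hardThreshold
    split_ifs with h₁ h₂ h₃ <;> first | simp_all; done | norm_num at *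
  have hDH : H (tops D) ↔ t + 1 = w.length + 4 + 3 * k := by
    split_ifs at hD with ht
    · rw [hD, hk₁]; omega
    · have : tops (fun _ : J => ([] : List Bool)) = fun _ => none := rfl
      rw [hD, this]
      refine ⟨fun h => absurd h hH, fun h => absurd ⟨by omega, by omega⟩ ht⟩
  ext1 i
  rw [hs₃, htest, hth]
  split_ifs with ht
  · have hDk : D = δ.step^[k] (initial src e w w.length) := by
      rw [hD, if_pos (by omega)]
      congr 2
      omega
    rw [hDk] at hDH ⊢
    have : tops (δ.step^[k] (initial src e w w.length)) j = some (decide (w ∈ L)) := hk₂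
    fin_cases i
    · simp [hDH.2 ht, this]
    · simp [hDH.2 ht]
  · have : ¬ H (tops D) := fun h => ht (hDH.1 h)
    fin_cases i <;> simp [this]

/-- If membership can be decided in polynomial time when a prefix of `e` is given, then the network
with the bias bits `e` decides. -/
theorem PT.mem_classENN {d : List Bool × List Bool → List Bool} (hd : PT d) {L : Language Bool}
    {e : ℕ → Bool} [DecidablePred (· ∈ L)]
    (h : ∀ w : List Bool, d (prefixWord e w.length, w) = [decide (w ∈ L)]) :
    L ∈ classENN {e} poly := by
  classical
  obtain ⟨M, P, hM⟩ := hd.exists_machine₂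
  obtain ⟨C, hC⟩ := M.exists_bsm_run
  have : Fintype M.Ctrl := Fintype.ofFinite _
  let src : M.J → Src
    | .inl c => .const (decide ((M.prog M.main, M.start) = (c.1.1, c.2)))
    -- The first input of the machine is the bias word, the second the input word; both are pushed
    -- as they arrive and hence stand reversed on the stacks.
    | .inr (.inl i, a) => .chan (decide (i = 1)) fun b => decide (Sum.inl b = a)
    | .inr (.inr _, _) => .const false
  have hinit : ∀ w : List Bool, Cell.initial src e w w.length =
      M.bsmInit ![(prefixWord e w.length).reverse, w.reverse] := by
    intro w
    ext1 j
    have hw : w = (List.range w.length).map fun k => w.getD k false := by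
      refine List.ext_getElem (by simp) fun i h₁ h₂ => by simp [h₁]
    rcases j with c | ⟨i | i, a⟩
    · simp [Cell.initial, src, Machine.bsmInit]
    · fin_cases i
      · simp [Cell.initial, src, Machine.bsmInit, Cell.letter, prefixWord, Function.comp_def]
      · simp only [Cell.initial, src, Machine.bsmInit, Cell.letter]
        conv_rhs => rw [show (![(prefixWord e w.length).reverse, w.reverse] : Fin 2 → _)
          ((fun i => i) ⟨1, by omega⟩) = w.reverse from rfl, hw]
        simp [Function.comp_def]
    · simp [Cell.initial, src, Machine.bsmInit]
  refine mem_classENN_of_bsm (δ := M.bsm) src Machine.bsm_idle M.HaltTops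
    (by simp [Machine.HaltTops]) M.outJ (.C C * P) fun w => ?_
  obtain ⟨k, hk, h₁, h₂⟩ := hC _ _ _ (hM (prefixWord e w.length).reverse w.reverse)
  have hl : (prefixWord e w.length).reverse.take w.reverse.length =
      (prefixWord e w.length).reverse := List.take_of_length_le (by simp [prefixWord])
  rw [hl, List.reverse_reverse, List.reverse_reverse, h] at h₁
  rw [hinit]
  refine ⟨k, by simpa using hk, h₂, ?_⟩
  rw [h₁ k le_rfl]
  rfl

/-! Advice as a word of small Kolmogorov complexity. -/

theorem prefixWord_length (s : ℕ → Bool) (n : ℕ) : (prefixWord s n).length = n := by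
  simp [prefixWord]

theorem prefixWord_succ (s : ℕ → Bool) (n : ℕ) :
    prefixWord s (n + 1) = prefixWord s n ++ [s n] := by
  simp [prefixWord, List.range_succ]

theorem prefixWord_getElem (s : ℕ → Bool) (n i : ℕ) (h : i < (prefixWord s n).length) :
    (prefixWord s n)[i] = s i := by
  simp [prefixWord]

theorem take_prefixWord (s : ℕ → Bool) (m n : ℕ) :
    (prefixWord s n).take m = prefixWord s (min m n) := by
  refine List.ext_getElem (by simp [prefixWord_length]) fun i h₁ h₂ => ?_
  simp [prefixWord_getElem]

theorem prefixWord_prefix (s : ℕ → Bool) {m n : ℕ} (h : m ≤ n) :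
    prefixWord s m <+: prefixWord s n := by
  rw [← min_eq_left h, ← take_prefixWord]
  exact List.take_prefix _ _

/-- A polynomial-time function has a program for the universal machine. -/
theorem Machine.IsUniversal.exists_program {U : Machine (Fin 2)} (hU : U.IsUniversal)
    {h : List Bool × ℕ → List Bool} (hh : PT h) : ∃ p : List Bool, ∃ Q : Polynomial ℕ, ∀ x n,
      U.OutputsIn ![p ++ x, unary n] (h (x.take n, n)) (Q.eval n) := by
  obtain ⟨M, P, hM⟩ := PT.exists_machine₂ (f := fun z => h (z.1.reverse, z.2.length))
    (hh.comp (PT.fst.reverse.pair PT.snd.length))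
  obtain ⟨p, q, hq, hp⟩ := hU M
  obtain ⟨Q, hQ⟩ := exists_polynomial_of_mem_poly hq
  refine ⟨p, Q.comp P, fun x n => ?_⟩
  have := hp _ _ _ _ (hM x (unary n))
  simp only [List.length_reverse, List.reverse_reverse, unary, List.length_replicate] at this
  exact this.mono (by simpa using hQ _)

/-- The number of leading letters `1`, and the rest of the word. -/
def leadStep (z : ℕ × List Bool) : ℕ × List Bool :=
  match z.2 with
  | [] => z
  | b :: _ => bif b then (z.1 + 1, z.2.tail) else z

def lead (y : List Bool) : ℕ × List Bool := leadStep^[y.length] (0, y)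

theorem lead_replicate (j : ℕ) (R : List Bool) :
    lead (List.replicate j true ++ false :: R) = (j, false :: R) := by
  have h : ∀ j i k, leadStep^[j + k] (i, List.replicate j true ++ false :: R) =
      (i + j, false :: R) := by
    intro j
    induction j with
    | zero =>
      intro i k
      rw [zero_add]
      exact Function.iterate_fixed rfl k
    | succ j ih =>
      intro i k
      rw [Nat.add_right_comm, Function.iterate_succ_apply, List.replicate_succ, List.cons_append]
      have := ih (i + 1) k
      rw [Nat.add_right_comm, add_assoc] at this
      exact this
  have := h j 0 (R.length + 1)
  rw [zero_add] at this
  rw [lead, show (List.replicate j true ++ false :: R).length = j + (R.length + 1) by simp]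
  exact this

theorem PT.lead {E : Type} [Env E] {f : E → List Bool} (hf : PT f) : PT (fun x => lead (f x)) := by
  have hs : PT leadStep := by
    refine cases (E := ℕ × List Bool) (c := fun z => z.2) (f := fun z => z)
      (g := fun b z => bif b then (z.1 + 1, z.2.tail) else z) snd id fun b => ?_
    cases b
    · exact id
    · exact fst.succ.pair snd.tail
  refine iter (f := fun (_ : E) z => leadStep z) (hs.comp snd) 1 (fun n m y z _ _ h => ?_)
    hf.length ((constNat 0).pair hf)
  obtain ⟨k, l⟩ := z
  rw [Env.le_prod, Env.le_nat, Env.le_list] at h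
  rcases l with _ | ⟨_ | _, l⟩ <;> simp [leadStep, Env.le_prod] at * <;> omega

section Code

variable (g : ℕ → ℕ) (c : ℕ) (A : ℕ → Bool)

/-- The number of letters known after `2 i` letters of the code. -/
def known : ℕ → ℕ
  | 0 => c
  | i + 1 => if known i < g i then known i + 1 else known i

/-- The code of the letters of `A` from the `c`-th on: a marker says whether a letter follows. -/
def codeWord (k : ℕ) : Bool :=
  if known g c (k / 2) < g (k / 2) then (if k % 2 = 0 then true else A (known g c (k / 2)))
  else false

variable {g c}

theorem known_mono : Monotone (known g c) := by
  refine monotone_nat_of_le_succ fun i => ?_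
  rw [known]
  split_ifs <;> omega

theorem le_known (i : ℕ) : c ≤ known g c i := known_mono (Nat.zero_le i)

theorem known_le (hg : Monotone g) (i : ℕ) : known g c i ≤ max c (g i) := by
  induction i with
  | zero => exact le_max_left _ _
  | succ i ih =>
    have := hg (Nat.le_succ i)
    simp only [Nat.succ_eq_add_one] at this
    rw [known]
    split_ifs <;> omega

/-- From block `i` on, each block supplies a letter until at least `g i` are known. -/
theorem min_le_known (hg : Monotone g) (i k : ℕ) : min (g i) k ≤ known g c (i + k) := by
  induction k with
  | zero => simp
  | succ k ih =>
    have := hg (Nat.le_add_right i k)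
    rw [← add_assoc, known]
    split_ifs <;> omega

variable (g)

/-- Produces two letters of the code. -/
def codeStep (z : (ℕ × ℕ) × (List Bool × List Bool)) : (ℕ × ℕ) × (List Bool × List Bool) :=
  if z.1.2 < g z.1.1 then
    ((z.1.1 + 1, z.1.2 + 1), (z.2.1.tail, z.2.1.head?.getD false :: true :: z.2.2))
  else ((z.1.1 + 1, z.1.2), (z.2.1, false :: false :: z.2.2))

/-- The bound `hk` guarantees that a letter is taken from `R` only while there is one, so the
default letter of `codeStep` never matters. -/
theorem codeStep_iterate (R : List Bool) (hR : ∀ i (h : i < R.length), R[i] = A (c + i)) (k : ℕ)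
    (hk : known g c k ≤ c + R.length) : (codeStep g)^[k] ((0, c), (R, [])) =
      ((k, known g c k),
        (R.drop (known g c k - c), (prefixWord (codeWord g c A) (2 * k)).reverse)) := by
  induction k with
  | zero => simp [known, prefixWord]
  | succ k ih =>
    have h₀ := le_known (g := g) (c := c) k
    have h₁ : (2 * k) / 2 = k := by omega
    have h₂ : (2 * k + 1) / 2 = k := by omega
    have h₃ : (2 * k) % 2 = 0 := by omega
    have h₄ : (2 * k + 1) % 2 ≠ 0 := by omega
    rw [Function.iterate_succ_apply', ih ((known_mono (Nat.le_succ k)).trans hk), codeStep,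
      show 2 * (k + 1) = 2 * k + 1 + 1 by ring, prefixWord_succ, prefixWord_succ]
    simp only [codeWord, h₁, h₂, h₃, h₄]
    rw [known] at *
    by_cases hlt : known g c k < g k
    · simp only [hlt, if_true] at hk ⊢
      have h₅ : known g c k - c < R.length := by omega
      rw [List.drop_eq_getElem_cons h₅, hR _ h₅, show c + (known g c k - c) = known g c k by omega,
        show known g c k + 1 - c = known g c k - c + 1 by omega]
      simp
    · simp [hlt]

theorem PT.codeStep {g : ℕ → ℕ} (hg : PT g) : PT (codeStep g) := by
  have h₁ : PT (fun z : (ℕ × ℕ) × (List Bool × List Bool) => z.1.1) := fst.fst'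
  have h₂ : PT (fun z : (ℕ × ℕ) × (List Bool × List Bool) => z.1.2) := fst.snd'
  have h₃ : PT (fun z : (ℕ × ℕ) × (List Bool × List Bool) => z.2.1) := snd.fst'
  have h₄ : PT (fun z : (ℕ × ℕ) × (List Bool × List Bool) => z.2.2) := snd.snd'
  exact (h₂.lt_decide (hg.comp h₁)).ite
    ((h₁.succ.pair h₂.succ).pair (h₃.tail.pair (h₃.head.consBool (h₄.cons true))))
    ((h₁.succ.pair h₂).pair (h₃.pair ((h₄.cons false).cons false)))

theorem PT.codeRun {g : ℕ → ℕ} (hg : PT g) {E : Type} [Env E] {k c : E → ℕ} {R : E → List Bool}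
    (hk : PT k) (hc : PT c) (hR : PT R) :
    PT (fun x => (_root_.codeStep g)^[k x] ((0, c x), (R x, []))) := by
  refine iter (f := fun (_ : E) z => _root_.codeStep g z) (hg.codeStep.comp snd) 2
    (fun n m y z _ _ h => ?_) hk (((constNat 0).pair hc).pair (hR.pair nil))
  obtain ⟨⟨i, k⟩, ⟨l, a⟩⟩ := z
  simp only [Env.le_prod, Env.le_nat, Env.le_list] at h
  unfold _root_.codeStep
  split_ifs <;> simp [Env.le_prod] <;> omega

/-- Reads one letter of the code. -/
def decodeStep (z : Bool × Bool × List Bool) (b : Bool) : Bool × Bool × List Bool :=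
  if z.1 = true then (false, z.2.1, if z.2.1 = true then b :: z.2.2 else z.2.2)
  else (true, b, z.2.2)

/-- The markers make decoding independent of `g`. -/
def decode (l : List Bool) : List Bool := (l.foldl decodeStep (false, false, [])).2.2.reverse

theorem PT.decode {E : Type} [Env E] {f : E → List Bool} (hf : PT f) :
    PT (fun x => decode (f x)) := by
  refine (foldl (f := fun (_ : E) z b => decodeStep z b) (fun b => ?_) 1
    (fun n m y z b hn _ h => ?_) hf
    ((constBool false).pair ((constBool false).pair nil))).snd'.snd'.reverse
  · have h₁ : PT (fun z : E × (Bool × Bool × List Bool) => z.2.1) := snd.fst'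
    have h₂ : PT (fun z : E × (Bool × Bool × List Bool) => z.2.2.1) := snd.snd'.fst'
    have h₃ : PT (fun z : E × (Bool × Bool × List Bool) => z.2.2.2) := snd.snd'.snd'
    exact (h₁.eqBool (constBool true)).ite
      ((constBool false).pair (h₂.pair ((h₂.eqBool (constBool true)).ite (h₃.cons b) h₃)))
      ((constBool true).pair ((constBool b).pair h₃))
  · obtain ⟨a, q, l⟩ := z
    simp only [Env.le_prod, Env.le_bool, Env.le_list] at h
    unfold decodeStep
    dsimp only
    split_ifs <;> simp [Env.le_prod] <;> omega

/-- A prefix of odd length ends with a marker whose letter is missing; it contributes nothing. -/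
theorem decode_prefixWord (n : ℕ) : prefixWord A c ++ decode (prefixWord (codeWord g c A) n) =
    prefixWord A (known g c (n / 2)) := by
  have key : ∀ k, ∃ x l, (prefixWord (codeWord g c A) (2 * k)).foldl decodeStep (false, false, []) =
      (false, x, l) ∧ prefixWord A c ++ l.reverse = prefixWord A (known g c k) := by
    intro k
    induction k with
    | zero => exact ⟨false, [], by simp [prefixWord], by simp [known]⟩
    | succ k ih =>
      obtain ⟨x, l, h₁, h₂⟩ := ih
      have e₁ : (2 * k) / 2 = k := by omega
      have e₂ : (2 * k + 1) / 2 = k := by omega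
      have e₃ : (2 * k) % 2 = 0 := by omega
      have e₄ : (2 * k + 1) % 2 ≠ 0 := by omega
      rw [show 2 * (k + 1) = 2 * k + 1 + 1 by ring, prefixWord_succ, prefixWord_succ,
        List.foldl_append, List.foldl_append, h₁]
      simp only [codeWord, e₁, e₂, e₃, e₄, known]
      by_cases hlt : known g c k < g k
      · refine ⟨true, A (known g c k) :: l, by simp [hlt, decodeStep], ?_⟩
        rw [if_pos hlt, prefixWord_succ, ← h₂]
        simp
      · exact ⟨false, l, by simp [hlt, decodeStep], by simp [hlt, h₂]⟩
  obtain ⟨x, l, h₁, h₂⟩ := key (n / 2)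
  rcases Nat.mod_two_eq_zero_or_one n with h | h
  · rw [show n = 2 * (n / 2) by omega, decode, h₁]
    simpa using h₂
  · rw [show n = 2 * (n / 2) + 1 by omega, decode, prefixWord_succ, List.foldl_append, h₁,
      show (2 * (n / 2) + 1) / 2 = n / 2 by omega]
    simpa [decodeStep] using h₂

end Code

/-- The only information needed is the program itself, of constant length. Here the class of bounds
has to be unbounded up to constants. -/
theorem exists_const_mem_KolmogorovWords {U : Machine (Fin 2)} (hU : U.IsUniversal)
    {𝓕 : Set (ℕ → ℕ)} (hunb : ∀ c : ℕ, ∃ f ∈ 𝓕, ∀ᶠ n in atTop, c ≤ f n) :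
    (fun _ => true) ∈ KolmogorovWords U 𝓕 poly := by
  obtain ⟨p, Q, hp⟩ := hU.exists_program (h := fun z => unary z.2) PT.snd.unary
  obtain ⟨f, hf, hf'⟩ := hunb p.length
  refine ⟨f, hf, _, eval_mem_poly Q, fun i => p.getD i false, ?_⟩
  filter_upwards [hf'] with n hn m hm
  have h₁ : prefixWord (fun i => p.getD i false) m = p ++ List.replicate (m - p.length) false := by
    refine List.ext_getElem (by simp [prefixWord_length]; omega) fun i h₁ h₂ => ?_
    rw [prefixWord_getElem, List.getElem_append]
    split_ifs with h <;> simp [h]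
  have h₂ : prefixWord (fun _ => true) n = unary n := by
    refine List.ext_getElem (by simp [prefixWord_length, unary]) fun i h₁ h₂ => ?_
    simp [prefixWord_getElem, unary]
  rw [h₁, h₂]
  exact hp _ _

/-- The letters of `A` are computed from a word that agrees with `A` from the place `c` on and has
the program before that place. So the first `g n` letters suffice without an additive constant, and
`c` depends on `g` but not on `A`. -/
theorem codeWord_mem_KolmogorovWords {U : Machine (Fin 2)} (hU : U.IsUniversal)
    {𝓕 : Set (ℕ → ℕ)} (h𝓕 : IsReasonable 𝓕) {g : ℕ → ℕ} (hg : g ∈ 𝓕) (hg' : PT g)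
    (hgu : ∀ c, ∀ᶠ n in atTop, c ≤ g n) :
    ∃ c, ∀ A, codeWord g c A ∈ KolmogorovWords U 𝓕 poly := by
  let h : List Bool × ℕ → List Bool := fun z =>
    ((codeStep g)^[z.2] ((0, 2 * (lead z.1).1 + 1), ((lead z.1).2.tail, []))).2.2.reverse.take z.2
  have hh : PT h := by
    have h₁ : PT (fun z : List Bool × ℕ => lead z.1) := PT.fst.lead
    exact PT.snd.take (PT.codeRun hg' PT.snd ((PT.constNat 2).mul h₁.fst').succ
      h₁.snd'.tail).snd'.snd'.reverse
  obtain ⟨p, Q, hp⟩ := hU.exists_program hh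
  obtain ⟨j, hj⟩ : ∃ j, j = p.length := ⟨_, rfl⟩
  -- After the program comes its own length in self-delimiting unary, from which the algorithm
  -- computes the offset `c = 2 j + 1`.
  let q : List Bool := p ++ (List.replicate j true ++ [false])
  have hq : q.length = 2 * j + 1 := by simp [q, hj]; omega
  refine ⟨2 * j + 1, fun A => ⟨g, hg, _, eval_mem_poly Q,
    fun i => if h : i < q.length then q[i] else A i, ?_⟩⟩
  filter_upwards [hgu (2 * j + 1), h𝓕.sublinear g hg] with n hn hgn m hm
  obtain ⟨R, hR⟩ : ∃ R, R = (List.range (m - (2 * j + 1))).map fun i => A (2 * j + 1 + i) :=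
    ⟨_, rfl⟩
  have hβ : prefixWord (fun i => if h : i < q.length then q[i] else A i) m = q ++ R := by
    refine List.ext_getElem (by simp [prefixWord_length, hR, hq]; omega) fun i h₁ h₂ => ?_
    rw [prefixWord_getElem, List.getElem_append]
    split_ifs with h
    · rfl
    · simp only [hR, List.getElem_map, List.getElem_range]
      congr 1
      omega
  -- The algorithm sees only `n` letters after the program. This is enough because `g n ≤ n`.
  have htake : (List.replicate j true ++ false :: R).take n =
      List.replicate j true ++ false :: R.take (n - (j + 1)) := by
    rw [List.take_append, List.take_of_length_le (by simp; omega), List.length_replicate,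
      show n - j = n - (j + 1) + 1 by omega, List.take_succ_cons]
  have hlen : (R.take (n - (j + 1))).length = min (n - (j + 1)) (m - (2 * j + 1)) := by simp [hR]
  have hk := known_le (g := g) (c := 2 * j + 1) (h𝓕.monotone g hg) n
  rw [max_eq_right hn] at hk
  have hrun := codeStep_iterate g A (c := 2 * j + 1) (R.take (n - (j + 1)))
    (fun i hi => by simp [hR]) n (by omega)
  have := hp (List.replicate j true ++ false :: R) n
  have hres : h (List.replicate j true ++ false :: R.take (n - (j + 1)), n) =
      prefixWord (codeWord g (2 * j + 1) A) n := by
    simp only [h, lead_replicate, List.tail_cons, hrun, List.reverse_reverse, take_prefixWord]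
    congr 1
    omega
  rw [htake, hres] at this
  rw [hβ]
  simpa [q] using this

/-- A network sees only as many letters of its bias word as the input has. The thinned advice
delivers enough of `A` in that time, and stability under longer prefixes makes the surplus harmless.
-/
theorem adviceStarClass_subset_classENN {U : Machine (Fin 2)} (hU : U.IsUniversal)
    {𝓕 : Set (ℕ → ℕ)} (h𝓕 : IsReasonable 𝓕)
    (hunb : ∀ c : ℕ, ∃ f ∈ 𝓕, ∀ᶠ n in atTop, c ≤ f n) :
    adviceStarClass classP 𝓕 ⊆ classENN (KolmogorovWords U 𝓕 poly) poly := by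
  classical
  rintro L ⟨f, hf, L', hL', α, ⟨hα, hα'⟩, hL⟩
  obtain ⟨d, hd, hd'⟩ := mem_classP_iff.1 hL'
  suffices key : ∃ s ∈ KolmogorovWords U 𝓕 poly, ∃ a : List Bool → List Bool, PT a ∧
      ∀ᶠ n in atTop, ∀ w : List Bool, w.length = n →
        (w ∈ L ↔ pairWord w (a (prefixWord s n)) ∈ L') by
    obtain ⟨s, hs, a, ha, hev⟩ := key
    obtain ⟨N, hN⟩ := eventually_atTop.1 hev
    -- The finitely many input lengths below `N` are answered from a table.
    obtain ⟨e, he, F, hF, M, hM⟩ := PT.mem_classENN (L := L) (e := s)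
      (PT.patch N (fun w => decide (w ∈ L)) (E := List Bool × List Bool) PT.snd
        (hd.comp (PT.snd.pairWord (ha.comp PT.fst)))) fun w => by
          dsimp only
          split_ifs with h
          · rfl
          · simp only [hd', hN w.length (not_lt.1 h) w rfl]
    obtain rfl : e = s := he
    exact ⟨e, hs, F, hF, M, hM⟩
  have hfm : Monotone f := fun m n hmn => by
    rw [← hα', ← hα']
    exact (hα m n hmn).length_le
  by_cases hb : ∃ B, ∀ n, f n ≤ B
  · obtain ⟨N, hN⟩ : ∃ N, ∀ n ≥ N, f n = f N := by
      obtain ⟨B, hB⟩ := hb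
      have hbdd : BddAbove (Set.range f) := ⟨B, Set.forall_mem_range.2 hB⟩
      obtain ⟨N, hN⟩ := Nat.sSup_mem (Set.range_nonempty f) hbdd
      exact ⟨N, fun n hn => le_antisymm (hN ▸ le_csSup hbdd ⟨n, rfl⟩) (hfm hn)⟩
    refine ⟨_, exists_const_mem_KolmogorovWords hU hunb, fun _ => α N, PT.constList _, ?_⟩
    filter_upwards [eventually_ge_atTop N] with n hn w hw
    rw [(hL n w hw).1, (hα N n hn).eq_of_length (by rw [hα', hα', hN n hn])]
  · push Not at hb
    -- The limit of the advice words; the default is not used, since the chosen word is longer than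
    -- `i`.
    let A : ℕ → Bool := fun i => (α (Nat.find (hb i))).getD i false
    have hA : ∀ n, α n = prefixWord A (f n) := by
      intro n
      refine List.ext_getElem (by simp [prefixWord_length, hα']) fun i h₁ h₂ => ?_
      rw [prefixWord_getElem]
      have hi : i < (α (Nat.find (hb i))).length := by rw [hα']; exact Nat.find_spec (hb i)
      simp only [A, List.getD_eq_getElem _ _ hi]
      rcases le_total n (Nat.find (hb i)) with h | h
      · exact (hα _ _ h).getElem h₁
      · exact ((hα _ _ h).getElem hi).symm
    -- The bound will be used at `n / 4`, and `n ≤ 4 * (n / 4) + 8`. Of the `n / 2` blocks read, a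
    -- quarter of `n` fixes the goal `g (n / 4)`, and another quarter suffices to reach it.
    obtain ⟨g₀, hg₀, hg₀'⟩ := h𝓕.comp_poly f hf _ (eval_mem_poly (4 * .X + 8))
    obtain ⟨g, hg, hg₁, hg₂⟩ := h𝓕.dominated g₀ hg₀
    have hfg : ∀ᶠ n in atTop, f (4 * n + 8) ≤ g n := by
      filter_upwards [hg₀', hg₁] with n h₁ h₂
      exact le_trans (by simpa using h₁) h₂
    have hgm := h𝓕.monotone g hg
    have hgu : ∀ c, ∀ᶠ n in atTop, c ≤ g n := by
      intro c
      obtain ⟨N, hN⟩ := hb c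
      filter_upwards [hfg, eventually_ge_atTop N] with n h₁ h₂
      exact (hN.le.trans (hfm (by omega))).trans h₁
    obtain ⟨c, hc⟩ := codeWord_mem_KolmogorovWords hU h𝓕 hg hg₂.pt hgu
    refine ⟨_, hc A, fun l => prefixWord A c ++ decode l,
      (PT.constList _).append (PT.decode PT.id), ?_⟩
    have h4 : Tendsto (fun n : ℕ => n / 4) atTop atTop :=
      Nat.tendsto_div_const_atTop (by norm_num)
    filter_upwards [h4.eventually hfg, h4.eventually (h𝓕.sublinear g hg)] with n h₁ h₂ w hw
    have hle : f n ≤ known g c (n / 2) := by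
      have h₃ := min_le_known (c := c) hgm (n / 4) (n / 4)
      rw [min_eq_left h₂] at h₃
      exact ((hfm (by omega)).trans h₁).trans (h₃.trans (known_mono (by omega)))
    obtain ⟨k, hk⟩ := hb (known g c (n / 2))
    rw [decode_prefixWord, (hL n w hw).1]
    -- The decoded prefix lies between the advice for `n` and a later advice word that is long
    -- enough.
    refine (hL n w hw).2 (max n k) (le_max_left _ _) _ ?_ ?_
    · rw [hA]; exact prefixWord_prefix _ hle
    · rw [hA]; exact prefixWord_prefix _ (hk.le.trans (hfm (le_max_right _ _)))

/-! Simulation of networks in polynomial time. -/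

theorem abs_linSigmoid_sub_le (x y : ℝ) : |linSigmoid x - linSigmoid y| ≤ |x - y| := by
  have h : ∀ x y, x ≤ y → |linSigmoid x - linSigmoid y| ≤ |x - y| := by
    intro x y h
    have h₁ : linSigmoid x ≤ linSigmoid y := by
      rw [linSigmoid_eq, linSigmoid_eq]
      exact max_le_max le_rfl (min_le_min h le_rfl)
    rw [abs_sub_comm, abs_of_nonneg (sub_nonneg.2 h₁), abs_sub_comm, abs_of_nonneg (sub_nonneg.2 h)]
    simp only [linSigmoid]
    split_ifs <;> linarith
  rcases le_total x y with hxy | hxy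
  · exact h x y hxy
  · rw [abs_sub_comm, abs_sub_comm x]
    exact h y x hxy

theorem linSigmoid_div {z : ℤ} {q : ℕ} (hq : 0 < q) :
    linSigmoid (z / q) = (min z.toNat q : ℕ) / q := by
  have hq' : (0 : ℝ) < q := by exact_mod_cast hq
  rcases le_total z 0 with hz | hz
  · rw [linSigmoid_of_nonpos, Int.toNat_of_nonpos hz]
    · simp
    · exact div_nonpos_of_nonpos_of_nonneg (by exact_mod_cast hz) hq'.le
  · obtain ⟨n, rfl⟩ := Int.eq_ofNat_of_zero_le hz
    rcases le_total n q with hn | hn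
    · rw [linSigmoid_of_mem]
      · simp [hn]
      · positivity
      · rw [div_le_one hq']; exact_mod_cast hn
    · rw [linSigmoid_of_one_le]
      · simp [hn, hq'.ne']
      · rw [one_le_div hq']; exact_mod_cast hn

theorem prefixWord_succ' (s : ℕ → Bool) (n : ℕ) :
    prefixWord s (n + 1) = s 0 :: prefixWord (fun i => s (i + 1)) n := by
  simp [prefixWord, List.range_succ_eq_map, Function.comp_def]

theorem abs_delta4_sub_enc4_le (s : ℕ → Bool) (n : ℕ) :
    |delta4 s - enc4 (prefixWord s n)| ≤ (1 / 4) ^ n := by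
  induction n generalizing s with
  | zero =>
    have := delta4_mem s
    simp only [prefixWord, List.range_zero, List.map_nil, enc4, pow_zero, sub_zero]
    rw [abs_of_nonneg (by linarith [this.1])]
    exact this.2
  | succ n ih =>
    rw [delta4_eq, prefixWord_succ', enc4, ← sub_div, add_sub_add_left_eq_sub, abs_div, pow_succ]
    have := ih fun i => s (i + 1)
    rw [abs_of_pos (show (0 : ℝ) < 4 by norm_num)]
    linarith

/-- The binary digits of `4 ^ l.length * enc4 l`. -/
def digits4 (l : List Bool) : List Bool := l.foldl (fun a b => true :: b :: a) []

theorem PT.digits4 {E : Type} [Env E] {f : E → List Bool} (hf : PT f) :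
    PT (fun x => digits4 (f x)) :=
  foldl (f := fun (_ : E) a b => true :: b :: a) (fun b => (snd.cons b).cons true) 2
    (fun n m y e b _ _ h => by
    rw [Env.le_list] at *
    simp only [List.length_cons, Polynomial.eval_ofNat]
    omega) hf nil

/-- The base-4 digit `2 b + 1` has the two bits `true` and `b`, lowest first, so conversion needs no
arithmetic. -/
theorem ofBits_digits4 (l : List Bool) :
    (BNat.ofBits (digits4 l) : ℝ) = 4 ^ l.length * enc4 l := by
  have h : ∀ l a : List Bool, l.foldl (fun a b => true :: b :: a) a = digits4 l ++ a := by
    intro l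
    induction l with
    | nil => exact fun _ => rfl
    | cons b l ih =>
      intro a
      rw [List.foldl_cons, ih, show digits4 (b :: l) = digits4 l ++ [true, b] from ih [true, b]]
      simp
  have h' : ∀ b l, digits4 (b :: l) = digits4 l ++ [true] ++ [b] := fun b l => by
    rw [digits4, List.foldl_cons, h]; simp
  have hlen : ∀ l, (digits4 l).length = 2 * l.length := by
    intro l
    induction l with
    | nil => rfl
    | cons b l ih => rw [h']; simp [ih]; ring
  induction l with
  | nil => simp [digits4, enc4, BNat.ofBits]
  | cons b l ih =>
    rw [h', BNat.ofBits_concat, BNat.ofBits_concat]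
    simp only [Nat.cast_add, ih, List.length_append, hlen, enc4, List.length_cons]
    have : (2 : ℝ) ^ (2 * l.length) = 4 ^ l.length := by rw [pow_mul]; norm_num
    cases b <;> simp [pow_succ, this] <;> ring

theorem exists_common_denominator {ι : Type} [Fintype ι] (q : ι → ℚ) :
    ∃ D : ℕ, 0 < D ∧ ∀ i, ∃ z : ℤ, (D * q i : ℝ) = z := by
  refine ⟨∏ i, (q i).den, Finset.prod_pos fun i _ => (q i).den_pos, fun i => ?_⟩
  obtain ⟨k, hk⟩ := Finset.dvd_prod_of_mem (fun i => (q i).den) (Finset.mem_univ i)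
  refine ⟨k * (q i).num, ?_⟩
  have h₁ : ((q i).den : ℝ) ≠ 0 := by exact_mod_cast (q i).den_ne_zero
  rw [hk, Rat.cast_def]
  push_cast
  field_simp

/-- Positive and negative coefficients are summed separately; the truncated difference is the
`toNat` of the whole. -/
theorem PT.linB {E J : Type} [Env E] [Fintype J] (c : J → ℤ) {f : J → E → BNat}
    (hf : ∀ j, PT (f j)) : PT (fun x => BNat.mk (∑ j, c j * ((f j x).val : ℤ)).toNat) := by
  refine ((sumB Finset.univ fun j => constMulB (c j).toNat (hf j)).subB
    (sumB Finset.univ fun j => constMulB (-c j).toNat (hf j))).congr fun x => ?_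
  congr 1
  have : ∑ j, c j * ((f j x).val : ℤ) =
      (∑ j, (c j).toNat * (f j x).val : ℕ) - (∑ j, (-c j).toNat * (f j x).val : ℕ) := by
    push_cast
    rw [← Finset.sum_sub_distrib]
    refine Finset.sum_congr rfl fun j _ => ?_
    rw [← sub_mul]
    congr 1
    omega
  rw [this, Int.toNat_sub]

/-- Runs of a network with two close biases are close. -/
theorem abs_state_sub_le {m : ℕ} {V : ℕ → Fin (m + 1) → ℝ} {B : Fin (m + 1) → Fin (m + 1) → ℝ}
    {C r r' δ : ℝ} (hC : ∀ i, 1 + ∑ j, |B i j| ≤ C) (hr : |r - r'| ≤ δ) {x y : ℕ → Fin (m + 1) → ℝ}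
    (h₀ : x 0 = y 0)
    (hx : ∀ t i, x (t + 1) i = linSigmoid (V t i + (if i = 0 then r else 0) + ∑ j, B i j * x t j))
    (hy : ∀ t i, y (t + 1) i = linSigmoid (V t i + (if i = 0 then r' else 0) + ∑ j, B i j * y t j))
    (t : ℕ) (i : Fin (m + 1)) : |x t i - y t i| ≤ C ^ t * δ := by
  have hδ : 0 ≤ δ := (abs_nonneg _).trans hr
  have hC₁ : 1 ≤ C := le_trans (by
    linarith [Finset.sum_nonneg fun j (_ : j ∈ Finset.univ) => abs_nonneg (B 0 j)]) (hC 0)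
  induction t generalizing i with
  | zero => simpa [h₀] using hδ
  | succ t ih =>
    rw [hx, hy]
    refine (abs_linSigmoid_sub_le _ _).trans ?_
    have h₁ : |(if i = 0 then r else 0) - (if i = 0 then r' else 0)| ≤ δ := by
      split_ifs
      · exact hr
      · simpa using hδ
    have h₂ : |∑ j, B i j * x t j - ∑ j, B i j * y t j| ≤ (C - 1) * (C ^ t * δ) := by
      rw [← Finset.sum_sub_distrib]
      refine (Finset.abs_sum_le_sum_abs _ _).trans ?_
      calc ∑ j, |B i j * x t j - B i j * y t j| ≤ ∑ j, |B i j| * (C ^ t * δ) := by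
            refine Finset.sum_le_sum fun j _ => ?_
            rw [← mul_sub, abs_mul]
            exact mul_le_mul_of_nonneg_left (ih j) (abs_nonneg _)
        _ = (∑ j, |B i j|) * (C ^ t * δ) := by rw [Finset.sum_mul]
        _ ≤ _ := mul_le_mul_of_nonneg_right (by linarith [hC i]) (by positivity)
    -- The fresh error of the bias fits into the one unit by which `C` exceeds the row sums.
    have h₃ : δ ≤ C ^ t * δ := le_mul_of_one_le_left hδ (one_le_pow₀ hC₁)
    have h₄ := abs_add_le ((if i = 0 then r else 0) - (if i = 0 then r' else 0))
      (∑ j, B i j * x t j - ∑ j, B i j * y t j)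
    rw [show V t i + (if i = 0 then r else 0) + ∑ j, B i j * x t j -
      (V t i + (if i = 0 then r' else 0) + ∑ j, B i j * y t j) =
      ((if i = 0 then r else 0) - (if i = 0 then r' else 0)) +
      (∑ j, B i j * x t j - ∑ j, B i j * y t j) by ring, pow_succ]
    nlinarith

section Simulation

/-- The state of the simulation of a network: the activation values multiplied with a common
denominator, the denominator, the bias multiplied with the denominator, the rest of the input, and
the last answer. -/
abbrev SimState (m : ℕ) : Type := ((Fin (m + 1) → BNat) × (BNat × BNat)) × (List Bool × Bool)

variable {m : ℕ} (D : ℕ) (a : Fin (m + 1) → Fin 3 → ℤ) (b : Fin (m + 1) → Fin (m + 1) → ℤ)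
  (o : Fin 2 → Fin (m + 1) → ℤ)

/-- The summands of the activation of a cell. -/
def simTerm (z : SimState m) : Fin (m + 1) ⊕ Fin 4 → BNat :=
  Sum.elim z.1.1 ![if z.2.1.head?.getD false = true then z.1.2.1 else ⟨0⟩,
    if z.2.1 = [] then ⟨0⟩ else z.1.2.1, z.1.2.1, z.1.2.2]

/-- Over the new denominator the sigmoid is truncation to the range from 0 to the denominator:
`toNat` below, `min` above. -/
def simCells (z : SimState m) (i : Fin (m + 1)) : BNat :=
  ⟨min (∑ j, (Sum.elim (b i) ![a i 0, a i 1, a i 2, if i = 0 then (D : ℤ) else 0] : _ → ℤ) j *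
    ((simTerm z j).val : ℤ)).toNat (D * z.1.2.1.val)⟩

/-- Multiplying the denominator by `D` in each step keeps all values integral, and its length grows
only linearly. -/
def simUpdate (z : SimState m) : SimState m :=
  ((simCells D a b z, (⟨D * z.1.2.1.val⟩, ⟨D * z.1.2.2.val⟩)), (z.2.1.tail, z.2.2))

/-- The comparison is with `1 / 2`, inside the gap of the threshold; hence the factor 2. -/
def simTest (k : Fin 2) (z : SimState m) : Prop :=
  D * z.1.2.1.val ≤ (∑ j, 2 * o k j * ((z.1.1 j).val : ℤ)).toNat

open Classical in
noncomputable def simAnswer (z : SimState m) : SimState m :=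
  (z.1, (z.2.1, if simTest D o 1 z then decide (simTest D o 0 z) else z.2.2))

noncomputable def simStep (z : SimState m) : SimState m := simAnswer D o (simUpdate D a b z)

theorem PT.simStep : PT (simStep D a b o) := by
  classical
  have h₁ : ∀ j, PT (fun z : SimState m => z.1.1 j) := fun j => (apply j).comp fst.fst'
  have h₂ : PT (fun z : SimState m => z.1.2.1) := fst.snd'.fst'
  have h₃ : PT (fun z : SimState m => z.1.2.2) := fst.snd'.snd'
  have h₄ : PT (fun z : SimState m => z.2.1) := snd.fst'
  have h₅ : PT (fun z : SimState m => z.2.2) := snd.snd'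
  have hterm : ∀ j, PT (fun z : SimState m => simTerm z j) := by
    rintro (j | j)
    · exact h₁ j
    · fin_cases j
      · exact (h₄.head.eqBool (constBool true)).ite h₂ (constB 0)
      · exact h₄.isNil.ite (constB 0) h₂
      · exact h₂
      · exact h₃
  have hS := constMulB D h₂
  have hcells : PT (fun z : SimState m => simCells D a b z) := by
    refine pi fun i => ?_
    have hl := linB (Sum.elim (b i) ![a i 0, a i 1, a i 2, if i = 0 then (D : ℤ) else 0]) hterm
    refine ((hl.leB hS).ite hl hS).congr fun z => ?_
    rw [simCells]
    generalize Int.toNat _ = x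
    simp only
    rcases le_total x (D * z.1.2.1.val) with h | h
    · rw [min_eq_left h, if_pos h]
    · rw [min_eq_right h]
      split_ifs with h'
      · rw [le_antisymm h h']
      · rfl
  have htest : ∀ k, PT (fun z : SimState m => decide (simTest D o k z)) := fun k =>
    (hS.leB (linB (fun j => 2 * o k j) h₁)).congr fun z => decide_eq_decide.2 Iff.rfl
  have hu : PT (simUpdate D a b) := (hcells.pair (hS.pair (constMulB D h₃))).pair (h₄.tail.pair h₅)
  have ha : PT (simAnswer D o) := fst.pair (h₄.pair ((htest 1).ite (htest 0) h₅))
  exact ha.comp hu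

theorem bits_length_mono {x y : ℕ} (h : x ≤ y) : x.bits.length ≤ y.bits.length := by
  simp only [Nat.size_eq_bits_len]
  exact Nat.size_le_size h

theorem bits_length_mul_le (D x : ℕ) : (D * x).bits.length ≤ x.bits.length + D := by
  simp only [Nat.size_eq_bits_len]
  rw [Nat.size_le, add_comm, pow_add]
  exact Nat.mul_lt_mul'' Nat.lt_two_pow_self (Nat.lt_size_self x)

theorem PT.simRun {E : Type} [Env E] {k : E → ℕ} (hk : PT k) {z : E → SimState m} (hz : PT z) :
    PT (fun x => (_root_.simStep D a b o)^[k x] (z x)) := by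
  refine iter (f := fun (_ : E) z => _root_.simStep D a b o z) ((simStep D a b o).comp snd)
    (.C D + 1) (fun n m y z _ _ h => ?_) hk hz
  obtain ⟨⟨H, S, R⟩, l, q⟩ := z
  simp only [Env.le_prod, Env.le_pi, Env.le_bnat, Env.le_list, Env.le_bool] at h
  obtain ⟨⟨h₁, h₂, h₃⟩, h₄, h₅⟩ := h
  simp only [_root_.simStep, simAnswer, simUpdate, Env.le_prod, Env.le_pi, Env.le_bnat, Env.le_list,
    Env.le_bool, Polynomial.eval_add, Polynomial.eval_C, Polynomial.eval_one, List.length_tail]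
  have hS := bits_length_mul_le D S.val
  have hR := bits_length_mul_le D R.val
  refine ⟨⟨fun j => ?_, by omega, by omega⟩, by omega, by omega⟩
  have := bits_length_mono (min_le_right
    (∑ k, (Sum.elim (b j) ![a j 0, a j 1, a j 2, if j = 0 then (D : ℤ) else 0] : _ → ℤ) k *
    ((simTerm (((H, S, R), l, q) : SimState _) k).val : ℤ)).toNat (D * S.val))
  simp only [simCells]
  omega

variable {D a b o} {A : Fin (m + 1) → Fin 3 → ℝ} {B : Fin (m + 1) → Fin (m + 1) → ℝ}
  {O : Fin 2 → Fin (m + 1) → ℝ}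

theorem simStep_iterate (hD : 0 < D) (hA : ∀ i j, D * A i j = a i j) (hB : ∀ i j, D * B i j = b i j)
    {w : List Bool} {r : ℝ} {x : ℕ → Fin (m + 1) → ℝ}
    (hx : ∀ t i, x (t + 1) i = linSigmoid (A i 0 * RNN.input w t 0 + A i 1 * RNN.input w t 1 +
      A i 2 + (if i = 0 then r else 0) + ∑ j, B i j * x t j)) {z : SimState m}
    (hz₁ : ∀ i, ((z.1.1 i).val : ℝ) = z.1.2.1.val * x 0 i) (hz₂ : 0 < z.1.2.1.val)
    (hz₃ : (z.1.2.2.val : ℝ) = z.1.2.1.val * r) (hz₄ : z.2.1 = w) (t : ℕ) :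
    let z' := (simStep D a b o)^[t] z
    (∀ i, ((z'.1.1 i).val : ℝ) = z'.1.2.1.val * x t i) ∧ 0 < z'.1.2.1.val ∧
      (z'.1.2.2.val : ℝ) = z'.1.2.1.val * r ∧ z'.2.1 = w.drop t := by
  induction t with
  | zero => exact ⟨hz₁, hz₂, hz₃, hz₄⟩
  | succ t ih =>
    rw [Function.iterate_succ_apply']
    generalize (simStep D a b o)^[t] z = z at *
    obtain ⟨i₁, i₂, i₃, i₄⟩ := ih
    have hS : 0 < D * z.1.2.1.val := Nat.mul_pos hD i₂
    refine ⟨fun i => ?_, hS, ?_, ?_⟩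
    · have h₀ : ((simTerm z (.inr 0)).val : ℝ) = z.1.2.1.val * RNN.input w t 0 := by
        simp only [simTerm, Sum.elim_inr, Matrix.cons_val_zero, i₄, RNN.input]
        by_cases ht : t < w.length
        · rw [List.head?_drop, List.getElem?_eq_getElem ht, dif_pos ht]
          cases w[t] <;> simp
        · simp [ht, List.drop_of_length_le (not_lt.1 ht)]
      have h₁ : ((simTerm z (.inr 1)).val : ℝ) = z.1.2.1.val * RNN.input w t 1 := by
        simp only [simTerm, Sum.elim_inr, Matrix.cons_val_one, Matrix.cons_val_zero, i₄, RNN.input,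
          List.drop_eq_nil_iff]
        by_cases ht : t < w.length
        · simp [ht, not_le.2 ht]
        · simp [ht, not_lt.1 ht]
      have hZ : ((∑ j, (Sum.elim (b i) ![a i 0, a i 1, a i 2,
          if i = 0 then (D : ℤ) else 0] : _ → ℤ) j * ((simTerm z j).val : ℤ) : ℤ) : ℝ) =
          (D * z.1.2.1.val : ℕ) *
          (A i 0 * RNN.input w t 0 + A i 1 * RNN.input w t 1 + A i 2 +
            (if i = 0 then r else 0) + ∑ j, B i j * x t j) := by
        rw [Fintype.sum_sum_type, Fin.sum_univ_four]
        push_cast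
        have h₂ : ((simTerm z (.inr 2)).val : ℝ) = z.1.2.1.val := rfl
        have h₃ : ((simTerm z (.inr 3)).val : ℝ) = z.1.2.2.val := rfl
        have h₄ : ∀ j, ((simTerm z (.inl j)).val : ℝ) = z.1.2.1.val * x t j := fun j => i₁ j
        simp only [h₀, h₁, h₂, h₃, h₄, Sum.elim_inl, Sum.elim_inr, Matrix.cons_val, ← hA, ← hB, i₃]
        rw [mul_add, Finset.mul_sum, add_comm]
        congr 1
        · split_ifs <;> simp <;> ring
        · exact Finset.sum_congr rfl fun j _ => by ring
      have hS' : ((D * z.1.2.1.val : ℕ) : ℝ) ≠ 0 := by exact_mod_cast hS.ne'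
      have hσ := linSigmoid_div (z := ∑ j, (Sum.elim (b i) ![a i 0, a i 1, a i 2,
        if i = 0 then (D : ℤ) else 0] : _ → ℤ) j * ((simTerm z j).val : ℤ)) hS
      rw [hZ, mul_div_cancel_left₀ _ hS', ← hx, eq_div_iff hS', mul_comm] at hσ
      exact hσ.symm
    · simp only [simStep, simAnswer, simUpdate]
      push_cast
      rw [i₃]
      ring
    · simp only [simStep, simAnswer, simUpdate, i₄, List.tail_drop]

theorem simTest_iff (hD : 0 < D) (hO : ∀ i j, D * O i j = o i j) {x : Fin (m + 1) → ℝ}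
    {z : SimState m} (h₁ : ∀ i, ((z.1.1 i).val : ℝ) = z.1.2.1.val * x i) (h₂ : 0 < z.1.2.1.val)
    (k : Fin 2) :
    simTest D o k z ↔ 1 / 2 ≤ ∑ j, O k j * x j := by
  have hS : 0 < D * z.1.2.1.val := Nat.mul_pos hD h₂
  have hZ : ((∑ j, 2 * o k j * ((z.1.1 j).val : ℤ) : ℤ) : ℝ) =
      2 * ((D * z.1.2.1.val : ℕ) * ∑ j, O k j * x j) := by
    push_cast
    rw [Finset.mul_sum, Finset.mul_sum]
    refine Finset.sum_congr rfl fun j _ => ?_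
    rw [h₁, ← hO]
    ring
  have hS' : (0 : ℝ) < (D * z.1.2.1.val : ℕ) := by exact_mod_cast hS
  rw [simTest]
  generalize (∑ j, 2 * o k j * ((z.1.1 j).val : ℤ) : ℤ) = Z at *
  generalize D * z.1.2.1.val = S at *
  rw [show S ≤ Z.toNat ↔ (S : ℤ) ≤ Z by omega, ← Int.cast_le (R := ℝ), hZ, Int.cast_natCast]
  constructor <;> intro h <;> nlinarith

/-- The data bit is stored when the validation bit appears, which happens once up to time `T`, so it
is still there at the end of the clock. -/
theorem simStep_answer (hD : 0 < D) (hA : ∀ i j, D * A i j = a i j) (hB : ∀ i j, D * B i j = b i j)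
    (hO : ∀ i j, D * O i j = o i j) {w : List Bool} {r : ℝ} {x : ℕ → Fin (m + 1) → ℝ}
    (hx : ∀ t i, x (t + 1) i = linSigmoid (A i 0 * RNN.input w t 0 + A i 1 * RNN.input w t 1 +
      A i 2 + (if i = 0 then r else 0) + ∑ j, B i j * x t j)) {z : SimState m}
    (hz₁ : ∀ i, ((z.1.1 i).val : ℝ) = z.1.2.1.val * x 0 i) (hz₂ : 0 < z.1.2.1.val)
    (hz₃ : (z.1.2.2.val : ℝ) = z.1.2.1.val * r) (hz₄ : z.2.1 = w) {c : Bool} {τ T : ℕ} (hτ : 1 ≤ τ)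
    (h₁ : ∀ t < T, 1 / 2 ≤ ∑ j, O 1 j * x (t + 1) j ↔ t + 1 = τ)
    (h₀ : ∀ t < T, t + 1 = τ → (1 / 2 ≤ ∑ j, O 0 j * x (t + 1) j ↔ c = true)) :
    ∀ t ≤ T, τ ≤ t → ((simStep D a b o)^[t] z).2.2 = c := by
  intro t
  induction t with
  | zero => omega
  | succ t ih =>
    intro ht hτt
    obtain ⟨i₁, i₂, -, -⟩ :=
      simStep_iterate (o := o) hD hA hB hx hz₁ hz₂ hz₃ hz₄ (t + 1)
    rw [Function.iterate_succ_apply'] at i₁ i₂ ⊢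
    rw [simStep] at i₁ i₂ ⊢
    have htest := fun k =>
      simTest_iff (z := simUpdate D a b ((simStep D a b o)^[t] z)) hD hO i₁ i₂ k
    simp only [simAnswer, htest, h₁ t (by omega)]
    split_ifs with h
    · simp only [h₀ t (by omega) h, Bool.decide_eq_true]
    · exact ih (by omega) (by omega)

end Simulation

theorem PT.pow4 {E : Type} [Env E] {f : E → List Bool} (hf : PT f) :
    PT (fun x => BNat.mk (4 ^ (f x).length)) := by
  refine (((hf.mapBool fun _ => false).append (hf.mapBool fun _ => false)).append
    (constList [true])).ofBits.congr fun x => ?_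
  have h : ∀ l : List Bool, BNat.ofBits (l.map fun _ => false) = 0 := by
    intro l
    induction l with
    | nil => rfl
    | cons b l ih => rw [List.map_cons, BNat.ofBits, ih]; rfl
  rw [BNat.ofBits_concat, ← List.map_append, h]
  simp [← two_mul, pow_mul]

theorem half_le_iff_of_hardThreshold {v v' : ℝ} {b : Bool} (h : hardThreshold v = some b)
    (hv : |v - v'| ≤ 1 / 4) : 1 / 2 ≤ v' ↔ b = true := by
  rw [abs_le] at hv
  unfold hardThreshold at h
  split_ifs at h with h₁ h₂
  · obtain rfl : false = b := by simpa using h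
    simp only [Bool.false_eq_true, iff_false, not_le]
    linarith [hv.1]
  · obtain rfl : true = b := by simpa using h
    simp only [iff_true]
    linarith [hv.2]

/-- A network whose bias is given with sufficient precision can be simulated in polynomial time. -/
theorem RNN.IsANN.exists_pt {N : RNN} {s : ℕ → Bool} (hN : N.IsANN (delta4 s)) {L : Language Bool}
    [DecidablePred (· ∈ L)] {f : ℕ → ℕ} (hf : f ∈ poly) (hL : N.DecidesIn L f) :
    ∃ P : Polynomial ℕ, (∀ n, n ≤ P.eval n) ∧ ∃ d : List Bool × List Bool → List Bool, PT d ∧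
      ∀ w, d (w, prefixWord s (P.eval w.length)) = [decide (w ∈ L)] := by
  obtain ⟨⟨hin, hres, hout, hini⟩, hbias⟩ := hN
  obtain ⟨T, hT⟩ := exists_polynomial_of_mem_poly hf
  have hin' : ∀ i j, ∃ q : ℚ, (¬(i = 0 ∧ j = 2) → ∀ t, N.Win t i j = q) ∧
      ((i = 0 ∧ j = 2) → q = 0) := by
    intro i j
    by_cases hij : i = 0 ∧ j = 2
    · exact ⟨0, fun h => absurd hij h, fun _ => rfl⟩
    · exact (hin i j hij).imp fun q hq => ⟨fun _ => hq, fun h => absurd h hij⟩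
  choose A hA hA' using hin'
  choose B hB using hres
  choose O hO using hout
  choose h hh using hini
  obtain ⟨D, hD, hz⟩ := exists_common_denominator (ι := (((Fin (N.K + 1) × Fin 3) ⊕
    (Fin (N.K + 1) × Fin (N.K + 1))) ⊕ ((Fin 2 × Fin (N.K + 1)) ⊕ Fin (N.K + 1))))
    (Sum.elim (Sum.elim (fun i => A i.1 i.2) fun i => B i.1 i.2) (Sum.elim (fun i => O i.1 i.2) h))
  choose z hz using hz
  have hah : ∀ i, (D * h i : ℝ) = (z (.inr (.inr i))).toNat := by
    intro i
    have h₁ := hz (.inr (.inr i))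
    simp only [Sum.elim_inr] at h₁
    have h₂ : (0 : ℝ) ≤ h i := hh i ▸ (N.h₀_mem i).1
    have h₃ : (0 : ℝ) ≤ z (.inr (.inr i)) := h₁ ▸ by positivity
    rw [h₁]
    have h₄ : 0 ≤ z (.inr (.inr i)) := by exact_mod_cast h₃
    exact_mod_cast (Int.toNat_of_nonneg h₄).symm
  obtain ⟨C, hC⟩ := exists_nat_ge (1 + ∑ i, ∑ j, |(B i j : ℝ)| + ∑ i, ∑ j, |(O i j : ℝ)|)
  have hB₀ : 0 ≤ ∑ i, ∑ j, |(B i j : ℝ)| := by positivity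
  have hO₀ : 0 ≤ ∑ i, ∑ j, |(O i j : ℝ)| := by positivity
  have hCB : ∀ i, 1 + ∑ j, |(B i j : ℝ)| ≤ C := fun i => by
    have := Finset.single_le_sum (f := fun i => ∑ j, |(B i j : ℝ)|) (fun _ _ => by positivity)
      (Finset.mem_univ i)
    linarith
  have hCO : ∀ i, ∑ j, |(O i j : ℝ)| ≤ C := fun i => by
    have := Finset.single_le_sum (f := fun i => ∑ j, |(O i j : ℝ)|) (fun _ _ => by positivity)
      (Finset.mem_univ i)
    linarith
  -- Since `C ≤ 4 ^ C`, this precision keeps the output error below `1 / 4`. The summand `X` makes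
  -- `P n` tend to infinity.
  let P : Polynomial ℕ := .C C * (T + 2) + 1 + .X
  let z₀ : List Bool × List Bool → SimState N.K := fun x =>
    (((fun i => ⟨(z (.inr (.inr i))).toNat * 4 ^ x.2.length⟩), (⟨D * 4 ^ x.2.length⟩,
      ⟨D * BNat.ofBits (digits4 x.2)⟩)), (x.1, false))
  have hz₀ : PT z₀ := ((PT.pi fun i => PT.constMulB _ PT.snd.pow4).pair
    ((PT.constMulB D PT.snd.pow4).pair (PT.constMulB D PT.snd.digits4.ofBits))).pair
      (PT.fst.pair (PT.constBool false))
  refine ⟨P, fun n => by simp [P], fun x => [((simStep D (fun i j => z (.inl (.inl (i, j))))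
    (fun i j => z (.inl (.inr (i, j)))) (fun i j => z (.inr (.inl (i, j)))))^[T.eval x.1.length]
    (z₀ x)).2.2], (PT.simRun _ _ _ _ (PT.fst.length.polyEval T) hz₀).snd'.snd'.singleton,
    fun w => ?_⟩
  obtain ⟨τ, hτ, hτ₁, hans⟩ : ∃ τ ≤ T.eval w.length, N.Answers w (decide (w ∈ L)) τ := by
    by_cases hw : w ∈ L
    · obtain ⟨τ, h₁, h₂⟩ := (hL w).1 hw
      exact ⟨τ, h₁.trans (hT _), by simpa [hw] using h₂⟩
    · obtain ⟨τ, h₁, h₂⟩ := (hL w).2 hw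
      exact ⟨τ, h₁.trans (hT _), by simpa [hw] using h₂⟩
  let n := P.eval w.length
  let x : ℕ → Fin (N.K + 1) → ℝ := fun t => Nat.rec (fun i => (h i : ℝ)) (fun t x i =>
    linSigmoid (A i 0 * RNN.input w t 0 + A i 1 * RNN.input w t 1 + A i 2 +
      (if i = 0 then enc4 (prefixWord s n) else 0) + ∑ j, B i j * x j)) t
  have hy : ∀ t i, N.state w (t + 1) i = linSigmoid (A i 0 * RNN.input w t 0 +
      A i 1 * RNN.input w t 1 + A i 2 + (if i = 0 then delta4 s else 0) +
      ∑ j, B i j * N.state w t j) := by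
    intro t i
    rw [RNN.state]
    simp only [Matrix.mulVec, dotProduct, Fin.sum_univ_three, hB]
    rw [hA i 0 (by simp), hA i 1 (by simp)]
    by_cases hi : i = 0
    · subst hi
      rw [hbias, hA' 0 2 (by simp)]
      simp
    · rw [hA i 2 (by simp [hi])]
      simp [hi]
  have hclose := abs_state_sub_le (V := fun t i => A i 0 * RNN.input w t 0 +
      A i 1 * RNN.input w t 1 + A i 2) hCB (abs_delta4_sub_enc4_le s n) (x := N.state w) (y := x)
      (funext fun i => hh i) hy fun _ _ => rfl
  have hCC : (C : ℝ) ^ (T.eval w.length + 2) * (1 / 4) ^ n ≤ 1 / 4 := by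
    have h₁ : C ^ (T.eval w.length + 2) ≤ 4 ^ (C * (T.eval w.length + 2)) := by
      rw [pow_mul]
      refine Nat.pow_le_pow_left (Nat.lt_two_pow_self.le.trans ?_) _
      exact Nat.pow_le_pow_left (by norm_num) _
    have h₂ : n = C * (T.eval w.length + 2) + (w.length + 1) := by simp [n, P]; ring
    have h₃ : (C : ℝ) ^ (T.eval w.length + 2) ≤ 4 ^ (C * (T.eval w.length + 2)) := by
      exact_mod_cast h₁
    have h₀ : (1 / 4 : ℝ) ^ n =
        (4 ^ (C * (T.eval w.length + 2)))⁻¹ * (4 ^ w.length)⁻¹ * (1 / 4) := by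
      rw [h₂, pow_add, pow_succ, one_div, inv_pow, inv_pow, mul_assoc]
    rw [h₀, ← mul_assoc, ← mul_assoc]
    have h₄ : (C : ℝ) ^ (T.eval w.length + 2) * (4 ^ (C * (T.eval w.length + 2)))⁻¹ ≤ 1 := by
      rw [← div_eq_mul_inv]
      exact div_le_one_of_le₀ h₃ (by positivity)
    have h₅ : ((4 : ℝ) ^ w.length)⁻¹ ≤ 1 := inv_le_one_of_one_le₀ (one_le_pow₀ (by norm_num))
    have h₆ : (0 : ℝ) ≤ ((4 : ℝ) ^ w.length)⁻¹ := by positivity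
    nlinarith [mul_le_mul h₄ h₅ h₆ zero_le_one]
  have hC₁ : (1 : ℝ) ≤ C := by linarith
  have htest : ∀ t < T.eval w.length, ∀ k b, N.output w t k = some b →
      (1 / 2 ≤ ∑ j, (O k j : ℝ) * x (t + 1) j ↔ b = true) := by
    intro t ht k b hb
    refine half_le_iff_of_hardThreshold hb ?_
    simp only [Matrix.mulVec, dotProduct, hO]
    rw [← Finset.sum_sub_distrib]
    refine (Finset.abs_sum_le_sum_abs _ _).trans (le_trans ?_ hCC)
    calc ∑ j, |(O k j : ℝ) * N.state w (t + 1) j - O k j * x (t + 1) j|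
        ≤ ∑ j, |(O k j : ℝ)| * (C ^ (t + 1) * (1 / 4) ^ n) := by
          refine Finset.sum_le_sum fun j _ => ?_
          rw [← mul_sub, abs_mul]
          exact mul_le_mul_of_nonneg_left (hclose (t + 1) j) (abs_nonneg _)
      _ = (∑ j, |(O k j : ℝ)|) * (C ^ (t + 1) * (1 / 4) ^ n) := by rw [Finset.sum_mul]
      _ ≤ C * (C ^ (t + 1) * (1 / 4) ^ n) := mul_le_mul_of_nonneg_right (hCO k) (by positivity)
      _ = C ^ (t + 2) * (1 / 4) ^ n := by ring
      _ ≤ _ := mul_le_mul_of_nonneg_right (pow_le_pow_right₀ hC₁ (by omega)) (by positivity)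
  have hlen : (prefixWord s n).length = n := prefixWord_length s n
  dsimp only
  refine congrArg (fun b => [b]) (simStep_answer (A := fun i j => A i j) (B := fun i j => B i j)
    (O := fun i j => O i j) (x := x) (w := w) (r := enc4 (prefixWord s n)) (τ := τ) hD
    (fun i j => hz (.inl (.inl (i, j)))) (fun i j => hz (.inl (.inr (i, j))))
    (fun i j => hz (.inr (.inl (i, j)))) (fun _ _ => rfl) (fun i => ?_) ?_ ?_ rfl hτ₁
    (fun t ht => ?_) (fun t ht e => ?_) _ le_rfl hτ)
  · have e : ∀ k : ℕ, (((z (.inr (.inr i))).toNat * 4 ^ k : ℕ) : ℝ) = (D * 4 ^ k : ℕ) * h i :=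
      fun k => by
        push_cast
        rw [← hah i]
        ring
    exact e _
  · exact Nat.mul_pos hD (by positivity)
  · simp only [z₀]
    push_cast
    rw [ofBits_digits4]
    ring
  · by_cases e : t + 1 = τ
    · rw [htest t ht 1 true (by rw [hans, if_pos e]; rfl)]
      simp [e]
    · rw [htest t ht 1 false (by rw [hans, if_neg e]; rfl)]
      simp [e]
  · exact htest t ht 0 _ (by rw [hans, if_pos e]; rfl)

theorem prefixWord_of_prefix {β : ℕ → Bool} {a : List Bool} {n : ℕ} (h : a <+: prefixWord β n) :
    a = prefixWord β a.length := by
  have h₁ := List.prefix_iff_eq_take.1 h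
  have h₂ := h.length_le
  rw [prefixWord_length] at h₂
  rwa [take_prefixWord, min_eq_left h₂] at h₁

/-- The advice is a prefix of the word `β` that makes the universal machine print the bias. Every
longer prefix yields the same digits within the same time, so the simulation gives the same answer.
-/
theorem classANN_subset_adviceStarClass {U : Machine (Fin 2)} {𝓕 : Set (ℕ → ℕ)}
    (h𝓕 : IsReasonable 𝓕) :
    classANN (KolmogorovReals U 𝓕 poly) poly ⊆ adviceStarClass classP 𝓕 := by
  classical
  rintro L ⟨_, ⟨s, ⟨f, hf, g, hg, β, hβ⟩, rfl⟩, T, hT, N, hN, hL⟩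
  obtain ⟨P, hP, d, hd, hd'⟩ := hN.exists_pt hT hL
  obtain ⟨Q, hQ⟩ := exists_polynomial_of_mem_poly hg
  -- For inputs of length `n`, `P n` digits are needed, hence `f (P n)` letters of `β`.
  obtain ⟨F, hF, hfF⟩ := h𝓕.comp_poly f hf _ (eval_mem_poly P)
  have hx : PT (fun (z : List Bool × List Bool) => ![z.2, unary (P.eval z.1.length)]) := by
    refine PT.pi fun i => ?_
    fin_cases i
    · exact PT.snd
    · exact (PT.fst.length.polyEval P).unary
  obtain ⟨u, hu, hu'⟩ := PT.exists_sim U hx ((PT.fst.length.polyEval P).polyEval Q)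
  have hev : ∀ᶠ n in atTop, ∀ m ≥ F n, ∀ w : List Bool, w.length = n →
      u (w, prefixWord β m) = prefixWord s (P.eval n) := by
    have hPt : Tendsto (fun n => P.eval n) atTop atTop := tendsto_atTop_mono hP tendsto_id
    filter_upwards [hPt.eventually hβ, hfF] with n h₁ h₂ m hm w hw
    refine hu' (w, prefixWord β m) _ ?_
    simp only [hw]
    exact (h₁ m (h₂.trans hm)).mono (hQ _)
  obtain ⟨n₀, hn₀⟩ := eventually_atTop.1 hev
  have hpair : PT unpairWord := PT.unpairWord PT.id
  -- Below `n₀` the digits may be wrong, and the answers come from a finite table that ignores the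
  -- advice.
  let L' : Language Bool := langOf fun v => if (unpairWord v).1.length < n₀ then
    [decide ((unpairWord v).1 ∈ L)] else d ((unpairWord v).1, u (unpairWord v))
  have hL' : L' ∈ classP := langOf_mem_classP (PT.patch n₀ (fun w => decide (w ∈ L)) hpair.fst'
    (hd.comp (hpair.fst'.pair (hu.comp hpair))))
  have hFm := h𝓕.monotone F hF
  have key : ∀ w m, F w.length ≤ m → (pairWord w (prefixWord β m) ∈ L' ↔ w ∈ L) := by
    intro w m hm
    simp only [L', mem_langOf, unpairWord_pairWord]
    split_ifs with hw
    · simp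
    · rw [hn₀ _ (not_lt.1 hw) m hm w rfl, hd']
      simp
  refine ⟨F, hF, L', hL', fun n => prefixWord β (F n),
    ⟨fun m n hmn => prefixWord_prefix β (hFm hmn), fun n => prefixWord_length β _⟩, ?_⟩
  rintro n w rfl
  refine ⟨(key w _ le_rfl).symm, fun k _ a ha ha' => ?_⟩
  have hl := ha.length_le
  rw [prefixWord_length] at hl
  rw [prefixWord_of_prefix ha', key w _ le_rfl, key w _ hl]

theorem mainTheorem2 (U : Machine (Fin 2)) (hU : U.IsUniversal)
    (𝓕 : Set (ℕ → ℕ)) (h𝓕 : IsReasonable 𝓕)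
    (hunb : ∀ c : ℕ, ∃ f ∈ 𝓕, ∀ᶠ n in atTop, c ≤ f n) :
    adviceStarClass classP 𝓕 = classANN (KolmogorovReals U 𝓕 poly) poly ∧
    classANN (KolmogorovReals U 𝓕 poly) poly = classENN (KolmogorovWords U 𝓕 poly) poly ∧
    ((∀ f ∈ 𝓕, PolyTimeComputable f) →
      weakAdviceStarClass classP 𝓕 = adviceStarClass classP 𝓕) := by
  have h₁ := adviceStarClass_subset_classENN hU h𝓕 hunb
  have h₂ : classENN (KolmogorovWords U 𝓕 poly) poly ⊆ classANN (KolmogorovReals U 𝓕 poly) poly :=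
    classENN_subset_classANN _
  have h₃ := classANN_subset_adviceStarClass (U := U) h𝓕
  exact ⟨(h₁.trans h₂).antisymm h₃, (h₃.trans h₁).antisymm h₂, weakAdviceStarClass_eq⟩
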